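/- Let $d\ge 0$ be an integer, let $A=\mathbb{Z}[x_1,\dots,x_d]/\mathfrak{m}^2$ with $\mathfrak{m}=(x_1,\dots,x_d)$, and let all tensor products be over $\mathbb{Z}$. For $n\ge 0$ define on $A^{\otimes n+1}$ the maps $d_i(a_0\otimes\cdots\otimes a_n)=a_0\otimes\cdots\otimes a_ia_{i+1}\otimes\cdots\otimes a_n$ ($0\le i<n$), $d_n(a_0\otimes\cdots\otimes a_n)=a_na_0\otimes a_1\otimes\cdots\otimes a_{n-1}$, $b_n=\sum_{i=0}^{n}(-1)^id_i$, $b'_n=\sum_{i=0}^{n-1}(-1)^id_i$, $t_n(a_0\otimes\cdots\otimes a_n)=(-1)^n a_n\otimes a_0\otimes\cdots\otimes a_{n-1}$ and $N_n=1+t_n+\cdots+t_n^n$. The cyclic homology of $A$ is the homology of the total complex of the first quadrant double complex whose entry in column $p\ge 0$ and row $q\ge 0$ is $A^{\otimes q+1}$, with vertical maps $b$ in the even columns and $b'$ in the odd columns (with the usual sign $(-1)^p$ in the total complex), and with horizontal maps $1-t_q$ out of the odd columns and $N_q$ out of the even columns $p>0$. The weight of a tensor monomial $a_0\otimes\cdots\otimes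 a_n$ with all $a_i\in\{1,x_1,\dots,x_d\}$ is the number of $i$ with $a_i\in\{x_1,\dots,x_d\}$; all the maps above preserve weight, and $HC_n^{(w)}(A)$, for $n,w\ge 0$, denotes the $n$-th homology group of the subcomplex of the total complex spanned by the tensor monomials of weight $w$. For $m\ge 1$ let $\omega_{m,d}$ be the set of orbits, under cyclic rotation, of those words of length $m$ in the letters $x_1,\dots,x_d$ for which $m$ is the least positive number of rotations by one place that gives back the word (primitive necklaces of length $m$). Then, as abelian groups, $$HC_n^{(0)}(A)\cong\begin{cases}\mathbb{Z} & n\ge 0 \text{ even},\\ 0 & n \text{ odd},\end{cases}$$ and for every $w>0$ $$HC_n^{(w)}(A)\cong\begin{cases} 0 & 0\le n\le w-2,\\[4pt] \Big(\bigoplus_{m\mid w,\ m\equiv w\,(2)}\ \bigoplus_{\omega_{m,d}}\mathbb{Z}\Big)\oplus\Big(\bigoplus_{m\mid w,\ m\not\equiv w\,(2)}\ \bigoplus_{\omega_{m,d}}\mathbb{Z}/2\Big) & n=w-1,\\[4pt] \bigoplus_{m\mid w,\ m\equiv w\,(2)}\ \bigoplus_{\omega_{m,d}}\mathbb{Z}/(w/m)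 & n=w+2i,\ i\ge 0,\\[4pt] \bigoplus_{m\mid w,\ m\not\equiv w\,(2)}\ \bigoplus_{\omega_{m,d}}\mathbb{Z}/2 & n=w+1+2i,\ i\ge 0, \end{cases}$$ where $m$ runs over the positive divisors of $w$. Moreover, for every $m\ge 1$, $$|\omega_{m,d}|=\frac1m\sum_{i\mid m}\mu(m/i)\,d^{\,i},$$ where $\mu$ is the Möbius function. -/

import Mathlib

open scoped TensorProduct DirectSum

noncomputable section

namespace CyclicHom

/-! ### The Hochschild and bar boundaries, the cyclic operator and the norm -/

section General

variable (k A : Type*) [CommRing k] [Ring A] [Algebra k A]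

/-- `Chain k A n` is `A^{⊗ (n+1)}` over `k`, the degree `n` part of the Hochschild complex. -/
abbrev Chain (n : ℕ) : Type _ := ⨂[k] (_ : Fin (n + 1)), A

variable {A} in
/-- Changing one entry of `a` changes one entry of the contracted tuple, in a linear way. -/
theorem contractNth_update {n : ℕ} (j : Fin (n + 1)) (i : Fin (n + 2)) (a : Fin (n + 2) → A) :
    ∃ (l : Fin (n + 1)) (f : A →ₗ[k] A), ∀ x : A,
      Fin.contractNth j.castSucc (· * ·) (Function.update a i x) =
        Function.update (Fin.contractNth j.castSucc (· * ·) a) l (f x) := by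
  rcases lt_trichotomy i.val j.val with h | h | h
  · refine ⟨⟨i, by omega⟩, LinearMap.id, fun x => ?_⟩
    ext l
    simp only [Fin.contractNth, Function.update_apply, Fin.ext_iff, Fin.val_castSucc, Fin.val_succ,
      LinearMap.id_apply]
    grind
  · refine ⟨j, LinearMap.mulRight k (a j.succ), fun x => ?_⟩
    ext l
    simp only [Fin.contractNth, Function.update_apply, Fin.ext_iff, Fin.val_castSucc, Fin.val_succ,
      LinearMap.mulRight_apply]
    grind
  · by_cases h' : i.val = j.val + 1
    · refine ⟨j, LinearMap.mulLeft k (a j.castSucc), fun x => ?_⟩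
      ext l
      simp only [Fin.contractNth, Function.update_apply, Fin.ext_iff, Fin.val_castSucc,
        Fin.val_succ, LinearMap.mulLeft_apply]
      grind
    · refine ⟨⟨i - 1, by omega⟩, LinearMap.id, fun x => ?_⟩
      ext l
      simp only [Fin.contractNth, Function.update_apply, Fin.ext_iff, Fin.val_castSucc,
        Fin.val_succ, LinearMap.id_apply]
      grind

/-- The multilinear map `(a₀, …, a_{n+1}) ↦ a₀ ⊗ ⋯ ⊗ a_j a_{j+1} ⊗ ⋯ ⊗ a_{n+1}`, `0 ≤ j ≤ n`. -/
def faceMultilinear (n : ℕ) (j : Fin (n + 1)) :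
    MultilinearMap k (fun _ : Fin (n + 2) => A) (Chain k A n) :=
  MultilinearMap.mk' (fun a => PiTensorProduct.tprod k (Fin.contractNth j.castSucc (· * ·) a))
    (fun a i x y => by
      obtain ⟨l, f, h⟩ := contractNth_update k j i a
      simp only [h, map_add, MultilinearMap.map_update_add])
    (fun a i c x => by
      obtain ⟨l, f, h⟩ := contractNth_update k j i a
      simp only [h, map_smul, MultilinearMap.map_update_smul])

/-- The face map `d_j : A^{⊗ (n+2)} → A^{⊗ (n+1)}` for `0 ≤ j ≤ n`. -/
def face (n : ℕ) (j : Fin (n + 1)) : Chain k A (n + 1) →ₗ[k] Chain k A n :=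
  PiTensorProduct.lift (faceMultilinear k A n j)

/-- The unsigned rotation `a₀ ⊗ ⋯ ⊗ a_n ↦ a_n ⊗ a₀ ⊗ ⋯ ⊗ a_{n-1}`. -/
def rot (n : ℕ) : Chain k A n →ₗ[k] Chain k A n :=
  (PiTensorProduct.reindex k (fun _ : Fin (n + 1) => A) (finRotate (n + 1))).toLinearMap

/-- The last face map `d_{n+1} (a₀ ⊗ ⋯ ⊗ a_{n+1}) = a_{n+1} a₀ ⊗ a₁ ⊗ ⋯ ⊗ a_n`. -/
def lastFace (n : ℕ) : Chain k A (n + 1) →ₗ[k] Chain k A n :=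
  face k A n 0 ∘ₗ rot k A (n + 1)

/-- The boundary `b'_{n+1} = ∑_{0 ≤ j ≤ n} (-1)^j d_j` of the bar complex. -/
def barB (n : ℕ) : Chain k A (n + 1) →ₗ[k] Chain k A n :=
  ∑ j : Fin (n + 1), (-1 : k) ^ (j : ℕ) • face k A n j

/-- The Hochschild boundary `b_{n+1} = ∑_{0 ≤ j ≤ n+1} (-1)^j d_j`. -/
def hochB (n : ℕ) : Chain k A (n + 1) →ₗ[k] Chain k A n :=
  barB k A n + (-1 : k) ^ (n + 1) • lastFace k A n

/-- The cyclic operator `t_n (a₀ ⊗ ⋯ ⊗ a_n) = (-1)^n a_n ⊗ a₀ ⊗ ⋯ ⊗ a_{n-1}`. -/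
def cyc (n : ℕ) : Chain k A n →ₗ[k] Chain k A n := (-1 : k) ^ n • rot k A n

/-- The norm `N_n = 1 + t_n + ⋯ + t_n^n`. -/
def cycNorm (n : ℕ) : Chain k A n →ₗ[k] Chain k A n := ∑ i ∈ Finset.range (n + 1), cyc k A n ^ i

theorem face_tprod (n : ℕ) (j : Fin (n + 1)) (a : Fin (n + 2) → A) :
    face k A n j (PiTensorProduct.tprod k a) =
      PiTensorProduct.tprod k (Fin.contractNth j.castSucc (· * ·) a) :=
  PiTensorProduct.lift.tprod a

theorem rot_tprod (n : ℕ) (a : Fin (n + 1) → A) :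
    rot k A n (PiTensorProduct.tprod k a) =
      PiTensorProduct.tprod k (Fin.cons (a (Fin.last n)) (Fin.init a) : Fin (n + 1) → A) := by
  simp only [rot, LinearEquiv.coe_coe, PiTensorProduct.reindex_tprod]
  congr 1
  funext i
  refine Fin.cases ?_ (fun i => ?_) i
  · rw [Fin.cons_zero]
    congr 1
  · rw [Fin.cons_succ, Fin.init]
    congr 1
    rw [Equiv.symm_apply_eq, finRotate_apply]
    simp

theorem lastFace_tprod (n : ℕ) (a : Fin (n + 2) → A) :
    lastFace k A n (PiTensorProduct.tprod k a) =
      PiTensorProduct.tprod k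
        (Fin.cons (a (Fin.last (n + 1)) * a 0) (fun i : Fin n => a i.succ.castSucc) :
          Fin (n + 1) → A) := by
  rw [lastFace, LinearMap.comp_apply, rot_tprod, face_tprod]
  congr 1
  funext i
  refine Fin.cases ?_ (fun i => ?_) i
  · simp [Fin.contractNth, Fin.init]
  · simp [Fin.contractNth, Fin.init]

/-! ### The cyclic (Tsygan) bicomplex -/

/-- The horizontal map of the cyclic bicomplex from column `p + 1` to column `p`, in row `q`:
`1 - t_q` out of odd columns and `N_q` out of even columns. -/
def horiz (p q : ℕ) : Chain k A q →ₗ[k] Chain k A q :=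
  if Even p then LinearMap.id - cyc k A q else cycNorm k A q

/-- The vertical map of the cyclic bicomplex from row `q + 1` to row `q`, in column `p`:
`b` in even columns and `b'` in odd columns. -/
def vert (p q : ℕ) : Chain k A (q + 1) →ₗ[k] Chain k A q :=
  if Even p then hochB k A q else barB k A q

/-- Families of elements of the entries of the cyclic bicomplex; the entry in column `p` and
row `q`, of total degree `p + q`, is `A^{⊗ (q+1)}`. The degree `n` part of the total complex
consists of the families that vanish outside the finitely many entries with `p + q = n`. -/
abbrev Tot : Type _ := (pq : ℕ × ℕ) → Chain k A pq.2

/-- The differential of the total complex of the cyclic bicomplex, in all degrees at once. On the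
entry in column `p` and row `q` it is the horizontal map plus `(-1)^p` times the vertical map; so
the value in the entry `(p, q)` comes from the entries `(p + 1, q)` and `(p, q + 1)`. -/
def totD : Tot k A →ₗ[k] Tot k A :=
  LinearMap.pi fun pq =>
    horiz k A pq.1 pq.2 ∘ₗ LinearMap.proj (pq.1 + 1, pq.2) +
      (-1 : k) ^ pq.1 • (vert k A pq.1 pq.2 ∘ₗ LinearMap.proj (pq.1, pq.2 + 1))

end General

/-! ### The algebra `k[x₁, …, x_d] / (x₁, …, x_d)²` and the weight grading -/

section Weight

variable (k : Type*) [CommRing k] (d : ℕ)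

/-- The ring `k[x₁, …, x_d] / 𝔪²` with `𝔪 = (x₁, …, x_d)`. -/
abbrev Alg : Type _ :=
  MvPolynomial (Fin d) k ⧸ (Ideal.span (Set.range (MvPolynomial.X (R := k) (σ := Fin d)))) ^ 2

/-- The monomials `1` and `x₁, …, x_d` of `k[x₁, …, x_d] / 𝔪²`. -/
def letter : Option (Fin d) → Alg k d
  | none => 1
  | some j => Ideal.Quotient.mk _ (MvPolynomial.X j)

/-- The weight `w` part of `A^{⊗ (n+1)}`: the span of the tensor monomials
`a₀ ⊗ ⋯ ⊗ a_n`, `a_i ∈ {1, x₁, …, x_d}`, in which exactly `w` entries are variables. -/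
def weightPart (n w : ℕ) : Submodule k (Chain k (Alg k d) n) :=
  Submodule.span k
    {y | ∃ u : Fin (n + 1) → Option (Fin d),
      (Finset.univ.filter fun i => u i ≠ none).card = w ∧
        y = PiTensorProduct.tprod k fun i => letter k d (u i)}

/-- The weight `w` part of the total complex in degree `n`: all entries outside `p + q = n` vanish
and the others have weight `w`. -/
def totWeight (n w : ℕ) : Submodule k (Tot k (Alg k d)) :=
  ⨅ pq : ℕ × ℕ,
    (if pq.1 + pq.2 = n then weightPart k d pq.2 w else ⊥).comap
      (LinearMap.proj pq)

/-- The cycles of degree `n` and weight `w`. -/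
def cycles (n w : ℕ) : Submodule k (Tot k (Alg k d)) :=
  totWeight k d n w ⊓ LinearMap.ker (totD k (Alg k d))

/-- The boundaries of degree `n` and weight `w`. -/
def boundaries (n w : ℕ) : Submodule k (Tot k (Alg k d)) :=
  (totWeight k d (n + 1) w).map (totD k (Alg k d))

/-- The weight `w` part `HC_n^{(w)}` of the cyclic homology of `k[x₁, …, x_d] / 𝔪²` over `k`:
the degree `n` homology of the weight `w` subcomplex of the total complex. -/
abbrev HC (n w : ℕ) : Type _ :=
  cycles k d n w ⧸ (boundaries k d n w).submoduleOf (cycles k d n w)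

end Weight

/-! ### Cycle families of words -/

section Words

/-- The rotation `x_{j₁} ⋯ x_{j_m} ↦ x_{j_m} x_{j₁} ⋯ x_{j_{m-1}}` of words of length `m`. -/
def wordRot (m d : ℕ) (u : Fin m → Fin d) : Fin m → Fin d := fun i => u ((finRotate m).symm i)

/-- The cycle length of a word: the least `c > 0` such that `c` rotations give back the word. -/
def cycleLength (m d : ℕ) (u : Fin m → Fin d) : ℕ := Function.minimalPeriod (wordRot m d) u

/-- The cycle family of a word: the set of all its rotations. -/
def cycleFamily (m d : ℕ) (u : Fin m → Fin d) : Set (Fin m → Fin d) :=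
  {v | ∃ n : ℕ, v = (wordRot m d)^[n] u}

/-- `ω_{m,d}`: the cycle families of words of length `m` and cycle length `m` in `d` letters. -/
def omega (m d : ℕ) : Set (Set (Fin m → Fin d)) :=
  {F | ∃ u : Fin m → Fin d, cycleLength m d u = m ∧ F = cycleFamily m d u}

end Words

end CyclicHom

end

noncomputable section

namespace CyclicHom

/-! ### The free module on words -/

section Words

variable {α : Type*}

/-! The tensor monomials in `1, x₁, …, x_d` form a basis of `A^{⊗(n+1)}`, so the bicomplex is a
complex of words in which `1·a = a` and `x_i x_j = 0`, and weight counts the variables.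

Degenerate words contribute nothing. In the bar complex, a run of k units strictly between two fixed
letters is shortened by k + 1 faces with alternating signs, which cancel for k odd and leave one
term for k even. A run thus behaves like a complex with differentials 0, 1, 0, 1, …, contractible in
positive length, and lengthening the first odd run by one is a contracting homotopy
(`bar_growTail_add`). It touches neither end letter, so it survives multiplying the ends together
and contracts the part of the Hochschild complex spanned by words with a `1` after the first letter
(`hochL_growList_add`). Each odd column of the bicomplex is contracted by `1 ⊗ -`, so a pair of
columns 2i, 2i+1 reduces to one Hochschild complex, and an induction over the pairs
(`exists_famD_eq`) makes a cycle a boundary once its nondegenerate part is zero. The only identities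
of the bicomplex needed are `b(1-t) = (1-t)b'`, `b'N = Nb` and `(1-t)N = N(1-t) = 0`; the first two
follow by writing `b` and `b'` as sums of conjugates `tⁱ d₀ t⁻ⁱ`.

In weight w > 0 the nondegenerate words are the words of length w in the variables, and `1` followed
by such a word. The former make up the lowest row that is nonzero in weight w; all vertical maps out
of it vanish because `x_i x_j = 0`. The total complex retracts onto this row (`phi`, `phi_famD`,
`exists_famD_iff`), so the homology in degree n is that of the row in column n + 1 - w. In weight 0
only the word `1` is nondegenerate, and it gives one ℤ in each even degree.

The row is the periodic complex, with maps `1 - t` and `N`, of the cyclic group of order w acting on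
words by rotation with sign ε = (-1)^(w+1). It splits over orbits. Going once around an orbit of
length m gives the sign ε^m, which is 1 exactly when m ≡ w mod 2. For sign 1 the coinvariants are ℤ,
the invariants modulo norms are ℤ/(w/m), and the kernel of `N` modulo the image of `1 - t` is 0; for
sign -1 these groups are ℤ/2, 0 and ℤ/2. A word of least period m is the repetition of a primitive
word of length m, so the orbits of length m are the elements of `omega m d`. Counting all words by
orbits gives ∑_{m∣w} m |ω_{m,d}| = d^w, and Möbius inversion gives the last formula. -/

/-- The free abelian group on words in the letters `1` (`none`) and `x` (`some x`). -/
abbrev Wd (α : Type*) : Type _ := List (Option α) →₀ ℤ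

/-- A word as a basis element. -/
def ww (l : List (Option α)) : Wd α := Finsupp.single l 1

/-- The linear extension of a function on words. -/
def lin (f : List (Option α) → Wd α) : Wd α →ₗ[ℤ] Wd α := Finsupp.linearCombination ℤ f

@[simp] theorem lin_ww (f : List (Option α) → Wd α) (l) : lin f (ww l) = f l := by
  simp [lin, ww]

theorem wd_ext {N : Type*} [AddCommGroup N] {f g : Wd α →ₗ[ℤ] N}
    (h : ∀ l, f (ww l) = g (ww l)) : f = g :=
  Finsupp.lhom_ext' fun l => LinearMap.ext_ring (h l)

/-- Prepend a letter. -/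
def cns (a : Option α) : Wd α →ₗ[ℤ] Wd α := lin fun l => ww (a :: l)

/-- Append a letter. -/
def snc (a : Option α) : Wd α →ₗ[ℤ] Wd α := lin fun l => ww (l ++ [a])

@[simp] theorem cns_ww (a : Option α) (l) : cns a (ww l) = ww (a :: l) := lin_ww _ _

@[simp] theorem snc_ww (a : Option α) (l) : snc a (ww l) = ww (l ++ [a]) := lin_ww _ _

/-- Multiply the first letter of a word by `a` on the left. -/
def mulHead : Option α → List (Option α) → Wd α
  | _, [] => 0
  | none, b :: l => ww (b :: l)
  | some a, none :: l => ww (some a :: l)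
  | some _, some _ :: _ => 0

@[simp] theorem mulHead_nil (a : Option α) : mulHead a [] = 0 := by cases a <;> rfl

@[simp] theorem mulHead_none (b : Option α) (l) : mulHead none (b :: l) = ww (b :: l) := rfl

@[simp] theorem mulHead_some_none (a : α) (l) : mulHead (some a) (none :: l) = ww (some a :: l) :=
  rfl

@[simp] theorem mulHead_some_some (a b : α) (l) : mulHead (some a) (some b :: l) = 0 := rfl

@[simp] theorem mulHead_cons_none (a : Option α) (l) : mulHead a (none :: l) = ww (a :: l) := by
  cases a <;> rfl

/-- The zeroth face, multiplying the first two letters. -/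
def dzero : List (Option α) → Wd α
  | [] => 0
  | a :: l => mulHead a l

/-- The boundary `b'` on words. -/
def bar : List (Option α) → Wd α
  | [] => 0
  | a :: l => mulHead a l - cns a (bar l)

/-- Whether the number of leading units, not counting the last letter of the word, is even. -/
def evenLead : List (Option α) → Bool
  | [] => false
  | none :: l => !evenLead l
  | some _ :: _ => true

/-- Lengthen the first block of units by one when its length is odd; the last letter of the word is
left alone. -/
def grow : List (Option α) → Wd α
  | [] => 0
  | none :: l => if evenLead l then ww (none :: none :: l) else 0
  | some x :: l => - cns (some x) (grow l)

/-- `grow` on the part of the word after the first letter. -/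
def growTail : List (Option α) → Wd α
  | [] => 0
  | a :: l => cns a (grow l)

theorem grow_none_cns_some (x : α) (m : Wd α) :
    lin grow (cns none (cns (some x) m)) = cns none (cns none (cns (some x) m)) := by
  have : lin grow ∘ₗ cns none ∘ₗ cns (some x) = cns none ∘ₗ cns none ∘ₗ cns (some x) :=
    wd_ext fun l => by simp [grow, evenLead]
  exact LinearMap.congr_fun this m

theorem grow_none_none_cns_some (x : α) (m : Wd α) :
    lin grow (cns none (cns none (cns (some x) m))) = 0 := by
  have : lin grow ∘ₗ cns none ∘ₗ cns none ∘ₗ cns (some x) = 0 :=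
    wd_ext fun l => by simp [grow, evenLead]
  exact LinearMap.congr_fun this m

theorem grow_none_none_none (m : Wd α) :
    lin grow (cns none (cns none (cns none m))) = cns none (cns none (lin grow (cns none m))) := by
  have : lin grow ∘ₗ cns none ∘ₗ cns none ∘ₗ cns none =
      cns none ∘ₗ cns none ∘ₗ lin grow ∘ₗ cns (none : Option α) :=
    wd_ext fun l => by
      simp only [LinearMap.comp_apply, cns_ww, lin_ww, grow, evenLead, Bool.not_not]
      split_ifs <;> simp
  exact LinearMap.congr_fun this m

/-- Since `x·1 = x` and `x·y = 0`, each face of a word starting with `x` either keeps `x` in front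
or vanishes. -/
theorem bar_some_eq (x : α) (l) : ∃ m : Wd α, bar (some x :: l) = cns (some x) m := by
  rcases l with _ | ⟨_ | y, l⟩
  · exact ⟨0, by simp [bar]⟩
  · exact ⟨ww l - bar (none :: l), by rw [bar, map_sub]; simp⟩
  · exact ⟨- bar (some y :: l), by rw [bar]; simp⟩

/-- The first two faces cancel, as a unit multiplied into the next letter just disappears. The
correction is for the word `1 ⊗ 1`, which has only one face. -/
theorem bar_none_none (l : List (Option α)) :
    bar (none :: none :: l) = cns none (cns none (bar l)) + (if l = [] then ww [none] else 0) := by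
  rcases l with _ | ⟨b, l⟩
  · simp [bar]
  · rw [bar, bar]; simp

/-- Let `l` start with k units, its last letter not counted. The k faces touching them alternate in
sign: for k even they cancel, for k odd they leave one word with k - 1 units. Prefixing `1` changes
the parity, so `grow` acts on every term in the first case and only on that one in the second. -/
theorem grow_none_bar : ∀ l : List (Option α), l ≠ [] →
    lin grow (cns none (bar l)) =
      if evenLead l then cns none (cns none (bar l)) else ww (none :: l)
  | [], h => absurd rfl h
  | some x :: l, _ => by
    obtain ⟨m, hm⟩ := bar_some_eq x l
    simp [hm, grow_none_cns_some, evenLead]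
  | [none], _ => by simp [bar, evenLead]
  | none :: some x :: l, _ => by
    obtain ⟨m, hm⟩ := bar_some_eq x l
    rw [bar, map_sub, map_sub, hm, grow_none_none_cns_some]
    simp [evenLead, grow]
  | [none, none], _ => by simp [bar, evenLead, grow]
  | none :: none :: b :: l, _ => by
    have ih := grow_none_bar (b :: l) (by simp)
    rw [bar_none_none, if_neg (by simp), add_zero, grow_none_none_none, ih]
    simp only [evenLead, Bool.not_not]
    split_ifs <;> simp

/-- The augmented contraction on words with a unit strictly between the two end letters. -/
theorem bar_growTail_add (a : Option α) (l : List (Option α)) (hl : none ∈ l.dropLast) :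
    lin bar (growTail (a :: l)) + lin growTail (bar (a :: l)) = ww (a :: l) := by
  have cns_bar : ∀ (c : Option α) (m : Wd α),
      lin bar (cns c m) = lin (mulHead c) m - cns c (lin bar m) := by
    intro c m
    have : lin bar ∘ₗ cns c = lin (mulHead c) - cns c ∘ₗ lin bar :=
      wd_ext fun l => by simp [bar]
    exact LinearMap.congr_fun this m
  have cns_growTail : ∀ (c : Option α) (m : Wd α), lin growTail (cns c m) = cns c (lin grow m) := by
    intro c m
    have : lin growTail ∘ₗ cns c = cns c ∘ₗ lin grow := wd_ext fun l => by simp [growTail]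
    exact LinearMap.congr_fun this m
  induction l generalizing a with
  | nil => simp at hl
  | cons b l ih =>
    rcases l with _ | ⟨c, l⟩
    · simp at hl
    rcases b with _ | x
    · have key := grow_none_bar (c :: l) (by simp)
      rw [bar, map_sub, cns_growTail, growTail, cns_bar, bar, map_sub]
      rw [key, mulHead_cons_none, mulHead_none, lin_ww, growTail, grow]
      by_cases he : evenLead (c :: l)
      · simp only [he, if_true, lin_ww]
        rw [bar_none_none, if_neg (by simp)]
        simp
      · simp only [he, if_false, Bool.false_eq_true]
        simp
    · have hl' : none ∈ (c :: l).dropLast := by simpa using hl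
      have ih := ih (some x) hl'
      -- The zeroth face commutes with the homotopy: `1·x = x` leaves the interior alone and `y·x =
      -- 0`.
      have h1 : lin (mulHead a) (cns (some x) (grow (c :: l))) =
          lin growTail (mulHead a (some x :: c :: l)) := by
        rcases a with _ | y
        · have : lin (mulHead none) ∘ₗ cns (some x) = cns (some x) := wd_ext fun l => by simp
          simpa [growTail] using LinearMap.congr_fun this (grow (c :: l))
        · have : lin (mulHead (some y)) ∘ₗ cns (some x) = 0 := wd_ext fun l => by simp
          simpa using LinearMap.congr_fun this (grow (c :: l))
      -- On words starting with a variable, `grow` is minus `growTail`, so the induction hypothesis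
      -- becomes a homotopy formula for `grow` with the opposite sign.
      have h2 : lin bar (grow (some x :: c :: l)) + lin grow (bar (some x :: c :: l)) =
          - ww (some x :: c :: l) := by
        obtain ⟨m, hm⟩ := bar_some_eq x (c :: l)
        have h3 : ∀ m : Wd α, lin grow (cns (some x) m) = - lin growTail (cns (some x) m) := by
          intro m
          have : lin grow ∘ₗ cns (some x) = - (lin growTail ∘ₗ cns (some x)) :=
            wd_ext fun l => by simp [growTail, grow]
          exact LinearMap.congr_fun this m
        rw [← ih, hm, h3, grow, growTail, map_neg]
        abel
      rw [bar, map_sub, cns_growTail, growTail, cns_bar, ← cns_ww,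
        ← neg_neg (ww (some x :: c :: l)), ← h2, grow, map_neg, h1]
      simp only [map_neg, map_add]
      abel

end Words

end CyclicHom

end

noncomputable section

namespace CyclicHom

/-! ### Homogeneous parts and the cyclic operator on words -/

section Cyclic

variable {α : Type*}

theorem supported_induction {S : Set (List (Option α))} {N : Type*} [AddCommGroup N]
    {f : Wd α →ₗ[ℤ] N} {P : Submodule ℤ N} (h : ∀ l ∈ S, f (ww l) ∈ P) {m : Wd α}
    (hm : m ∈ Finsupp.supported ℤ ℤ S) : f m ∈ P := by
  rw [Finsupp.supported_eq_span_single] at hm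
  have : Submodule.span ℤ ((fun l => Finsupp.single l (1 : ℤ)) '' S) ≤ P.comap f := by
    rw [Submodule.span_le]
    rintro _ ⟨l, hl, rfl⟩
    exact h l hl
  exact this hm

theorem supported_ext {S : Set (List (Option α))} {N : Type*} [AddCommGroup N]
    {f g : Wd α →ₗ[ℤ] N} (h : ∀ l ∈ S, f (ww l) = g (ww l)) {m : Wd α}
    (hm : m ∈ Finsupp.supported ℤ ℤ S) : f m = g m := by
  have := supported_induction (f := f - g) (P := ⊥) (S := S)
    (fun l hl => by simp [h l hl]) hm
  simpa [sub_eq_zero] using this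

/-- The span of the words of length `n`. -/
def lenPart (α : Type*) (n : ℕ) : Submodule ℤ (Wd α) :=
  Finsupp.supported ℤ ℤ {l | l.length = n}

theorem ww_mem_lenPart (l : List (Option α)) : ww l ∈ lenPart α l.length :=
  Finsupp.single_mem_supported ℤ 1 rfl

theorem ww_mem_lenPart' {l : List (Option α)} {n : ℕ} (h : l.length = n) : ww l ∈ lenPart α n :=
  h ▸ ww_mem_lenPart l

/-- Rotation to the right. -/
def rotR (l : List (Option α)) : List (Option α) := l.getLast?.toList ++ l.dropLast

/-- Rotation to the left. -/
def rotL : List (Option α) → List (Option α)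
  | [] => []
  | a :: l => l ++ [a]

@[simp] theorem rotR_nil : rotR ([] : List (Option α)) = [] := rfl

@[simp] theorem rotR_append (l : List (Option α)) (a) : rotR (l ++ [a]) = a :: l := by simp [rotR]

@[simp] theorem rotR_rotL (l : List (Option α)) : rotR (rotL l) = l := by
  cases l <;> simp [rotL]

@[simp] theorem rotL_rotR (l : List (Option α)) : rotL (rotR l) = l := by
  rcases List.eq_nil_or_concat l with rfl | ⟨l, a, rfl⟩ <;> simp [rotL]

@[simp] theorem length_rotL (l : List (Option α)) : (rotL l).length = l.length := by
  cases l <;> simp [rotL]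

@[simp] theorem length_rotR (l : List (Option α)) : (rotR l).length = l.length := by
  rw [← length_rotL, rotL_rotR]

theorem iterate_rotL (l : List (Option α)) (n : ℕ) : rotL^[n] l = l.rotate n := by
  induction n generalizing l with
  | zero => simp
  | succ n ih =>
    rw [Function.iterate_succ_apply, ih]
    cases l <;> simp [rotL]

/-- The cyclic operator `t` on words. -/
def tcyc (α : Type*) : Wd α →ₗ[ℤ] Wd α :=
  lin fun l => (-1 : ℤ) ^ (l.length + 1) • ww (rotR l)

/-- The inverse of the cyclic operator. -/
def tinv (α : Type*) : Wd α →ₗ[ℤ] Wd α :=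
  lin fun l => (-1 : ℤ) ^ (l.length + 1) • ww (rotL l)

theorem tcyc_ww (l : List (Option α)) :
    tcyc α (ww l) = (-1 : ℤ) ^ (l.length + 1) • ww (rotR l) := lin_ww _ _

theorem tinv_ww (l : List (Option α)) :
    tinv α (ww l) = (-1 : ℤ) ^ (l.length + 1) • ww (rotL l) := lin_ww _ _

@[simp] theorem tcyc_tinv (m : Wd α) : tcyc α (tinv α m) = m := by
  have : tcyc α ∘ₗ tinv α = LinearMap.id := wd_ext fun l => by
    simp only [LinearMap.comp_apply, tinv_ww, map_smul, tcyc_ww, length_rotL, rotR_rotL, smul_smul,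
      ← mul_pow, LinearMap.id_apply]
    simp
  exact LinearMap.congr_fun this m

@[simp] theorem tinv_tcyc (m : Wd α) : tinv α (tcyc α m) = m := by
  have : tinv α ∘ₗ tcyc α = LinearMap.id := wd_ext fun l => by
    simp only [LinearMap.comp_apply, tinv_ww, map_smul, tcyc_ww, length_rotR, rotL_rotR, smul_smul,
      ← mul_pow, LinearMap.id_apply]
    simp
  exact LinearMap.congr_fun this m

theorem tinv_pow_ww (l : List (Option α)) (n : ℕ) :
    (tinv α ^ n) (ww l) = (-1 : ℤ) ^ ((l.length + 1) * n) • ww (l.rotate n) := by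
  rw [← iterate_rotL]
  induction n generalizing l with
  | zero => simp
  | succ n ih =>
    rw [pow_succ, Module.End.mul_apply, tinv_ww, map_smul, ih, length_rotL, smul_smul,
      Function.iterate_succ_apply]
    ring_nf

/-- A full turn collects the sign (-1)^(n(n+1)) = 1. -/
theorem tinv_pow_of_mem {n : ℕ} {m : Wd α} (hm : m ∈ lenPart α n) : (tinv α ^ n) m = m := by
  refine supported_ext (g := LinearMap.id) (fun l (hl : l.length = n) => ?_) hm
  rw [tinv_pow_ww, ← hl, List.rotate_length,
    Even.neg_one_pow (by rw [mul_comm]; exact Nat.even_mul_succ_self _)]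
  simp

theorem tcyc_pow_tinv_pow (n : ℕ) (m : Wd α) : (tcyc α ^ n) ((tinv α ^ n) m) = m := by
  induction n generalizing m with
  | zero => rfl
  | succ n ih => rw [pow_succ, pow_succ', Module.End.mul_apply, Module.End.mul_apply, tcyc_tinv, ih]

theorem tinv_pow_tcyc_pow (n : ℕ) (m : Wd α) : (tinv α ^ n) ((tcyc α ^ n) m) = m := by
  induction n generalizing m with
  | zero => rfl
  | succ n ih => rw [pow_succ, pow_succ', Module.End.mul_apply, Module.End.mul_apply, tinv_tcyc, ih]

theorem tcyc_pow_of_mem {n : ℕ} {m : Wd α} (hm : m ∈ lenPart α n) : (tcyc α ^ n) m = m := by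
  conv_lhs => rw [← tinv_pow_of_mem hm]
  exact tcyc_pow_tinv_pow n m

theorem tcyc_mem_lenPart {n : ℕ} {m : Wd α} (hm : m ∈ lenPart α n) : tcyc α m ∈ lenPart α n :=
  supported_induction (fun l (hl : l.length = n) => by
    rw [tcyc_ww]; exact Submodule.smul_mem _ _ (ww_mem_lenPart' (by simp [hl]))) hm

theorem tinv_mem_lenPart {n : ℕ} {m : Wd α} (hm : m ∈ lenPart α n) : tinv α m ∈ lenPart α n :=
  supported_induction (fun l (hl : l.length = n) => by
    rw [tinv_ww]; exact Submodule.smul_mem _ _ (ww_mem_lenPart' (by simp [hl]))) hm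

theorem tinv_pow_mem_lenPart {n : ℕ} (i : ℕ) {m : Wd α} (hm : m ∈ lenPart α n) :
    (tinv α ^ i) m ∈ lenPart α n := by
  induction i generalizing m with
  | zero => exact hm
  | succ i ih => rw [pow_succ, Module.End.mul_apply]; exact ih (tinv_mem_lenPart hm)

theorem mulHead_mem_lenPart (a : Option α) (l : List (Option α)) :
    mulHead a l ∈ lenPart α l.length := by
  rcases l with _ | ⟨b, l⟩
  · simp
  rcases a with _ | a
  · exact ww_mem_lenPart' (by simp)
  rcases b with _ | b
  · exact ww_mem_lenPart' (by simp)
  · simp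

theorem dzero_mem_lenPart {n : ℕ} {m : Wd α} (hm : m ∈ lenPart α (n + 1)) :
    lin dzero m ∈ lenPart α n :=
  supported_induction (fun l (hl : l.length = n + 1) => by
    rw [lin_ww]
    rcases l with _ | ⟨a, l⟩
    · simp at hl
    · have h := mulHead_mem_lenPart a l
      rwa [show l.length = n by simpa using hl] at h) hm

/-- The norm operator on words. -/
def nrm (α : Type*) : Wd α →ₗ[ℤ] Wd α :=
  lin fun l => ∑ i ∈ Finset.range l.length, (tcyc α ^ i) (ww l)

theorem nrm_of_mem {n : ℕ} {m : Wd α} (hm : m ∈ lenPart α n) :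
    nrm α m = ∑ i ∈ Finset.range n, (tcyc α ^ i) m := by
  have := supported_ext (f := nrm α) (g := ∑ i ∈ Finset.range n, tcyc α ^ i)
    (fun l (hl : l.length = n) => by simp [nrm, hl]) hm
  simpa using this

theorem nrm_tcyc (m : Wd α) : nrm α (tcyc α m) = nrm α m := by
  have : nrm α ∘ₗ tcyc α = nrm α := wd_ext fun l => by
    have h := ww_mem_lenPart l
    rw [LinearMap.comp_apply, nrm_of_mem (tcyc_mem_lenPart h), nrm_of_mem h]
    simp only [← Module.End.mul_apply, ← pow_succ]
    have h1 := Finset.sum_range_succ (fun i => (tcyc α ^ i) (ww l)) l.length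
    rw [Finset.sum_range_succ', tcyc_pow_of_mem h] at h1
    simpa using h1
  exact LinearMap.congr_fun this m

theorem tcyc_nrm (m : Wd α) : tcyc α (nrm α m) = nrm α m := by
  have : tcyc α ∘ₗ nrm α = nrm α ∘ₗ tcyc α := wd_ext fun l => by
    have h := ww_mem_lenPart l
    rw [LinearMap.comp_apply, LinearMap.comp_apply, nrm_of_mem (tcyc_mem_lenPart h), nrm_of_mem h,
      map_sum]
    simp only [← Module.End.mul_apply, ← pow_succ, ← pow_succ']
  exact (LinearMap.congr_fun this m).trans (nrm_tcyc m)

theorem tinv_nrm (m : Wd α) : tinv α (nrm α m) = nrm α m := by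
  conv_lhs => rw [← tcyc_nrm m]
  exact tinv_tcyc _

/-- The norm is fixed by the inverse of `t`, so shifting by n - 1 steps and reversing the order
turns powers of `t` into powers of its inverse. -/
theorem nrm_of_mem' {n : ℕ} {m : Wd α} (hm : m ∈ lenPart α n) :
    nrm α m = ∑ i ∈ Finset.range n, (tinv α ^ i) m := by
  have hN : ∀ k, (tinv α ^ k) (nrm α m) = nrm α m := by
    intro k
    induction k with
    | zero => rfl
    | succ k ih => rw [pow_succ, Module.End.mul_apply, tinv_nrm, ih]
  rcases n with _ | n
  · rw [nrm_of_mem hm]; simp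
  rw [← hN n, nrm_of_mem hm, map_sum, ← Finset.sum_range_reflect]
  refine Finset.sum_congr rfl fun i hi => ?_
  have hi : i ≤ n := by simpa [Nat.lt_succ_iff] using hi
  obtain ⟨k, rfl⟩ := Nat.exists_eq_add_of_le hi
  rw [show i + k + 1 - 1 - i = k by omega, pow_add, Module.End.mul_apply, tinv_pow_tcyc_pow]

theorem nrm_mem_lenPart {n : ℕ} {m : Wd α} (hm : m ∈ lenPart α n) : nrm α m ∈ lenPart α n := by
  rw [nrm_of_mem' hm]
  exact Submodule.sum_mem _ fun i _ => tinv_pow_mem_lenPart i hm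

/-! ### Faces as conjugates of `d₀`, and the identities of the bicomplex -/

/-- The `j`-th face map on words. -/
def faceL : ℕ → List (Option α) → Wd α
  | 0, l => dzero l
  | _ + 1, [] => 0
  | j + 1, a :: l => cns a (faceL j l)

theorem bar_eq_sum (l : List (Option α)) :
    bar l = ∑ j ∈ Finset.range (l.length - 1), (-1 : ℤ) ^ j • faceL j l := by
  induction l with
  | nil => simp [bar]
  | cons a l ih =>
    rw [bar, ih]
    rcases l with _ | ⟨b, l⟩
    · simp
    · simp only [List.length_cons, Nat.add_sub_cancel]
      rw [Finset.sum_range_succ']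
      simp [faceL, dzero, pow_succ, add_comm, sub_eq_add_neg]

theorem cns_snc (a b : Option α) (m : Wd α) : cns a (snc b m) = snc b (cns a m) := by
  have : cns a ∘ₗ snc b = snc b ∘ₗ cns a := wd_ext fun l => by simp
  exact LinearMap.congr_fun this m

theorem mulHead_snoc (a b : Option α) (l : List (Option α)) (hl : l ≠ []) :
    mulHead a (l ++ [b]) = snc b (mulHead a l) := by
  rcases l with _ | ⟨c, l⟩
  · exact absurd rfl hl
  · rcases a with _ | a <;> rcases c with _ | c <;> simp

theorem faceL_snoc (b : Option α) (j : ℕ) (l : List (Option α)) (h : j + 1 < l.length) :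
    faceL j (l ++ [b]) = snc b (faceL j l) := by
  induction j generalizing l with
  | zero =>
    rcases l with _ | ⟨a, l⟩
    · simp at h
    · exact mulHead_snoc a b l (by rintro rfl; simp at h)
  | succ j ih =>
    rcases l with _ | ⟨a, l⟩
    · simp at h
    · simp only [List.cons_append, faceL]
      rw [ih l (by simpa using h), cns_snc]

theorem faceL_mem_lenPart (j : ℕ) (l : List (Option α)) :
    faceL j l ∈ lenPart α (l.length - 1) := by
  induction j generalizing l with
  | zero =>
    rcases l with _ | ⟨a, l⟩
    · simp [faceL, dzero]
    · exact mulHead_mem_lenPart a l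
  | succ j ih =>
    rcases l with _ | ⟨a, l⟩
    · simp [faceL]
    · rcases l with _ | ⟨b, l⟩
      · cases j <;> simp [faceL, dzero]
      · exact supported_induction (fun k (hk : k.length = _) => by
          rw [cns_ww]; exact ww_mem_lenPart' (by simp [hk])) (ih (b :: l))

/-- Rotation moves the place of the multiplication one step to the right. The minus sign arises
because a face lowers the length, and with it the sign exponent of `t`, by one. -/
theorem tcyc_faceL (j : ℕ) (l : List (Option α)) (h : j + 2 < l.length) :
    tcyc α (faceL j l) = - lin (faceL (j + 1)) (tcyc α (ww l)) := by
  rcases List.eq_nil_or_concat l with rfl | ⟨l, a, rfl⟩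
  · simp at h
  rw [List.concat_eq_append] at *
  rw [faceL_snoc a j l (by simp at h; omega), tcyc_ww, map_smul, rotR_append, lin_ww, faceL]
  have hl : l.length - 1 + 1 = l.length := by simp at h; omega
  refine supported_ext (f := tcyc α ∘ₗ snc a)
    (g := -((-1 : ℤ) ^ ((l ++ [a]).length + 1) • cns a)) (fun k (hk : k.length = _) => ?_)
    (faceL_mem_lenPart j l)
  rw [LinearMap.comp_apply, snc_ww, tcyc_ww, rotR_append, LinearMap.neg_apply,
    LinearMap.smul_apply, cns_ww, List.length_append, hk, List.length_append, List.length_singleton,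
    hl, pow_succ _ (l.length + 1), mul_neg_one, neg_smul, neg_neg]

/-- Iterating `tcyc_faceL` absorbs the alternating signs: every signed face except the last is a
conjugate of `d₀`. -/
theorem sign_faceL (j : ℕ) (l : List (Option α)) (h : j + 1 < l.length) :
    (-1 : ℤ) ^ j • faceL j l = (tcyc α ^ j) (lin dzero ((tinv α ^ j) (ww l))) := by
  induction j generalizing l with
  | zero => simp [faceL]
  | succ j ih =>
    have h1 := tcyc_faceL j (rotL l) (by simpa using h)
    have h2 := ih (rotL l) (by simp; omega)
    rw [tcyc_ww, rotR_rotL, length_rotL, map_smul, lin_ww] at h1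
    rw [pow_succ' (tcyc α), pow_succ (tinv α), Module.End.mul_apply, Module.End.mul_apply, tinv_ww,
      map_smul, map_smul, map_smul, ← h2, map_smul, map_smul, h1, smul_neg, smul_neg, smul_smul,
      smul_smul, pow_succ, mul_neg_one, neg_smul, mul_right_comm, ← mul_pow]
    simp

theorem bar_eq_conj {n : ℕ} {m : Wd α} (hm : m ∈ lenPart α (n + 1)) :
    lin bar m = ∑ i ∈ Finset.range n, (tcyc α ^ i) (lin dzero ((tinv α ^ i) m)) := by
  have := supported_ext (f := lin bar)
    (g := ∑ i ∈ Finset.range n, (tcyc α ^ i) ∘ₗ lin dzero ∘ₗ (tinv α ^ i))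
    (fun l (hl : l.length = n + 1) => by
      rw [lin_ww, bar_eq_sum, hl, Nat.add_sub_cancel, LinearMap.sum_apply]
      refine Finset.sum_congr rfl fun i hi => ?_
      rw [sign_faceL i l (by simp at hi; omega)]
      rfl) hm
  simpa using this

/-- The boundary `b'`, linearly extended. -/
def barL (α : Type*) : Wd α →ₗ[ℤ] Wd α := lin bar

/-- The Hochschild boundary `b` on words. -/
def hochL (α : Type*) : Wd α →ₗ[ℤ] Wd α := barL α + lin dzero ∘ₗ tcyc α

/-- The last face `d₀ t` is the missing conjugate i = n: `t⁻ⁿ = t` on words of length n + 1, while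
`tⁿ = 1` on words of length n. -/
theorem hochL_eq_conj {n : ℕ} {m : Wd α} (hm : m ∈ lenPart α (n + 1)) :
    hochL α m = ∑ i ∈ Finset.range (n + 1), (tcyc α ^ i) (lin dzero ((tinv α ^ i) m)) := by
  have h := tinv_pow_of_mem (tcyc_mem_lenPart hm)
  rw [pow_succ, Module.End.mul_apply, tinv_tcyc] at h
  rw [Finset.sum_range_succ, ← bar_eq_conj hm, h,
    tcyc_pow_of_mem (dzero_mem_lenPart (tcyc_mem_lenPart hm))]
  rfl

theorem hochL_nil : hochL α (ww []) = 0 := by simp [hochL, barL, tcyc_ww, bar, dzero]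

theorem barL_nil : barL α (ww []) = 0 := by simp [barL, bar]

/-- Shifting the index in the sum of conjugates gives `b t = d₀ t + t b'`, and `b = b' + d₀ t` by
definition. -/
theorem hochL_sub_tcyc (m : Wd α) :
    hochL α (m - tcyc α m) = barL α m - tcyc α (barL α m) := by
  have : hochL α ∘ₗ (LinearMap.id - tcyc α) = (LinearMap.id - tcyc α) ∘ₗ barL α :=
    wd_ext fun l => by
      rcases Nat.eq_zero_or_pos l.length with h0 | h0
      · obtain rfl := List.length_eq_zero_iff.mp h0
        simp [tcyc_ww, hochL_nil, barL_nil]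
      obtain ⟨n, hn⟩ : ∃ n, l.length = n + 1 := ⟨l.length - 1, by omega⟩
      have h := ww_mem_lenPart' hn
      have h1 : hochL α (tcyc α (ww l)) = lin dzero (tcyc α (ww l)) + tcyc α (barL α (ww l)) := by
        rw [hochL_eq_conj (tcyc_mem_lenPart h), Finset.sum_range_succ', barL, bar_eq_conj h,
          map_sum, add_comm]
        congr 1
        refine Finset.sum_congr rfl fun i _ => ?_
        rw [pow_succ' (tcyc α), pow_succ (tinv α), Module.End.mul_apply, Module.End.mul_apply,
          tinv_tcyc]
      simp only [LinearMap.comp_apply, LinearMap.sub_apply, LinearMap.id_apply, map_sub, h1]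
      simp only [hochL, LinearMap.add_apply, LinearMap.comp_apply]
      abel
  simpa using LinearMap.congr_fun this m

/-- Both sides are `N d₀ N`: the norm absorbs the powers of `t` next to it, and the powers on the
other side of `d₀` add up to a second norm. -/
theorem barL_nrm (m : Wd α) : barL α (nrm α m) = nrm α (hochL α m) := by
  have : barL α ∘ₗ nrm α = nrm α ∘ₗ hochL α := wd_ext fun l => by
    rcases Nat.eq_zero_or_pos l.length with h0 | h0
    · obtain rfl := List.length_eq_zero_iff.mp h0
      simp [nrm, hochL_nil]
    obtain ⟨n, hn⟩ : ∃ n, l.length = n + 1 := ⟨l.length - 1, by omega⟩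
    have h := ww_mem_lenPart' hn
    have hti : ∀ i, (tinv α ^ i) (nrm α (ww l)) = nrm α (ww l) := by
      intro k
      induction k with
      | zero => rfl
      | succ k ih => rw [pow_succ, Module.End.mul_apply, tinv_nrm, ih]
    have htc : ∀ i (m : Wd α), nrm α ((tcyc α ^ i) m) = nrm α m := by
      intro k
      induction k with
      | zero => intro m; rfl
      | succ k ih => intro m; rw [pow_succ, Module.End.mul_apply, ih, nrm_tcyc]
    rw [LinearMap.comp_apply, LinearMap.comp_apply, barL, bar_eq_conj (nrm_mem_lenPart h),
      hochL_eq_conj h, map_sum]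
    simp only [hti, htc]
    rw [← nrm_of_mem (dzero_mem_lenPart (nrm_mem_lenPart h)), nrm_of_mem' h, map_sum, map_sum]
  exact LinearMap.congr_fun this m

/-! ### Contractions of the bar complex and of the degenerate Hochschild complex -/

theorem barL_cns_none {n : ℕ} {m : Wd α} (hm : m ∈ lenPart α (n + 1)) :
    barL α (cns none m) = m - cns none (barL α m) := by
  refine supported_ext (f := barL α ∘ₗ cns none) (g := LinearMap.id - cns none ∘ₗ barL α)
    (fun l (hl : l.length = n + 1) => ?_) hm
  rcases l with _ | ⟨a, l⟩
  · simp at hl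
  · simp [barL, bar]

/-- Multiply the first letter by the last one from the left, and drop the last one. -/
def wrap (α : Type*) : Wd α →ₗ[ℤ] Wd α := lin fun l => dzero (rotR l)

theorem wrap_snoc (l : List (Option α)) (a : Option α) : wrap α (ww (l ++ [a])) = mulHead a l := by
  simp [wrap, dzero]

theorem bar_snoc_none (l : List (Option α)) (hl : l ≠ []) :
    bar (l ++ [none]) = snc none (bar l) + (-1 : ℤ) ^ (l.length + 1) • ww l := by
  induction l with
  | nil => exact absurd rfl hl
  | cons a l ih =>
    rcases l with _ | ⟨b, l⟩
    · simp [bar]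
    · rw [List.cons_append, bar, ih (by simp), bar.eq_def (a :: b :: l)]
      simp only [map_add, map_sub, map_smul, cns_ww, cns_snc]
      rw [mulHead_snoc a none (b :: l) (by simp)]
      simp [pow_succ]
      abel

/-- The Hochschild complex is the bar complex with its two end letters multiplied together. The
appended `1` serves as the right end, and the face that absorbs it becomes the last Hochschild face.
-/
theorem hochL_eq_wrap (l : List (Option α)) : hochL α (ww l) = wrap α (bar (l ++ [none])) := by
  rcases Nat.eq_zero_or_pos l.length with h0 | h0
  · obtain rfl := List.length_eq_zero_iff.mp h0
    simp [hochL_nil, bar]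
  obtain ⟨n, hn⟩ : ∃ n, l.length = n + 1 := ⟨l.length - 1, by omega⟩
  rw [bar_snoc_none l (by rintro rfl; simp at h0), map_add, map_smul]
  have h : wrap α (snc none (bar l)) = bar l := by
    rw [bar_eq_sum, hn, Nat.add_sub_cancel]
    simp only [map_sum, map_smul]
    refine Finset.sum_congr rfl fun j hj => ?_
    congr 1
    refine supported_ext (f := wrap α ∘ₗ snc none) (g := LinearMap.id)
      (fun k (hk : k.length = _) => ?_) (faceL_mem_lenPart j l)
    rw [LinearMap.comp_apply, snc_ww, wrap_snoc]
    rcases k with _ | ⟨a, k⟩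
    · simp [hn] at hk hj; omega
    · simp
  rw [h]
  simp [hochL, barL, tcyc_ww, wrap]

/-- `grow` for words without a distinguished last letter. -/
def growW : List (Option α) → Wd α
  | [] => 0
  | none :: l => if evenLead (l ++ [none]) then ww (none :: none :: l) else 0
  | some x :: l => - cns (some x) (growW l)

theorem evenLead_snoc (l : List (Option α)) (a b : Option α) :
    evenLead (l ++ [a]) = evenLead (l ++ [b]) := by
  induction l with
  | nil => cases a <;> cases b <;> rfl
  | cons c l ih => cases c <;> simp [evenLead, ih]

theorem grow_snoc (l : List (Option α)) (a : Option α) : grow (l ++ [a]) = snc a (growW l) := by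
  induction l with
  | nil => cases a <;> simp [grow, growW, evenLead]
  | cons c l ih =>
    cases c
    · simp only [List.cons_append, grow, growW, evenLead_snoc l a none]
      split_ifs <;> simp
    · simp [grow, growW, ih, cns_snc]

/-- The contraction of the degenerate part of the Hochschild complex. -/
def growList : List (Option α) → Wd α
  | [] => 0
  | a :: l => cns a (growW l)

theorem growTail_snoc (l : List (Option α)) (a : Option α) (hl : l ≠ []) :
    growTail (l ++ [a]) = snc a (growList l) := by
  rcases l with _ | ⟨c, l⟩
  · exact absurd rfl hl
  · simp [growTail, growList, grow_snoc, cns_snc]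

/-- The bar homotopy alters neither end letter, so it is compatible with multiplying the ends and
descends to the Hochschild complex. -/
theorem growList_wrap (m : Wd α) : lin growList (wrap α m) = wrap α (lin growTail m) := by
  have : lin growList ∘ₗ wrap α = wrap α ∘ₗ lin growTail := wd_ext fun l => by
    rw [LinearMap.comp_apply, LinearMap.comp_apply, lin_ww]
    rcases List.eq_nil_or_concat l with rfl | ⟨l, z, rfl⟩
    · simp [wrap, growTail, dzero]
    rw [List.concat_eq_append, wrap_snoc]
    rcases l with _ | ⟨a, l⟩
    · simp [growTail, grow]
    · rw [growTail_snoc _ _ (by simp), growList]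
      have h : ∀ m : Wd α, wrap α (snc z (cns a m)) = lin (mulHead z) (cns a m) := fun m => by
        have : wrap α ∘ₗ snc z ∘ₗ cns a = lin (mulHead z) ∘ₗ cns a := wd_ext fun l => by
          rw [LinearMap.comp_apply, LinearMap.comp_apply, LinearMap.comp_apply, cns_ww, snc_ww,
            wrap_snoc, lin_ww]
        exact LinearMap.congr_fun this m
      have h0 : ∀ m : Wd α, lin (mulHead none) (cns a m) = cns a m := fun m => by
        have : lin (mulHead none) ∘ₗ cns a = cns a := wd_ext fun l => by simp
        exact LinearMap.congr_fun this m
      rw [h]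
      rcases z with _ | z
      · simp [growList, h0]
      · rcases a with _ | a
        · have : lin (mulHead (some z)) ∘ₗ cns none = cns (some z) := wd_ext fun l => by simp
          have := LinearMap.congr_fun this (growW l)
          simp only [LinearMap.comp_apply] at this
          rw [this]
          simp [growList]
        · have : lin (mulHead (some z)) ∘ₗ cns (some a) = 0 := wd_ext fun l => by simp
          have := LinearMap.congr_fun this (growW l)
          simp only [LinearMap.comp_apply] at this
          rw [this]
          simp
  exact LinearMap.congr_fun this m

/-- After appending `1`, a unit anywhere behind the first letter lies strictly between the two ends,
so `bar_growTail_add` applies; multiplying the ends together gives the formula. -/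
theorem hochL_growList_add (a : Option α) (l : List (Option α)) (hl : none ∈ l) :
    hochL α (growList (a :: l)) + lin growList (hochL α (ww (a :: l))) = ww (a :: l) := by
  have h1 : ∀ m : Wd α, hochL α m = wrap α (lin bar (snc none m)) := fun m => by
    have : hochL α = wrap α ∘ₗ lin bar ∘ₗ snc none := wd_ext fun l => by simp [hochL_eq_wrap]
    exact LinearMap.congr_fun this m
  rw [h1, ← growTail_snoc _ _ (by simp), hochL_eq_wrap, growList_wrap, ← map_add, List.cons_append,
    bar_growTail_add a (l ++ [none]) (by simpa using hl), ← List.cons_append, wrap_snoc]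
  simp

end Cyclic

end CyclicHom

end

noncomputable section

namespace CyclicHom

/-! ### The weight `w` part of the total complex, in terms of words -/

section Families

variable {α : Type*}

/-- The number of letters of a word that are not `1`. -/
def wt (l : List (Option α)) : ℕ := l.countP Option.isSome

@[simp] theorem wt_nil : wt ([] : List (Option α)) = 0 := rfl

@[simp] theorem wt_none (l : List (Option α)) : wt (none :: l) = wt l := by simp [wt]

@[simp] theorem wt_some (x : α) (l : List (Option α)) : wt (some x :: l) = wt l + 1 := by simp [wt]

theorem wt_append (l k : List (Option α)) : wt (l ++ k) = wt l + wt k := by simp [wt]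

theorem wt_le_length (l : List (Option α)) : wt l ≤ l.length := List.countP_le_length

theorem wt_rotR (l : List (Option α)) : wt (rotR l) = wt l := by
  rcases List.eq_nil_or_concat l with rfl | ⟨l, a, rfl⟩
  · rfl
  · rw [List.concat_eq_append, rotR_append, ← List.singleton_append, wt_append, wt_append, add_comm]

theorem none_not_mem_of_wt {l : List (Option α)} (h : wt l = l.length) : none ∉ l := by
  intro hn
  have := List.countP_eq_length.mp h none hn
  simp at this

theorem none_mem_of_wt {l : List (Option α)} (h : wt l < l.length) : none ∈ l := by
  by_contra hn
  have : wt l = l.length := List.countP_eq_length.mpr fun a ha => by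
    cases a
    · exact absurd ha hn
    · rfl
  omega

/-- The span of the words of length `n` and weight `w`. -/
def homPart (α : Type*) (n w : ℕ) : Submodule ℤ (Wd α) :=
  Finsupp.supported ℤ ℤ {l | l.length = n ∧ wt l = w}

/-- The span of the words with a `1` after the first letter. -/
def degPart (α : Type*) : Submodule ℤ (Wd α) := Finsupp.supported ℤ ℤ {l | none ∈ l.tail}

theorem ww_mem_homPart {l : List (Option α)} {n w : ℕ} (h : l.length = n) (h' : wt l = w) :
    ww l ∈ homPart α n w :=
  Finsupp.single_mem_supported ℤ 1 ⟨h, h'⟩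

theorem homPart_le_lenPart (n w : ℕ) : homPart α n w ≤ lenPart α n :=
  Finsupp.supported_mono fun _ h => h.1

theorem homPart_eq_zero {n w : ℕ} (h : n < w) {m : Wd α} (hm : m ∈ homPart α n w) : m = 0 := by
  have := supported_induction (f := LinearMap.id) (P := ⊥) (fun l hl => by
    have := wt_le_length l
    have h1 := hl.1
    have h2 := hl.2
    omega) hm
  simpa using this

theorem tcyc_mem_homPart {n w : ℕ} {m : Wd α} (hm : m ∈ homPart α n w) :
    tcyc α m ∈ homPart α n w :=
  supported_induction (fun l hl => by
    rw [tcyc_ww]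
    exact Submodule.smul_mem _ _ (ww_mem_homPart (by simp [hl.1]) (by rw [wt_rotR, hl.2]))) hm

theorem tcyc_pow_mem_homPart {n w : ℕ} (i : ℕ) {m : Wd α} (hm : m ∈ homPart α n w) :
    (tcyc α ^ i) m ∈ homPart α n w := by
  induction i generalizing m with
  | zero => exact hm
  | succ i ih => rw [pow_succ, Module.End.mul_apply]; exact ih (tcyc_mem_homPart hm)

theorem nrm_mem_homPart {n w : ℕ} {m : Wd α} (hm : m ∈ homPart α n w) :
    nrm α m ∈ homPart α n w := by
  rw [nrm_of_mem (homPart_le_lenPart _ _ hm)]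
  exact Submodule.sum_mem _ fun i _ => tcyc_pow_mem_homPart i hm

theorem cns_none_mem_homPart {n w : ℕ} {m : Wd α} (hm : m ∈ homPart α n w) :
    cns none m ∈ homPart α (n + 1) w :=
  supported_induction (fun l hl => by
    rw [cns_ww]; exact ww_mem_homPart (by simp [hl.1]) (by simp [hl.2])) hm

theorem cns_some_mem_homPart (x : α) {n w : ℕ} {m : Wd α} (hm : m ∈ homPart α n w) :
    cns (some x) m ∈ homPart α (n + 1) (w + 1) :=
  supported_induction (fun l hl => by
    rw [cns_ww]; exact ww_mem_homPart (by simp [hl.1]) (by simp [hl.2])) hm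

theorem dzero_mem_homPart (l : List (Option α)) : dzero l ∈ homPart α (l.length - 1) (wt l) := by
  rcases l with _ | ⟨_ | x, _ | ⟨_ | y, l⟩⟩
  · simp [dzero]
  · simp [dzero]
  · exact ww_mem_homPart (by simp) (by simp)
  · exact ww_mem_homPart (by simp) (by simp)
  · simp [dzero]
  · exact ww_mem_homPart (by simp) (by simp)
  · simp [dzero]

theorem bar_mem_homPart (l : List (Option α)) : bar l ∈ homPart α (l.length - 1) (wt l) := by
  induction l with
  | nil => simp [bar]
  | cons a l ih =>
    rw [bar]
    refine Submodule.sub_mem _ (dzero_mem_homPart (a :: l)) ?_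
    rcases l with _ | ⟨b, l⟩
    · simp [bar]
    · rcases a with _ | a
      · simpa using cns_none_mem_homPart ih
      · simpa using cns_some_mem_homPart a ih

theorem barL_mem_homPart {n w : ℕ} {m : Wd α} (hm : m ∈ homPart α n w) :
    barL α m ∈ homPart α (n - 1) w :=
  supported_induction (fun l hl => by
    have := bar_mem_homPart l
    rw [hl.1, hl.2] at this
    simpa [barL] using this) hm

theorem hochL_mem_homPart {n w : ℕ} {m : Wd α} (hm : m ∈ homPart α n w) :
    hochL α m ∈ homPart α (n - 1) w := by
  rw [hochL, LinearMap.add_apply]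
  refine Submodule.add_mem _ (barL_mem_homPart hm) ?_
  exact supported_induction (f := lin dzero) (fun l hl => by
    have := dzero_mem_homPart l
    rw [hl.1, hl.2] at this
    simpa using this) (tcyc_mem_homPart hm)

theorem growW_mem_homPart (l : List (Option α)) : growW l ∈ homPart α (l.length + 1) (wt l) := by
  induction l with
  | nil => simp [growW]
  | cons a l ih =>
    rcases a with _ | a
    · rw [growW]
      split_ifs
      · exact ww_mem_homPart (by simp) (by simp)
      · simp
    · rw [growW]
      simpa using cns_some_mem_homPart a ih

theorem growList_mem_homPart {n w : ℕ} {m : Wd α} (hm : m ∈ homPart α n w) :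
    lin growList m ∈ homPart α (n + 1) w :=
  supported_induction (fun l hl => by
    obtain ⟨rfl, rfl⟩ := hl
    rw [lin_ww]
    rcases l with _ | ⟨_ | a, l⟩
    · simp [growList]
    · simpa [growList] using cns_none_mem_homPart (growW_mem_homPart l)
    · simpa [growList] using cns_some_mem_homPart a (growW_mem_homPart l)) hm

/-- Exactness of the degenerate part of the Hochschild complex. -/
theorem exists_hochL_eq {n w : ℕ} {m : Wd α} (hm : m ∈ homPart α n w) (hd : m ∈ degPart α)
    (h : hochL α m = 0) : ∃ X ∈ homPart α (n + 1) w, hochL α X = m := by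
  refine ⟨lin growList m, growList_mem_homPart hm, ?_⟩
  have := supported_ext (f := hochL α ∘ₗ lin growList + lin growList ∘ₗ hochL α)
    (g := LinearMap.id) (fun l (hl : none ∈ l.tail) => by
      rcases l with _ | ⟨a, l⟩
      · simp at hl
      · simpa using hochL_growList_add a l hl) hd
  simpa [h] using this

/-- Exactness of a pair of adjacent columns of the cyclic bicomplex, modulo nondegenerate words. -/
theorem exists_pair {n w : ℕ} {x y : Wd α} (hx : x ∈ homPart α (n + 1) w) (hy : y ∈ homPart α n w)
    (hy0 : n = 0 → y = 0) (h1 : y - tcyc α y + hochL α x = 0) (h2 : barL α y = 0)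
    (hd : x + (cns none y - tcyc α (cns none y)) ∈ degPart α) :
    ∃ X ∈ homPart α (n + 2) w, ∃ Y ∈ homPart α (n + 1) w,
      Y - tcyc α Y + hochL α X = x ∧ - barL α Y = y := by
  -- Prefixing `1` contracts the bar column, so the cycle `y` can be removed at the cost of adding
  -- `(1-t)(1 ⊗ y)` to `x`; the sum is a Hochschild cycle.
  have hs : barL α (cns none y) = y := by
    rcases n with _ | n
    · simp [hy0 rfl]
    · rw [barL_cns_none (homPart_le_lenPart _ _ hy), h2]; simp
  have hsy := cns_none_mem_homPart hy
  obtain ⟨X, hX, hXe⟩ := exists_hochL_eq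
    (Submodule.add_mem _ hx (Submodule.sub_mem _ hsy (tcyc_mem_homPart hsy))) hd
    (by rw [map_add, hochL_sub_tcyc, hs, add_comm]; exact h1)
  refine ⟨X, hX, - cns none y, Submodule.neg_mem _ hsy, ?_, by simp [hs]⟩
  rw [hXe, map_neg]
  abel

/-! ### The total complex as families of words indexed by columns -/

/-- The degree `n`, weight `w` part of the total complex; the family is indexed by columns. -/
def famPart (α : Type*) (n w : ℕ) : Submodule ℤ (ℕ → Wd α) :=
  Submodule.pi Set.univ fun p => if p ≤ n then homPart α (n - p + 1) w else ⊥

theorem mem_famPart {n w : ℕ} {f : ℕ → Wd α} :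
    f ∈ famPart α n w ↔ (∀ p ≤ n, f p ∈ homPart α (n - p + 1) w) ∧ ∀ p, n < p → f p = 0 := by
  simp only [famPart, Submodule.mem_pi, Set.mem_univ, true_imp_iff]
  refine ⟨fun h => ⟨fun p hp => ?_, fun p hp => ?_⟩, fun h p => ?_⟩
  · simpa [hp] using h p
  · simpa [not_le.mpr hp] using h p
  · split_ifs with hp
    · exact h.1 p hp
    · simpa using h.2 p (not_le.mp hp)

/-- The horizontal maps of the cyclic bicomplex, from column `p + 1` to column `p`. -/
def horizL (α : Type*) (p : ℕ) : Wd α →ₗ[ℤ] Wd α :=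
  if Even p then LinearMap.id - tcyc α else nrm α

/-- The signed vertical maps of the cyclic bicomplex in column `p`. -/
def vertL (α : Type*) (p : ℕ) : Wd α →ₗ[ℤ] Wd α := if Even p then hochL α else - barL α

/-- The differential of the total complex. -/
def famD (α : Type*) : (ℕ → Wd α) →ₗ[ℤ] (ℕ → Wd α) :=
  LinearMap.pi fun p => horizL α p ∘ₗ LinearMap.proj (p + 1) + vertL α p ∘ₗ LinearMap.proj p

theorem famD_apply (f : ℕ → Wd α) (p : ℕ) :
    famD α f p = horizL α p (f (p + 1)) + vertL α p (f p) := rfl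

theorem famD_even (f : ℕ → Wd α) {p : ℕ} (hp : Even p) :
    famD α f p = f (p + 1) - tcyc α (f (p + 1)) + hochL α (f p) := by
  simp [famD_apply, horizL, vertL, hp]

theorem famD_odd (f : ℕ → Wd α) {p : ℕ} (hp : ¬ Even p) :
    famD α f p = nrm α (f (p + 1)) - barL α (f p) := by
  simp [famD_apply, horizL, vertL, hp, sub_eq_add_neg]

theorem horizL_mem {n w p : ℕ} {m : Wd α} (hm : m ∈ homPart α n w) :
    horizL α p m ∈ homPart α n w := by
  unfold horizL
  split_ifs
  · exact Submodule.sub_mem _ hm (tcyc_mem_homPart hm)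
  · exact nrm_mem_homPart hm

theorem vertL_mem {n w p : ℕ} {m : Wd α} (hm : m ∈ homPart α n w) :
    vertL α p m ∈ homPart α (n - 1) w := by
  unfold vertL
  split_ifs
  · exact hochL_mem_homPart hm
  · exact Submodule.neg_mem _ (barL_mem_homPart hm)

theorem horizL_horizL (p : ℕ) (m : Wd α) : horizL α p (horizL α (p + 1) m) = 0 := by
  by_cases hp : Even p
  · simp [horizL, hp, Nat.even_add_one, tcyc_nrm]
  · simp [horizL, hp, Nat.even_add_one, nrm_tcyc]

/-- The bicomplex has no vertical map out of row 0. On words this is automatic, because a product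
with the first letter of the empty word is 0 by convention. -/
theorem vertL_of_length_one {w p : ℕ} {m : Wd α} (hm : m ∈ homPart α 1 w) : vertL α p m = 0 := by
  refine supported_ext (g := 0) (fun l hl => ?_) hm
  obtain ⟨a, rfl⟩ := List.length_eq_one_iff.mp hl.1
  unfold vertL
  split_ifs <;> simp [hochL, barL, bar, tcyc_ww, rotR, dzero]

theorem famD_mem {n w : ℕ} {f : ℕ → Wd α} (hf : f ∈ famPart α (n + 1) w) :
    famD α f ∈ famPart α n w := by
  rw [mem_famPart] at *
  refine ⟨fun p hp => ?_, fun p hp => ?_⟩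
  · rw [famD_apply]
    refine Submodule.add_mem _ ?_ ?_
    · have := hf.1 (p + 1) (by omega)
      rw [show n + 1 - (p + 1) + 1 = n - p + 1 by omega] at this
      exact horizL_mem this
    · have := vertL_mem (p := p) (hf.1 p (by omega))
      rwa [show n + 1 - p + 1 - 1 = n - p + 1 by omega] at this
  · rw [famD_apply, hf.2 (p + 1) (by omega), map_zero, zero_add]
    rcases Nat.lt_or_ge (n + 1) p with h | h
    · rw [hf.2 p h, map_zero]
    · have := hf.1 p h
      rw [show n + 1 - p + 1 = 1 by omega] at this
      exact vertL_of_length_one this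

/-- A family concentrated in one column. -/
theorem famD_single (p : ℕ) (m : Wd α) :
    famD α (Pi.single (p + 1) m) =
      Pi.single p (horizL α p m) + Pi.single (p + 1) (vertL α (p + 1) m) := by
  funext q
  rw [famD_apply]
  by_cases h : q = p
  · subst h; simp
  · by_cases h' : q = p + 1
    · subst h'; simp
    · simp [h, h']

theorem famD_single_zero (m : Wd α) :
    famD α (Pi.single 0 m) = Pi.single 0 (vertL α 0 m) := by
  funext q
  rw [famD_apply]
  by_cases h : q = 0
  · subst h; simp
  · simp [h]

theorem single_mem_famPart {n w p : ℕ} (hp : p ≤ n) {m : Wd α}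
    (hm : m ∈ homPart α (n - p + 1) w) : Pi.single p m ∈ famPart α n w := by
  rw [mem_famPart]
  refine ⟨fun q _ => ?_, fun q hq => ?_⟩
  · by_cases h : q = p
    · subst h; simpa using hm
    · simp [h]
  · rw [Pi.single_eq_of_ne (by omega)]

/-- Exactness of the total complex modulo nondegenerate words, by descending induction over the
pairs of columns `2 i`, `2 i + 1`. -/
theorem exists_famD_eq {n w : ℕ} (i : ℕ) (f : ℕ → Wd α) (hf : f ∈ famPart α n w)
    (hcyc : famD α f = 0) (hzero : ∀ p, 2 * i ≤ p → f p = 0)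
    (hdeg : ∀ i, 2 * i ≤ n → (f (2 * i) = 0 ∧ f (2 * i + 1) = 0) ∨
      (f (2 * i) + (cns none (f (2 * i + 1)) - tcyc α (cns none (f (2 * i + 1)))) ∈ degPart α ∧
        ∀ k, n - 2 * i + 2 ≤ k → homPart α k w ≤ degPart α)) :
    ∃ g ∈ famPart α (n + 1) w, famD α g = f ∧ ∀ p, 2 * i ≤ p → g p = 0 := by
  induction i generalizing f with
  | zero => exact ⟨0, Submodule.zero_mem _, by
      rw [map_zero]; funext p; exact (hzero p (by simp)).symm, fun _ _ => rfl⟩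
  | succ i ih =>
    by_cases htriv : f (2 * i) = 0 ∧ f (2 * i + 1) = 0
    · obtain ⟨g, hg, hgf, hg0⟩ := ih f hf hcyc (fun p hp => by
        rcases Nat.lt_or_ge p (2 * (i + 1)) with h | h
        · obtain rfl | rfl : p = 2 * i ∨ p = 2 * i + 1 := by omega
          · exact htriv.1
          · exact htriv.2
        · exact hzero p h) hdeg
      exact ⟨g, hg, hgf, fun p hp => hg0 p (by omega)⟩
    have hn : 2 * i ≤ n := by
      by_contra h
      rw [mem_famPart] at hf
      exact htriv ⟨hf.2 _ (by omega), hf.2 _ (by omega)⟩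
    obtain ⟨hd, hk⟩ := (hdeg i hn).resolve_left htriv
    have hf' := mem_famPart.mp hf
    have hev : Even (2 * i) := even_two_mul i
    have hodd : ¬ Even (2 * i + 1) := by simp
    have h1 := congr_fun hcyc (2 * i)
    have h2 := congr_fun hcyc (2 * i + 1)
    rw [famD_even f hev] at h1
    rw [famD_odd f hodd, hzero _ (by omega)] at h2
    have hy : f (2 * i + 1) ∈ homPart α (n - 2 * i) w ∧ (n - 2 * i = 0 → f (2 * i + 1) = 0) := by
      refine ⟨?_, fun h => hf'.2 _ (by omega)⟩
      rcases Nat.eq_or_lt_of_le hn with h | h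
      · rw [hf'.2 _ (by omega)]; exact Submodule.zero_mem _
      · have := hf'.1 (2 * i + 1) h
        rwa [show n - (2 * i + 1) + 1 = n - 2 * i by omega] at this
    obtain ⟨X, hX, Y, hY, hXx, hYy⟩ := exists_pair (hf'.1 _ hn) hy.1 hy.2 h1 (by simpa using h2) hd
    -- The boundary of `g` equals `f` on the columns 2i and 2i + 1; otherwise it meets only the
    -- column 2i - 1.
    set g : ℕ → Wd α := Pi.single (2 * i) X + Pi.single (2 * i + 1) Y with hgdef
    have hg : g ∈ famPart α (n + 1) w := by
      refine Submodule.add_mem _ (single_mem_famPart (by omega) ?_)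
        (single_mem_famPart (by omega) ?_)
      · rwa [show n + 1 - 2 * i + 1 = n - 2 * i + 2 by omega]
      · rwa [show n + 1 - (2 * i + 1) + 1 = n - 2 * i + 1 by omega]
    have gX : g (2 * i) = X := by simp [hgdef]
    have gY : g (2 * i + 1) = Y := by simp [hgdef]
    have g0 : ∀ p, p ≠ 2 * i → p ≠ 2 * i + 1 → g p = 0 := fun p h h' => by
      simp [hgdef, h, h']
    have Dg1 : famD α g (2 * i) = f (2 * i) := by rw [famD_even g hev, gX, gY, hXx]
    have Dg2 : famD α g (2 * i + 1) = f (2 * i + 1) := by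
      rw [famD_odd g hodd, gY, g0 _ (by omega) (by omega), map_zero, zero_sub, hYy]
    have Dg0 : ∀ p, p + 1 ≠ 2 * i → p ≠ 2 * i → p ≠ 2 * i + 1 → famD α g p = 0 :=
      fun p h h' h'' => by
        rw [famD_apply, g0 _ h' h'', g0 _ h (by omega), map_zero, map_zero, add_zero]
    -- On the two columns of the pair this is the cycle condition for `f`; to their left it follows
    -- from `b'N = Nb`, `N(1-t) = 0` and `(1-t)N = 0`. The identity `b² = 0` is not needed.
    have hDD : famD α (famD α g) = 0 := by
      funext p
      by_cases hp1 : p = 2 * i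
      · subst hp1
        rw [famD_even _ hev, Dg1, Dg2]
        exact h1
      by_cases hp2 : p = 2 * i + 1
      · subst hp2
        rw [famD_odd _ hodd, Dg2, Dg0 _ (by omega) (by omega) (by omega)]
        exact h2
      by_cases hp3 : p + 1 = 2 * i
      · have hpo : ¬ Even p := by rw [← hp3, Nat.even_add_one] at hev; exact hev
        rw [famD_odd _ hpo, hp3, Dg1, famD_odd _ hpo, hp3, g0 p hp1 hp2, gX, map_zero, sub_zero,
          barL_nrm, ← map_sub, ← hXx, map_sub, map_add, map_sub, nrm_tcyc]
        simp
      by_cases hp4 : p + 2 = 2 * i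
      · have : famD α g (p + 1) = horizL α (p + 1) X := by
          rw [famD_apply, hp4, gX, g0 (p + 1) (by omega) (by omega), map_zero, add_zero]
        rw [famD_apply, this, horizL_horizL, Dg0 p hp3 hp1 hp2, map_zero]
        rfl
      · have : famD α g (p + 1) = 0 ∨ p + 1 = 2 * i + 1 := by
          by_cases h : p + 1 = 2 * i + 1
          · exact Or.inr h
          · exact Or.inl (Dg0 _ (by omega) (by omega) (by omega))
        rcases this with h | h
        · rw [famD_apply, h, Dg0 p hp3 hp1 hp2, map_zero, map_zero, add_zero]; rfl
        · omega
    have hzero' : ∀ p, 2 * i ≤ p → (f - famD α g) p = 0 := fun p hp => by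
      rw [Pi.sub_apply]
      by_cases hp1 : p = 2 * i
      · subst hp1; rw [Dg1, sub_self]
      by_cases hp2 : p = 2 * i + 1
      · subst hp2; rw [Dg2, sub_self]
      rw [hzero p (by omega), Dg0 p (by omega) hp1 hp2, sub_self]
    have hfg : f - famD α g ∈ famPart α n w := Submodule.sub_mem _ hf (famD_mem hg)
    obtain ⟨g', hg', hgf', hg0'⟩ := ih (f - famD α g) hfg (by rw [map_sub, hcyc, hDD, sub_zero])
      -- In the pairs further left the words are longer, hence all degenerate, so the correction by
      -- `g` does no harm there.
      hzero' (fun i' hi' => by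
        rcases Nat.lt_or_ge i' i with h | h
        · right
          have hfg' := mem_famPart.mp hfg
          have hy' : cns none ((f - famD α g) (2 * i' + 1)) ∈ homPart α (n - 2 * i' + 1) w := by
            have := cns_none_mem_homPart (hfg'.1 (2 * i' + 1) (by omega))
            rwa [show n - (2 * i' + 1) + 1 + 1 = n - 2 * i' + 1 by omega] at this
          exact ⟨hk (n - 2 * i' + 1) (by omega) (Submodule.add_mem _ (hfg'.1 _ hi')
            (Submodule.sub_mem _ hy' (tcyc_mem_homPart hy'))), fun k hk' => hk k (by omega)⟩
        · exact Or.inl ⟨hzero' _ (by omega), hzero' _ (by omega)⟩)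
    refine ⟨g + g', Submodule.add_mem _ hg hg', by rw [map_add, hgf']; abel, fun p hp => ?_⟩
    rw [Pi.add_apply, g0 p (by omega) (by omega), hg0' p (by omega), add_zero]

end Families

end CyclicHom

end

noncomputable section

namespace CyclicHom

/-! ### The bottom row -/

section Bottom

variable {α : Type*}

theorem bar_of_none_not_mem {l : List (Option α)} (h : none ∉ l) : bar l = 0 := by
  induction l with
  | nil => rfl
  | cons a l ih =>
    rw [List.mem_cons, not_or] at h
    rw [bar, ih h.2, map_zero, sub_zero]
    rcases a with _ | a
    · exact absurd rfl h.1
    rcases l with _ | ⟨_ | b, l⟩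
    · simp
    · simp at h
    · simp

theorem dzero_of_none_not_mem {l : List (Option α)} (h : none ∉ l) : dzero l = 0 := by
  rcases l with _ | ⟨_ | a, _ | ⟨_ | b, l⟩⟩ <;> simp_all [dzero]

theorem barL_of_mem_top {w : ℕ} {m : Wd α} (hm : m ∈ homPart α w w) : barL α m = 0 :=
  supported_ext (g := 0) (fun l hl => by
    rw [barL, lin_ww, bar_of_none_not_mem (none_not_mem_of_wt (hl.2.trans hl.1.symm))]; rfl) hm

theorem hochL_of_mem_top {w : ℕ} {m : Wd α} (hm : m ∈ homPart α w w) : hochL α m = 0 := by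
  rw [hochL, LinearMap.add_apply, barL_of_mem_top hm, zero_add]
  refine supported_ext (f := lin dzero) (g := 0) (fun l hl => ?_) (tcyc_mem_homPart hm)
  rw [lin_ww, dzero_of_none_not_mem (none_not_mem_of_wt (hl.2.trans hl.1.symm))]; rfl

/-- Every product of neighbours in such a word is `x_i x_j = 0`, so this row is a subcomplex. -/
theorem vertL_of_mem_top {w p : ℕ} {m : Wd α} (hm : m ∈ homPart α w w) : vertL α p m = 0 := by
  unfold vertL
  split_ifs
  · exact hochL_of_mem_top hm
  · rw [LinearMap.neg_apply, barL_of_mem_top hm, neg_zero]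

/-! ### The retraction onto the bottom row -/

/-- Remove a leading `1`; words starting with another letter are sent to `0`. -/
def stripList : List (Option α) → Wd α
  | none :: l => ww l
  | _ => 0

/-- Remove a leading `1`, linearly extended. -/
def strip (α : Type*) : Wd α →ₗ[ℤ] Wd α := lin stripList

@[simp] theorem strip_none (l : List (Option α)) : strip α (ww (none :: l)) = ww l := lin_ww _ _

@[simp] theorem strip_some (x : α) (l : List (Option α)) : strip α (ww (some x :: l)) = 0 :=
  lin_ww _ _

/-- The two faces absorbing the single unit carry opposite signs and cancel; if the unit is last,
only one of them exists. -/
theorem bar_append_none {p q : List (Option α)} (hp : none ∉ p) (hq : none ∉ q) (hp0 : p ≠ []) :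
    bar (p ++ none :: q) = if q = [] then (-1 : ℤ) ^ (p.length + 1) • ww p else 0 := by
  induction p with
  | nil => exact absurd rfl hp0
  | cons a p ih =>
    rw [List.mem_cons, not_or] at hp
    rcases a with _ | a
    · exact absurd rfl hp.1
    rcases p with _ | ⟨_ | b, p⟩
    · rw [List.cons_append, List.nil_append, bar, bar, bar_of_none_not_mem hq]
      rcases q with _ | ⟨c, q⟩ <;> simp
    · simp at hp
    · rw [List.cons_append, bar, ih hp.2 (by simp)]
      split_ifs <;> simp [pow_succ]

/-- The shapes of words of length `w + 1` and weight `w`. -/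
theorem word_cases {w : ℕ} {l : List (Option α)} (hl : l.length = w + 1) (hw : wt l = w) :
    ∃ p q : List (Option α), l = p ++ none :: q ∧ none ∉ p ∧ none ∉ q := by
  obtain ⟨p, q, rfl⟩ := List.append_of_mem (none_mem_of_wt (l := l) (by omega))
  refine ⟨p, q, rfl, none_not_mem_of_wt ?_, none_not_mem_of_wt ?_⟩
  all_goals
    have h1 := wt_le_length p
    have h2 := wt_le_length q
    rw [wt_append, wt_none] at hw
    rw [List.length_append, List.length_cons] at hl
    omega

theorem strip_sub_tcyc_word {p q : List (Option α)} (hp : none ∉ p) (hq : none ∉ q)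
    (h0 : p ++ q ≠ []) :
    strip α (ww (p ++ none :: q) - tcyc α (ww (p ++ none :: q))) = bar (p ++ none :: q) := by
  rw [map_sub, tcyc_ww, map_smul]
  rcases p with _ | ⟨_ | a, p⟩
  · rcases List.eq_nil_or_concat q with rfl | ⟨q, _ | z, rfl⟩
    · simp at h0
    · simp at hq
    · rw [List.concat_eq_append] at *
      rw [List.nil_append, bar, bar_of_none_not_mem hq, ← List.cons_append, rotR_append]
      simp only [strip_some, List.cons_append, strip_none]
      rcases q with _ | ⟨b, q⟩ <;> simp
  · simp at hp
  · rw [bar_append_none hp hq (by simp)]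
    rcases List.eq_nil_or_concat q with rfl | ⟨q, _ | z, rfl⟩
    · rw [if_pos rfl, rotR_append, strip_none, List.cons_append, strip_some]
      simp [pow_succ]
    · simp at hq
    · rw [List.concat_eq_append, ← List.cons_append, ← List.append_assoc, rotR_append]
      simp

/-- Such words contain exactly one unit. Only a unit at the start, or at the end and brought to the
front by `t`, contributes to the left side, and these are also the positions where the faces of `b'`
do not cancel. -/
theorem strip_sub_tcyc {w : ℕ} (hw : 0 < w) {m : Wd α} (hm : m ∈ homPart α (w + 1) w) :
    strip α (m - tcyc α m) = barL α m := by
  suffices h : (strip α ∘ₗ (LinearMap.id - tcyc α)) m = barL α m by simpa using h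
  refine supported_ext (fun l hl => ?_) hm
  obtain ⟨p, q, rfl, hp, hq⟩ := word_cases hl.1 hl.2
  rw [barL, lin_ww, ← strip_sub_tcyc_word hp hq]
  · rfl
  · intro h
    have := hl.1
    rw [List.append_eq_nil_iff] at h
    simp [h.1, h.2] at this
    omega

/-- All faces cancel unless the unit is the first letter. For `1 ⊗ q` the first face gives `q` and
the last one gives `-t q`. -/
theorem hochL_eq_strip {w : ℕ} (hw : 0 < w) {m : Wd α} (hm : m ∈ homPart α (w + 1) w) :
    hochL α m = strip α m - tcyc α (strip α m) := by
  suffices h : hochL α m = ((LinearMap.id - tcyc α) ∘ₗ strip α) m by simpa using h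
  refine supported_ext (fun l hl => ?_) hm
  have hlen := hl.1
  obtain ⟨p, q, rfl, hp, hq⟩ := word_cases hl.1 hl.2
  have hb := strip_sub_tcyc_word hp hq (fun h => by
    rw [List.append_eq_nil_iff] at h
    simp [h.1, h.2] at hlen
    omega)
  rw [hochL, LinearMap.add_apply, LinearMap.comp_apply, barL, lin_ww, ← hb, map_sub, tcyc_ww,
    map_smul, map_smul, lin_ww, LinearMap.comp_apply, LinearMap.sub_apply, LinearMap.id_apply]
  rcases List.eq_nil_or_concat q with rfl | ⟨q, _ | z, rfl⟩
  · rw [rotR_append, strip_none]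
    rcases p with _ | ⟨_ | a, p⟩
    · simp at hlen; omega
    · simp at hp
    · simp [dzero]
  · simp at hq
  · rw [List.concat_eq_append, ← List.cons_append, ← List.append_assoc, rotR_append]
    rcases p with _ | ⟨_ | a, p⟩
    · simp [dzero, tcyc_ww, pow_succ, sub_eq_add_neg]
    · simp at hp
    · simp [dzero]

/-- For a word `1 ⊗ k`, the two end faces of `b` give `k - t k` and the others `-1 ⊗ b' k`, so the
claim is `strip_sub_tcyc` for `k`. A word starting with a variable never acquires a leading `1`. -/
theorem strip_hochL {w : ℕ} (hw : 0 < w) {m : Wd α} (hm : m ∈ homPart α (w + 2) w) :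
    strip α (hochL α m) = 0 := by
  refine supported_ext (f := strip α ∘ₗ hochL α) (g := 0) (fun l hl => ?_) hm
  have hlen := hl.1
  have hsome : ∀ (x : α) (m : Wd α), strip α (cns (some x) m) = 0 := fun x m => by
    have : strip α ∘ₗ cns (some x) = 0 := wd_ext fun l => by simp
    exact LinearMap.congr_fun this m
  have hnone : ∀ (m : Wd α), strip α (cns none m) = m := fun m => by
    have : strip α ∘ₗ cns none = LinearMap.id := wd_ext fun l => by simp
    exact LinearMap.congr_fun this m
  rcases l with _ | ⟨_ | x, k⟩
  · simp at hlen
  · have hk : ww k ∈ homPart α (w + 1) w :=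
      ww_mem_homPart (by simpa using hl.1) (by simpa using hl.2)
    have h := strip_sub_tcyc hw hk
    rw [barL, lin_ww, map_sub, tcyc_ww, map_smul] at h
    rcases List.eq_nil_or_concat k with rfl | ⟨k, z, rfl⟩
    · simp at hlen
    rw [List.concat_eq_append] at *
    rw [rotR_append] at h
    have h1 : mulHead none (k ++ [z]) = ww (k ++ [z]) := by cases k <;> rfl
    rw [LinearMap.comp_apply, hochL, LinearMap.add_apply, LinearMap.comp_apply, barL, lin_ww, bar,
      map_add, map_sub, hnone, tcyc_ww, ← List.cons_append, rotR_append, map_smul, lin_ww, dzero,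
      mulHead_cons_none, h1, ← h, map_smul, List.cons_append, List.length_cons]
    simp [pow_succ]
  · obtain ⟨m, hm⟩ := bar_some_eq x k
    rw [LinearMap.comp_apply, hochL, LinearMap.add_apply, LinearMap.comp_apply, barL, lin_ww, hm,
      map_add, hsome, tcyc_ww, map_smul, lin_ww, zero_add, map_smul]
    rcases List.eq_nil_or_concat k with rfl | ⟨k, z, rfl⟩
    · simp [rotR, dzero]
    · rw [List.concat_eq_append, ← List.cons_append, rotR_append]
      cases z <;> simp [dzero]

theorem strip_mem_homPart {n w : ℕ} {m : Wd α} (hm : m ∈ homPart α (n + 1) w) :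
    strip α m ∈ homPart α n w :=
  supported_induction (fun l hl => by
    rcases l with _ | ⟨_ | x, k⟩
    · simp at hl
    · rw [strip_none]; exact ww_mem_homPart (by simpa using hl.1) (by simpa using hl.2)
    · simp) hm

/-- The retraction of the total complex onto the bottom row, at column `j`. -/
def phi (α : Type*) (j : ℕ) : (ℕ → Wd α) →ₗ[ℤ] Wd α :=
  if Even j then LinearMap.proj (φ := fun _ : ℕ => Wd α) j else
    strip α ∘ₗ LinearMap.proj (φ := fun _ : ℕ => Wd α) (j - 1) + LinearMap.proj j

theorem phi_even {j : ℕ} (hj : Even j) (f : ℕ → Wd α) : phi α j f = f j := by simp [phi, hj]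

theorem phi_odd {j : ℕ} (hj : ¬ Even j) (f : ℕ → Wd α) :
    phi α j f = strip α (f (j - 1)) + f j := by simp [phi, hj]

variable {n w j : ℕ}

theorem phi_mem (hj : j + w = n + 1) (hw : 0 < w) {f : ℕ → Wd α} (hf : f ∈ famPart α n w) :
    phi α j f ∈ homPart α w w := by
  rw [mem_famPart] at hf
  have h1 := hf.1 j (by omega)
  rw [show n - j + 1 = w by omega] at h1
  by_cases he : Even j
  · rwa [phi_even he]
  · rw [phi_odd he]
    refine Submodule.add_mem _ (strip_mem_homPart ?_) h1
    have hj0 : j ≠ 0 := by rintro rfl; simp at he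
    have := hf.1 (j - 1) (by omega)
    rwa [show n - (j - 1) + 1 = w + 1 by omega] at this

/-- The retraction is a chain map: for `j` even this is `hochL_eq_strip`; for `j` odd,
`strip_sub_tcyc` turns the horizontal part from the even column into the `b'` term and cancels it,
and `strip_hochL` kills the rest. -/
theorem phi_famD (hj : j + w = n + 1) (hw : 0 < w) {f : ℕ → Wd α}
    (hf : f ∈ famPart α (n + 1) w) : phi α j (famD α f) = horizL α j (phi α (j + 1) f) := by
  rw [mem_famPart] at hf
  have h1 := hf.1 j (by omega)
  rw [show n + 1 - j + 1 = w + 1 by omega] at h1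
  by_cases he : Even j
  · rw [phi_even he, phi_odd (by simpa [Nat.even_add_one] using he), famD_even f he,
      hochL_eq_strip hw h1]
    simp [horizL, he]
    abel
  · have hj0 : j ≠ 0 := by rintro rfl; simp at he
    have h2 := hf.1 (j - 1) (by omega)
    rw [show n + 1 - (j - 1) + 1 = w + 2 by omega] at h2
    have hjp : Even (j - 1) := by
      rcases j with _ | j
      · exact absurd rfl hj0
      · simpa [Nat.even_add_one] using he
    rw [phi_odd he, phi_even (by simpa [Nat.even_add_one] using he), famD_odd f he,
      famD_even f hjp, Nat.sub_add_cancel (by omega), map_add, strip_sub_tcyc hw h1,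
      strip_hochL hw h2]
    simp [horizL, he]

theorem phi_single (m : Wd α) : phi α j (Pi.single j m) = m := by
  by_cases he : Even j
  · rw [phi_even he, Pi.single_eq_same]
  · have hj0 : j ≠ 0 := by rintro rfl; simp at he
    rw [phi_odd he, Pi.single_eq_same, Pi.single_eq_of_ne (by omega), map_zero, zero_add]

theorem bottom_mem (hj : j + w = n + 1) (hw : 0 < w) {m : Wd α} (hm : m ∈ homPart α w w) :
    Pi.single j m ∈ famPart α n w :=
  single_mem_famPart (by omega) (by rwa [show n - j + 1 = w by omega])

theorem famD_bottom_succ {m : Wd α} (hm : m ∈ homPart α w w) :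
    famD α (Pi.single (j + 1) m) = Pi.single j (horizL α j m) := by
  rw [famD_single, vertL_of_mem_top hm, Pi.single_zero, add_zero]

theorem famD_bottom_zero {m : Wd α} (hm : m ∈ homPart α w w) :
    famD α (Pi.single 0 m) = 0 := by
  rw [famD_single_zero, vertL_of_mem_top hm, Pi.single_zero]

theorem homPart_le_degPart {k : ℕ} (hk : w + 2 ≤ k) : homPart α k w ≤ degPart α := by
  refine Finsupp.supported_mono fun l hl => ?_
  rcases l with _ | ⟨a, l⟩
  · have := hl.1; simp at this; omega
  · refine none_mem_of_wt (l := l) ?_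
    have h1 := hl.1
    have h2 := hl.2
    cases a <;> simp at h1 h2 <;> omega

/-- A word with one unit is nondegenerate exactly when the unit comes first, and `strip` reads off
the coefficients of those words. -/
theorem mem_degPart_of_strip {m : Wd α} (hm : m ∈ homPart α (w + 1) w) (h0 : strip α m = 0) :
    m ∈ degPart α := by
  rw [degPart, Finsupp.mem_supported]
  intro l hl
  have hl' := (Finsupp.mem_supported ℤ m).mp hm hl
  obtain ⟨p, q, rfl, hp, hq⟩ := word_cases hl'.1 hl'.2
  rcases p with _ | ⟨a, p⟩
  · exfalso
    classical
    have key : ∀ m : Wd α, strip α m q = m (none :: q) := fun m => by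
      have : Finsupp.lapply q ∘ₗ strip α = Finsupp.lapply (none :: q) := wd_ext fun l => by
        rw [LinearMap.comp_apply]
        rcases l with _ | ⟨_ | x, l⟩
        · rw [strip, lin_ww]; simp [stripList, ww]
        · rw [strip_none]; simp [ww, Finsupp.single_apply]
        · rw [strip_some]; simp [ww]
      exact LinearMap.congr_fun this m
    have := key m
    rw [h0] at this
    simp at hl
    exact hl this.symm
  · simp

/-- Cycles that vanish on the bottom row are boundaries. -/
theorem exists_of_phi_eq_zero (hj : j + w = n + 1) (hw : 0 < w) {f : ℕ → Wd α}
    (hf : f ∈ famPart α n w) (hcyc : famD α f = 0) (hphi : phi α j f = 0) :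
    ∃ g ∈ famPart α (n + 1) w, famD α g = f := by
  have hf' := mem_famPart.mp hf
  obtain ⟨g, hg, hgf, -⟩ := exists_famD_eq (n + 1) f hf hcyc (fun p hp => hf'.2 p (by omega))
    (fun i hi => by
      have hx := hf'.1 (2 * i) hi
      rcases Nat.lt_trichotomy (n - 2 * i + 1) w with h | h | h
      -- This pair has too few letters to reach weight `w`.
      · left
        refine ⟨homPart_eq_zero h hx, ?_⟩
        rcases Nat.lt_or_ge n (2 * i + 1) with h' | h'
        · exact hf'.2 _ h'
        · exact homPart_eq_zero (by omega) (hf'.1 _ h')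
      -- The bottom row sits in the even column; the odd column of the pair has words shorter than
      -- `w`.
      · left
        obtain rfl : j = 2 * i := by omega
        rw [phi_even (even_two_mul i)] at hphi
        refine ⟨hphi, ?_⟩
        rcases Nat.lt_or_ge n (2 * i + 1) with h' | h'
        · exact hf'.2 _ h'
        · exact homPart_eq_zero (by omega) (hf'.1 _ h')
      · right
        have hy := cns_none_mem_homPart (hf'.1 (2 * i + 1) (by omega))
        rw [show n - (2 * i + 1) + 1 + 1 = n - 2 * i + 1 by omega] at hy
        refine ⟨?_, fun k hk => homPart_le_degPart (by omega)⟩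
        have hmem := Submodule.add_mem _ hx (Submodule.sub_mem _ hy (tcyc_mem_homPart hy))
        rcases Nat.lt_or_ge (w + 1) (n - 2 * i + 1) with h' | h'
        · exact homPart_le_degPart (by omega) hmem
        -- The bottom row sits in the odd column. The hypothesis says `strip x + y = 0`, and `strip
        -- ((1-t)(1 ⊗ y)) = b'(1 ⊗ y) = y`, so the combined Hochschild cycle has no leading unit.
        · obtain rfl : j = 2 * i + 1 := by omega
          rw [show n - 2 * i + 1 = w + 1 by omega] at hmem hy
          refine mem_degPart_of_strip hmem ?_
          rw [phi_odd (by simp), Nat.add_sub_cancel] at hphi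
          have hyt := hf'.1 (2 * i + 1) (by omega)
          rw [show n - (2 * i + 1) + 1 = w by omega] at hyt
          rw [map_add, strip_sub_tcyc hw hy, barL_cns_none (n := w - 1)
            (by rw [Nat.sub_add_cancel hw]; exact homPart_le_lenPart _ _ hyt),
            barL_of_mem_top hyt, map_zero, sub_zero, hphi])
  exact ⟨g, hg, hgf⟩

/-- A cycle is a boundary if and only if its bottom row part is one. -/
theorem exists_famD_iff (hj : j + w = n + 1) (hw : 0 < w) {f : ℕ → Wd α}
    (hf : f ∈ famPart α n w) (hcyc : famD α f = 0) :
    (∃ g ∈ famPart α (n + 1) w, famD α g = f) ↔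
      ∃ m ∈ homPart α w w, horizL α j m = phi α j f := by
  constructor
  · rintro ⟨g, hg, rfl⟩
    exact ⟨phi α (j + 1) g, phi_mem (by omega) hw hg, (phi_famD hj hw hg).symm⟩
  · rintro ⟨m, hm, hmf⟩
    have hb := bottom_mem (j := j + 1) (n := n + 1) (by omega) hw hm
    have hbm : horizL α j m ∈ homPart α w w := horizL_mem hm
    have hD : famD α (Pi.single j (horizL α j m)) = 0 := by
      rcases j with _ | j
      · exact famD_bottom_zero hbm
      · rw [famD_bottom_succ hbm, horizL_horizL, Pi.single_zero]
    obtain ⟨g, hg, hgf⟩ := exists_of_phi_eq_zero (f := f - Pi.single j (horizL α j m)) hj hw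
      (Submodule.sub_mem _ hf (bottom_mem hj hw hbm)) (by rw [map_sub, hcyc, hD, sub_zero])
      (by rw [map_sub, phi_single, hmf, sub_self])
    exact ⟨g + Pi.single (j + 1) m, Submodule.add_mem _ hg hb, by
      rw [map_add, hgf, famD_bottom_succ hm]; abel⟩

/-- The bottom row part of a cycle is a cycle. -/
theorem horizL_phi (hj : j + 1 + w = n + 1) (hw : 0 < w) {f : ℕ → Wd α}
    (hf : f ∈ famPart α n w) (hcyc : famD α f = 0) : horizL α j (phi α (j + 1) f) = 0 := by
  obtain ⟨n, rfl⟩ : ∃ n', n = n' + 1 := ⟨n - 1, by omega⟩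
  rw [← phi_famD (by omega) hw hf, hcyc, map_zero]

/-! ### Weight zero -/

theorem homPart_zero_le_degPart {k : ℕ} (hk : 2 ≤ k) : homPart α k 0 ≤ degPart α :=
  homPart_le_degPart (by omega)

/-- In weight 0 every word of length at least 2 is degenerate, so the only obstruction is the word
`1` in row 0. It matters only when column `n` is even; in an odd column it is removed together with
its bar column. -/
theorem exists_famD_eq_of_weight_zero {i : ℕ} {f : ℕ → Wd α} (hf : f ∈ famPart α n 0)
    (hcyc : famD α f = 0) (h0 : Even n → f n = 0) (hi : ∀ p, 2 * i ≤ p → f p = 0) :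
    ∃ g ∈ famPart α (n + 1) 0, famD α g = f ∧ ∀ p, 2 * i ≤ p → g p = 0 := by
  have hf' := mem_famPart.mp hf
  refine exists_famD_eq i f hf hcyc hi (fun i hi => ?_)
  rcases Nat.eq_or_lt_of_le hi with h | h
  · exact Or.inl ⟨h ▸ h0 (h ▸ even_two_mul i), hf'.2 _ (by omega)⟩
  · right
    have hy := cns_none_mem_homPart (hf'.1 (2 * i + 1) (by omega))
    rw [show n - (2 * i + 1) + 1 + 1 = n - 2 * i + 1 by omega] at hy
    exact ⟨homPart_zero_le_degPart (by omega) (Submodule.add_mem _ (hf'.1 _ hi)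
      (Submodule.sub_mem _ hy (tcyc_mem_homPart hy))),
      fun k hk => homPart_zero_le_degPart (by omega)⟩

theorem tcyc_of_mem_one_zero {m : Wd α} (hm : m ∈ homPart α 1 0) : tcyc α m = m :=
  supported_ext (g := LinearMap.id) (fun l hl => by
    obtain ⟨a, rfl⟩ := List.length_eq_one_iff.mp hl.1
    simp [tcyc_ww, rotR]) hm

theorem hochL_of_mem_two_zero {m : Wd α} (hm : m ∈ homPart α 2 0) : hochL α m = 0 :=
  supported_ext (g := 0) (fun l hl => by
    obtain ⟨a, b, rfl⟩ := List.length_eq_two.mp hl.1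
    have h := hl.2
    cases a <;> cases b <;> simp at h
    simp [hochL, barL, tcyc_ww, rotR, bar, dzero]) hm

/-- Nothing hits the word `1` in an even column: `1 - t` vanishes on words of length one, and `b (1
⊗ 1) = 1 - 1 = 0`. -/
theorem famD_apply_top_of_weight_zero (hn : Even n) {g : ℕ → Wd α}
    (hg : g ∈ famPart α (n + 1) 0) : famD α g n = 0 := by
  have hg' := mem_famPart.mp hg
  have h1 := hg'.1 (n + 1) le_rfl
  have h2 := hg'.1 n (by omega)
  rw [show n + 1 - (n + 1) + 1 = 1 by omega] at h1
  rw [show n + 1 - n + 1 = 2 by omega] at h2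
  rw [famD_even g hn, tcyc_of_mem_one_zero h1, hochL_of_mem_two_zero h2]
  simp

/-- The boundary of `m` placed in column `n` is a cycle of odd degree, hence a boundary by the
previous results, and of a family vanishing in column `n`; subtracting that family does not change
the entry `m`. -/
theorem exists_cycle_weight_zero (hn : Even n) {m : Wd α} (hm : m ∈ homPart α 1 0) :
    ∃ f ∈ famPart α n 0, famD α f = 0 ∧ f n = m := by
  have hv : ∀ p, ∀ m' ∈ homPart α 1 0, vertL α p m' = 0 := fun p m' h => vertL_of_length_one h
  rcases n with _ | n
  · refine ⟨Pi.single 0 m, single_mem_famPart le_rfl (by simpa using hm), ?_, by simp⟩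
    rw [famD_single_zero, hv 0 m hm, Pi.single_zero]
  · have hn' : ¬ Even n := by simpa [Nat.even_add_one] using hn
    obtain ⟨i, hi⟩ := hn
    have hD : famD α (Pi.single (n + 1) m) = Pi.single n (horizL α n m) := by
      rw [famD_single, hv _ m hm, Pi.single_zero, add_zero]
    have hh : horizL α n m ∈ homPart α 1 0 := horizL_mem hm
    have hDD : famD α (Pi.single n (horizL α n m)) = 0 := by
      rcases n with _ | n
      · simp at hn'
      · rw [famD_single, horizL_horizL, hv _ _ hh, Pi.single_zero, Pi.single_zero, add_zero]
    obtain ⟨g, hg, hgf, hg0⟩ := exists_famD_eq_of_weight_zero (n := n) (i := i)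
      (single_mem_famPart le_rfl (by simpa using hh)) hDD (fun h => absurd h hn') (fun p hp => by
        rw [Pi.single_eq_of_ne (by omega)])
    refine ⟨Pi.single (n + 1) m - g,
      Submodule.sub_mem _ (single_mem_famPart le_rfl (by simpa using hm)) hg, ?_, ?_⟩
    · rw [map_sub, hD, hgf, sub_self]
    · rw [Pi.sub_apply, Pi.single_eq_same, hg0 _ (by omega), sub_zero]

end Bottom

end CyclicHom

end

noncomputable section

namespace CyclicHom

/-! ### The monomial basis of `A^{⊗ (n+1)}` -/

section Transport

variable {d : ℕ}

theorem letter_some_mul_some (i j : Fin d) :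
    letter ℤ d (some i) * letter ℤ d (some j) = 0 := by
  change Ideal.Quotient.mk _ _ * Ideal.Quotient.mk _ _ = 0
  rw [← map_mul, Ideal.Quotient.eq_zero_iff_mem, pow_two]
  exact Ideal.mul_mem_mul (Ideal.subset_span ⟨i, rfl⟩) (Ideal.subset_span ⟨j, rfl⟩)

theorem letter_none_mul (b : Option (Fin d)) : letter ℤ d none * letter ℤ d b = letter ℤ d b :=
  one_mul _

theorem letter_mul_none (b : Option (Fin d)) : letter ℤ d b * letter ℤ d none = letter ℤ d b :=
  mul_one _

theorem span_letter : ⊤ ≤ Submodule.span ℤ (Set.range (letter ℤ d)) := by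
  rintro x -
  obtain ⟨p, rfl⟩ := Ideal.Quotient.mk_surjective x
  set S := Submodule.span ℤ (Set.range (letter ℤ d))
  have hmul : ∀ (b : Option (Fin d)), ∀ y ∈ S, y * letter ℤ d b ∈ S := by
    intro b y hy
    have : S ≤ S.comap (LinearMap.mulRight ℤ (letter ℤ d b)) := by
      refine Submodule.span_le.mpr ?_
      rintro _ ⟨a, rfl⟩
      change letter ℤ d a * letter ℤ d b ∈ S
      rcases a with _ | a
      · rw [letter_none_mul]; exact Submodule.subset_span ⟨b, rfl⟩
      rcases b with _ | b
      · rw [letter_mul_none]; exact Submodule.subset_span ⟨some a, rfl⟩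
      · rw [letter_some_mul_some]; exact Submodule.zero_mem _
    exact this hy
  induction p using MvPolynomial.induction_on with
  | C a =>
    have : Ideal.Quotient.mk ((Ideal.span (Set.range (MvPolynomial.X (R := ℤ) (σ := Fin d)))) ^ 2)
        (MvPolynomial.C a) = a • letter ℤ d none := by
      change _ = a • (1 : Alg ℤ d)
      simp
    rw [this]
    exact Submodule.smul_mem _ _ (Submodule.subset_span ⟨none, rfl⟩)
  | add p q hp hq => rw [map_add]; exact Submodule.add_mem _ hp hq
  | mul_X p i hp => rw [map_mul]; exact hmul (some i) _ hp

/-- The coordinates of an element with respect to the monomials, as an algebra map. -/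
def algCoord (d : ℕ) : Alg ℤ d →ₐ[ℤ] TrivSqZeroExt ℤ (Fin d → ℤ) :=
  Ideal.Quotient.liftₐ _
    (MvPolynomial.aeval fun j => TrivSqZeroExt.inr (Pi.single j (1 : ℤ)))
    (fun a ha => by
      have : (Ideal.span (Set.range (MvPolynomial.X (R := ℤ) (σ := Fin d)))) ^ 2 ≤
          RingHom.ker (MvPolynomial.aeval (R := ℤ)
            fun j : Fin d => TrivSqZeroExt.inr (R := ℤ) (Pi.single j (1 : ℤ))) := by
        rw [pow_two, Ideal.span_mul_span', Ideal.span_le]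
        rintro _ ⟨_, ⟨i, rfl⟩, _, ⟨j, rfl⟩, rfl⟩
        simp [RingHom.mem_ker]
      exact this ha)

theorem algCoord_none : algCoord d (letter ℤ d none) = 1 := map_one _

theorem algCoord_some (j : Fin d) :
    algCoord d (letter ℤ d (some j)) = TrivSqZeroExt.inr (Pi.single j (1 : ℤ)) := by
  exact MvPolynomial.aeval_X _ j

/-- The square-zero extension of ℤ by ℤ^d receives `A` and separates `1` from the `x_j`, so no
relation arises from dividing by `𝔪²`. -/
theorem linearIndependent_letter : LinearIndependent ℤ (letter ℤ d) := by
  refine LinearIndependent.of_comp (algCoord d).toLinearMap ?_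
  rw [Fintype.linearIndependent_iff]
  intro g hg a
  simp only [Function.comp_apply, AlgHom.toLinearMap_apply, Fintype.sum_option, algCoord_none,
    algCoord_some] at hg
  rcases a with _ | j
  · have := congr_arg TrivSqZeroExt.fst hg
    simpa [TrivSqZeroExt.fst_sum] using this
  · have := congr_fun (congr_arg TrivSqZeroExt.snd hg) j
    simpa [TrivSqZeroExt.snd_sum, Finset.sum_apply, Pi.single_apply] using this

/-- The basis of monomials of `ℤ[x₁, …, x_d] / 𝔪²`. -/
def letterBasis (d : ℕ) : Module.Basis (Option (Fin d)) ℤ (Alg ℤ d) :=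
  Module.Basis.mk linearIndependent_letter span_letter

/-- The basis of tensor monomials. -/
def chainBasis (d n : ℕ) :
    Module.Basis (Fin (n + 1) → Option (Fin d)) ℤ (Chain ℤ (Alg ℤ d) n) :=
  Basis.piTensorProduct fun _ => letterBasis d

theorem chainBasis_apply {n : ℕ} (u : Fin (n + 1) → Option (Fin d)) :
    chainBasis d n u = PiTensorProduct.tprod ℤ fun i => letter ℤ d (u i) := by
  simp [chainBasis, letterBasis]

/-- The identification of `A^{⊗ (n+1)}` with the span of the words of length `n + 1`. -/
def iota (d n : ℕ) : Chain ℤ (Alg ℤ d) n →ₗ[ℤ] Wd (Fin d) :=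
  Finsupp.lmapDomain ℤ ℤ (fun u : Fin (n + 1) → Option (Fin d) => List.ofFn u) ∘ₗ
    (chainBasis d n).repr.toLinearMap

theorem iota_injective (n : ℕ) : Function.Injective (iota d n) :=
  (Finsupp.mapDomain_injective List.ofFn_injective).comp (chainBasis d n).repr.injective

theorem iota_basis {n : ℕ} (u : Fin (n + 1) → Option (Fin d)) :
    iota d n (chainBasis d n u) = ww (List.ofFn u) := by
  simp [iota, ww]

theorem iota_tprod {n : ℕ} (u : Fin (n + 1) → Option (Fin d)) :
    iota d n (PiTensorProduct.tprod ℤ fun i => letter ℤ d (u i)) = ww (List.ofFn u) := by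
  rw [← chainBasis_apply, iota_basis]

theorem wt_ofFn {α : Type*} {n : ℕ} (u : Fin n → Option α) :
    wt (List.ofFn u) = (Finset.univ.filter fun i => u i ≠ none).card := by
  induction n with
  | zero => simp
  | succ n ih =>
    rw [List.ofFn_succ, Fin.card_filter_univ_succ]
    have := ih fun i => u i.succ
    rw [← this]
    cases h : u 0 <;> simp

theorem map_weightPart (n w : ℕ) :
    (weightPart ℤ d n w).map (iota d n) = homPart (Fin d) (n + 1) w := by
  rw [weightPart, Submodule.map_span, homPart, Finsupp.supported_eq_span_single]
  congr 1
  ext m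
  constructor
  · rintro ⟨_, ⟨u, hu, rfl⟩, rfl⟩
    refine ⟨List.ofFn u, ⟨by simp, by rw [wt_ofFn]; convert hu⟩, ?_⟩
    exact (iota_tprod u).symm
  · rintro ⟨l, ⟨hl, hw⟩, rfl⟩
    obtain ⟨u, rfl⟩ : ∃ u : Fin (n + 1) → Option (Fin d), List.ofFn u = l :=
      ⟨fun i => l.get (i.cast hl.symm), List.ext_getElem (by simp [hl]) (by simp [-List.ofFn_succ])⟩
    exact ⟨_, ⟨u, by rw [wt_ofFn] at hw; convert hw, rfl⟩, iota_tprod u⟩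

theorem iota_mem_iff {n w : ℕ} {x : Chain ℤ (Alg ℤ d) n} :
    iota d n x ∈ homPart (Fin d) (n + 1) w ↔ x ∈ weightPart ℤ d n w := by
  rw [← map_weightPart, Submodule.mem_map]
  refine ⟨?_, fun h => ⟨x, h, rfl⟩⟩
  rintro ⟨y, hy, h⟩
  rwa [← iota_injective n h]

theorem chain_ext {n : ℕ} {N : Type*} [AddCommGroup N] {f g : Chain ℤ (Alg ℤ d) n →ₗ[ℤ] N}
    (h : ∀ u : Fin (n + 1) → Option (Fin d),
      f (PiTensorProduct.tprod ℤ fun i => letter ℤ d (u i)) =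
        g (PiTensorProduct.tprod ℤ fun i => letter ℤ d (u i))) : f = g :=
  (chainBasis d n).ext fun u => by rw [chainBasis_apply]; exact h u

/-! ### The structure maps in terms of words -/

theorem iota_rot {n : ℕ} (u : Fin (n + 1) → Option (Fin d)) :
    iota d n (rot ℤ (Alg ℤ d) n (PiTensorProduct.tprod ℤ fun i => letter ℤ d (u i))) =
      ww (rotR (List.ofFn u)) := by
  rw [rot_tprod]
  have : (Fin.cons (letter ℤ d (u (Fin.last n))) (Fin.init fun i => letter ℤ d (u i)) :
      Fin (n + 1) → Alg ℤ d) =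
      fun i => letter ℤ d ((Fin.cons (u (Fin.last n)) (Fin.init u) : Fin (n + 1) → _) i) := by
    funext i
    refine Fin.cases ?_ (fun i => ?_) i <;> simp [Fin.init]
  rw [this, iota_tprod, List.ofFn_succ' u, List.concat_eq_append, rotR_append, List.ofFn_succ]
  simp [Fin.init]

theorem iota_cyc {n : ℕ} (x : Chain ℤ (Alg ℤ d) n) :
    iota d n (cyc ℤ (Alg ℤ d) n x) = tcyc (Fin d) (iota d n x) := by
  have : iota d n ∘ₗ cyc ℤ (Alg ℤ d) n = tcyc (Fin d) ∘ₗ iota d n := chain_ext fun u => by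
    rw [LinearMap.comp_apply, LinearMap.comp_apply, iota_tprod, tcyc_ww, cyc, LinearMap.smul_apply,
      map_smul, iota_rot, List.length_ofFn]
    simp [pow_succ]
  exact LinearMap.congr_fun this x

theorem iota_cycNorm {n : ℕ} (x : Chain ℤ (Alg ℤ d) n) :
    iota d n (cycNorm ℤ (Alg ℤ d) n x) = nrm (Fin d) (iota d n x) := by
  have hpow : ∀ (i : ℕ) (x : Chain ℤ (Alg ℤ d) n),
      iota d n ((cyc ℤ (Alg ℤ d) n ^ i) x) = (tcyc (Fin d) ^ i) (iota d n x) := by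
    intro i
    induction i with
    | zero => intro x; rfl
    | succ i ih =>
      intro x
      rw [pow_succ (cyc _ _ _), pow_succ (tcyc _), Module.End.mul_apply, Module.End.mul_apply, ih,
        iota_cyc]
  have : iota d n ∘ₗ cycNorm ℤ (Alg ℤ d) n = nrm (Fin d) ∘ₗ iota d n := chain_ext fun u => by
    rw [LinearMap.comp_apply, LinearMap.comp_apply, cycNorm, LinearMap.sum_apply, map_sum]
    simp only [hpow, iota_tprod]
    rw [nrm_of_mem (ww_mem_lenPart' (List.length_ofFn (f := u)))]
  exact LinearMap.congr_fun this x

/-- `Option.or` is the product of two letters unless both are variables, in which case the product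
is 0. -/
theorem faceL_ofFn {α : Type*} {n : ℕ} (j : Fin (n + 1)) (u : Fin (n + 2) → Option α) :
    faceL j (List.ofFn u) =
      if (u j.castSucc).isSome ∧ (u j.succ).isSome then 0
      else ww (List.ofFn (Fin.contractNth j.castSucc Option.or u)) := by
  induction n with
  | zero =>
    obtain rfl : j = 0 := Fin.ext (by omega)
    rw [List.ofFn_succ, List.ofFn_succ, List.ofFn_zero]
    simp only [faceL, dzero]
    cases h0 : u 0 <;> cases h1 : u 1 <;> simp [Fin.contractNth, h0, h1]
  | succ n ih =>
    refine Fin.cases ?_ (fun j => ?_) j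
    · rw [List.ofFn_succ, List.ofFn_succ]
      simp only [Fin.val_zero, faceL, dzero]
      rw [List.ofFn_succ (f := Fin.contractNth _ _ _)]
      cases h0 : u 0 <;> cases h1 : u 1 <;> simp [Fin.contractNth, h0, h1]
    · have h2 : Fin.contractNth j.succ.castSucc Option.or u =
          (Fin.cons (u 0) (Fin.contractNth j.castSucc Option.or fun i => u i.succ) :
            Fin (n + 2) → Option α) := by
        funext i
        refine Fin.cases ?_ (fun i => ?_) i
        · simp [Fin.contractNth]
        · simp only [Fin.contractNth, Fin.val_castSucc, Fin.val_succ, Nat.add_lt_add_iff_right,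
            Nat.add_right_cancel_iff, Fin.cons_succ]
          rfl
      rw [List.ofFn_succ, Fin.val_succ, faceL, ih j, h2, List.ofFn_cons]
      simp only [Fin.succ_castSucc]
      split_ifs <;> simp

theorem iota_face {n : ℕ} (j : Fin (n + 1)) (u : Fin (n + 2) → Option (Fin d)) :
    iota d n (face ℤ (Alg ℤ d) n j (PiTensorProduct.tprod ℤ fun i => letter ℤ d (u i))) =
      faceL j (List.ofFn u) := by
  rw [face_tprod, faceL_ofFn]
  split_ifs with h
  · have : Fin.contractNth j.castSucc (· * ·) (fun i => letter ℤ d (u i)) j = 0 := by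
      obtain ⟨a, ha⟩ := Option.isSome_iff_exists.mp h.1
      obtain ⟨b, hb⟩ := Option.isSome_iff_exists.mp h.2
      simp [Fin.contractNth, ha, hb, letter_some_mul_some]
    rw [MultilinearMap.map_coord_zero _ j this, map_zero]
  · have : Fin.contractNth j.castSucc (· * ·) (fun i => letter ℤ d (u i)) =
        fun i => letter ℤ d (Fin.contractNth j.castSucc Option.or u i) := by
      funext i
      simp only [Fin.contractNth]
      split_ifs with h1 h2
      · rfl
      · have hij : i = j := Fin.ext h2
        subst hij
        cases ha : u i.castSucc
        · rw [letter_none_mul]; simp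
        · cases hb : u i.succ
          · rw [letter_mul_none]; simp
          · simp [ha, hb] at h
      · rfl
    rw [this, iota_tprod]

theorem iota_barB {n : ℕ} (x : Chain ℤ (Alg ℤ d) (n + 1)) :
    iota d n (barB ℤ (Alg ℤ d) n x) = barL (Fin d) (iota d (n + 1) x) := by
  have : iota d n ∘ₗ barB ℤ (Alg ℤ d) n = barL (Fin d) ∘ₗ iota d (n + 1) := chain_ext fun u => by
    rw [LinearMap.comp_apply, LinearMap.comp_apply, barB, LinearMap.sum_apply, map_sum, iota_tprod,
      barL, lin_ww, bar_eq_sum, List.length_ofFn, Nat.add_sub_cancel, Finset.sum_range]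
    simp only [LinearMap.smul_apply, map_smul, iota_face]
  exact LinearMap.congr_fun this x

theorem iota_hochB {n : ℕ} (x : Chain ℤ (Alg ℤ d) (n + 1)) :
    iota d n (hochB ℤ (Alg ℤ d) n x) = hochL (Fin d) (iota d (n + 1) x) := by
  have hface : ∀ y : Chain ℤ (Alg ℤ d) (n + 1),
      iota d n (face ℤ (Alg ℤ d) n 0 y) = lin dzero (iota d (n + 1) y) := fun y => by
    have : iota d n ∘ₗ face ℤ (Alg ℤ d) n 0 = lin dzero ∘ₗ iota d (n + 1) := chain_ext fun u => by
      rw [LinearMap.comp_apply, LinearMap.comp_apply, iota_face, iota_tprod, lin_ww]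
      rfl
    exact LinearMap.congr_fun this y
  -- The sign of the last face is the sign of the cyclic operator one degree up, so the last signed
  -- face is `d₀ t`.
  have hcyc : (-1 : ℤ) ^ (n + 1) • rot ℤ (Alg ℤ d) (n + 1) x = cyc ℤ (Alg ℤ d) (n + 1) x := rfl
  rw [hochB, hochL, LinearMap.add_apply, LinearMap.add_apply, map_add, iota_barB,
    LinearMap.smul_apply, lastFace, LinearMap.comp_apply, ← map_smul, hcyc, hface, iota_cyc,
    LinearMap.comp_apply]

theorem iota_horiz (p : ℕ) {q : ℕ} (x : Chain ℤ (Alg ℤ d) q) :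
    iota d q (horiz ℤ (Alg ℤ d) p q x) = horizL (Fin d) p (iota d q x) := by
  unfold horiz horizL
  split_ifs
  · simp [iota_cyc]
  · exact iota_cycNorm x

theorem iota_vert (p : ℕ) {q : ℕ} (x : Chain ℤ (Alg ℤ d) (q + 1)) :
    iota d q ((-1 : ℤ) ^ p • vert ℤ (Alg ℤ d) p q x) = vertL (Fin d) p (iota d (q + 1) x) := by
  unfold vert vertL
  split_ifs with h
  · rw [h.neg_one_pow, one_smul, iota_hochB]
  · rw [(Nat.not_even_iff_odd.mp h).neg_one_pow, neg_one_smul, map_neg, iota_barB]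
    rfl

/-! ### The total complex in terms of words -/

/-- The family of words of a family of chains of total degree `n`. -/
def toFam (d n : ℕ) : Tot ℤ (Alg ℤ d) →ₗ[ℤ] (ℕ → Wd (Fin d)) :=
  LinearMap.pi fun p => iota d (n - p) ∘ₗ LinearMap.proj (p, n - p)

theorem toFam_apply (n : ℕ) (F : Tot ℤ (Alg ℤ d)) (p : ℕ) :
    toFam d n F p = iota d (n - p) (F (p, n - p)) := rfl

theorem toFam_of_eq {n p q : ℕ} (h : p + q = n) (F : Tot ℤ (Alg ℤ d)) :
    toFam d n F p = iota d q (F (p, q)) := by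
  obtain rfl : q = n - p := by omega
  rfl

theorem mem_totWeight {n w : ℕ} {F : Tot ℤ (Alg ℤ d)} :
    F ∈ totWeight ℤ d n w ↔ (∀ p q, p + q = n → F (p, q) ∈ weightPart ℤ d q w) ∧
      ∀ p q, p + q ≠ n → F (p, q) = 0 := by
  simp only [totWeight, Submodule.mem_iInf, Submodule.mem_comap, Prod.forall, LinearMap.proj_apply]
  refine ⟨fun h => ⟨fun p q hpq => ?_, fun p q hpq => ?_⟩, fun h p q => ?_⟩
  · simpa [hpq] using h p q
  · simpa [hpq] using h p q
  · split_ifs with hpq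
    · exact h.1 p q hpq
    · simpa using h.2 p q hpq

theorem toFam_mem {n w : ℕ} {F : Tot ℤ (Alg ℤ d)} (hF : F ∈ totWeight ℤ d n w) :
    toFam d n F ∈ famPart (Fin d) n w := by
  rw [mem_totWeight] at hF
  rw [mem_famPart]
  refine ⟨fun p hp => ?_, fun p hp => ?_⟩
  · rw [toFam_apply]
    exact iota_mem_iff.mpr (hF.1 p _ (by omega))
  · rw [toFam_apply, hF.2 p _ (by omega), map_zero]

theorem toFam_injOn {n w : ℕ} {F G : Tot ℤ (Alg ℤ d)} (hF : F ∈ totWeight ℤ d n w)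
    (hG : G ∈ totWeight ℤ d n w) (h : toFam d n F = toFam d n G) : F = G := by
  rw [mem_totWeight] at hF hG
  funext ⟨p, q⟩
  by_cases hpq : p + q = n
  · apply iota_injective
    rw [← toFam_of_eq hpq, ← toFam_of_eq hpq, h]
  · rw [hF.2 p q hpq, hG.2 p q hpq]

theorem exists_toFam_eq {n w : ℕ} {f : ℕ → Wd (Fin d)} (hf : f ∈ famPart (Fin d) n w) :
    ∃ F ∈ totWeight ℤ d n w, toFam d n F = f := by
  rw [mem_famPart] at hf
  have h : ∀ p q, ∃ x : Chain ℤ (Alg ℤ d) q, (p + q = n → x ∈ weightPart ℤ d q w ∧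
      iota d q x = f p) ∧ (p + q ≠ n → x = 0) := by
    intro p q
    by_cases hpq : p + q = n
    · have := hf.1 p (by omega)
      rw [show n - p = q by omega, ← map_weightPart] at this
      obtain ⟨x, hx, hxf⟩ := this
      exact ⟨x, fun _ => ⟨hx, hxf⟩, fun h => absurd hpq h⟩
    · exact ⟨0, fun h => absurd h hpq, fun _ => rfl⟩
  choose F hF hF0 using h
  refine ⟨fun pq => F pq.1 pq.2, mem_totWeight.mpr ⟨fun p q h => (hF p q h).1, hF0⟩, ?_⟩
  funext p
  rw [toFam_apply]
  by_cases hp : p ≤ n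
  · exact (hF p (n - p) (by omega)).2
  · change iota d _ (F p (n - p)) = _
    rw [hF0 p (n - p) (by omega), map_zero, hf.2 p (by omega)]

theorem totD_apply (F : Tot ℤ (Alg ℤ d)) (p q : ℕ) :
    totD ℤ (Alg ℤ d) F (p, q) = horiz ℤ (Alg ℤ d) p q (F (p + 1, q)) +
      (-1 : ℤ) ^ p • vert ℤ (Alg ℤ d) p q (F (p, q + 1)) := rfl

theorem iota_totD {n p q : ℕ} (h : p + q + 1 = n) (F : Tot ℤ (Alg ℤ d)) :
    iota d q (totD ℤ (Alg ℤ d) F (p, q)) = famD (Fin d) (toFam d n F) p := by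
  rw [totD_apply, map_add, iota_horiz, iota_vert, famD_apply,
    toFam_of_eq (p := p + 1) (q := q) (by omega), toFam_of_eq (p := p) (q := q + 1) (by omega)]

theorem totD_apply_of_ne {n w p q : ℕ} (h : p + q + 1 ≠ n) {F : Tot ℤ (Alg ℤ d)}
    (hF : F ∈ totWeight ℤ d n w) : totD ℤ (Alg ℤ d) F (p, q) = 0 := by
  rw [mem_totWeight] at hF
  rw [totD_apply, hF.2 (p + 1) q (by omega), hF.2 p (q + 1) (by omega), map_zero, map_zero,
    smul_zero, add_zero]

theorem totD_mem {n w : ℕ} {F : Tot ℤ (Alg ℤ d)} (hF : F ∈ totWeight ℤ d (n + 1) w) :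
    totD ℤ (Alg ℤ d) F ∈ totWeight ℤ d n w := by
  refine mem_totWeight.mpr ⟨fun p q h => ?_, fun p q h => totD_apply_of_ne (by omega) hF⟩
  rw [← iota_mem_iff, iota_totD (n := n + 1) (by omega)]
  have := (mem_famPart.mp (famD_mem (toFam_mem hF))).1 p (by omega)
  rwa [show n - p = q by omega] at this

theorem toFam_totD {n w : ℕ} {F : Tot ℤ (Alg ℤ d)} (hF : F ∈ totWeight ℤ d (n + 1) w) :
    toFam d n (totD ℤ (Alg ℤ d) F) = famD (Fin d) (toFam d (n + 1) F) := by
  funext p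
  by_cases hp : p ≤ n
  · rw [toFam_of_eq (q := n - p) (by omega), iota_totD (n := n + 1) (by omega)]
  · rw [(mem_famPart.mp (toFam_mem (totD_mem hF))).2 p (by omega),
      (mem_famPart.mp (famD_mem (toFam_mem hF))).2 p (by omega)]

theorem totD_eq_zero_iff {n w : ℕ} {F : Tot ℤ (Alg ℤ d)} (hF : F ∈ totWeight ℤ d n w) :
    totD ℤ (Alg ℤ d) F = 0 ↔ famD (Fin d) (toFam d n F) = 0 := by
  have hfam := mem_famPart.mp (toFam_mem hF)
  constructor
  · intro h
    funext p
    by_cases hp : p + 1 ≤ n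
    · rw [← iota_totD (q := n - p - 1) (by omega), h]
      exact map_zero _
    · rw [famD_apply, hfam.2 (p + 1) (by omega), map_zero, zero_add]
      by_cases hp' : p = n
      · subst hp'
        have := hfam.1 p le_rfl
        rw [Nat.sub_self] at this
        exact vertL_of_length_one this
      · rw [hfam.2 p (by omega), map_zero]; rfl
  · intro h
    funext ⟨p, q⟩
    by_cases hpq : p + q + 1 = n
    · apply iota_injective
      rw [iota_totD hpq, h]
      exact (map_zero _).symm
    · exact totD_apply_of_ne hpq hF

/-- Computing `HC` by a linear map that is onto on cycles and detects boundaries. -/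
theorem nonempty_HC_equiv {n w : ℕ} {G : Type*} [AddCommGroup G]
    (Ψ : (ℕ → Wd (Fin d)) →ₗ[ℤ] G)
    (hsurj : ∀ y, ∃ f ∈ famPart (Fin d) n w, famD (Fin d) f = 0 ∧ Ψ f = y)
    (hker : ∀ f ∈ famPart (Fin d) n w, famD (Fin d) f = 0 →
      (Ψ f = 0 ↔ ∃ g ∈ famPart (Fin d) (n + 1) w, famD (Fin d) g = f)) :
    Nonempty (HC ℤ d n w ≃+ G) := by
  set Θ : cycles ℤ d n w →ₗ[ℤ] G := Ψ ∘ₗ toFam d n ∘ₗ (cycles ℤ d n w).subtype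
  have hs : Function.Surjective Θ := fun y => by
    obtain ⟨f, hf, hD, hy⟩ := hsurj y
    obtain ⟨F, hF, rfl⟩ := exists_toFam_eq hf
    exact ⟨⟨F, hF, (totD_eq_zero_iff hF).mpr hD⟩, hy⟩
  have hk : (boundaries ℤ d n w).submoduleOf (cycles ℤ d n w) = LinearMap.ker Θ := by
    ext ⟨F, hF, hD⟩
    rw [LinearMap.mem_ker]
    change F ∈ boundaries ℤ d n w ↔ Ψ (toFam d n F) = 0
    rw [hker _ (toFam_mem hF) ((totD_eq_zero_iff hF).mp hD)]
    constructor
    · rintro ⟨G, hG, rfl⟩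
      exact ⟨toFam d (n + 1) G, toFam_mem hG, (toFam_totD hG).symm⟩
    · rintro ⟨g, hg, hgF⟩
      obtain ⟨G, hG, rfl⟩ := exists_toFam_eq hg
      exact ⟨G, hG, toFam_injOn (totD_mem hG) hF (by rw [toFam_totD hG, hgF])⟩
  exact ⟨((Submodule.quotEquivOfEq _ _ hk).trans
    (Θ.quotKerEquivOfSurjective hs)).toAddEquiv⟩

end Transport

end CyclicHom

end

noncomputable section

namespace CyclicHom

/-! ### Homology of a cyclic group with coefficients in a signed permutation module -/

section SignedPerm

variable {X I : Type*} (ρ : X → X) (ε : ℤ) (w : ℕ) (rep : I → X) (m : I → ℕ)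

/-- The signed permutation operator. -/
def sgnT : (X →₀ ℤ) →ₗ[ℤ] (X →₀ ℤ) := ε • Finsupp.lmapDomain ℤ ℤ ρ

/-- Its norm. -/
def sgnN : (X →₀ ℤ) →ₗ[ℤ] (X →₀ ℤ) := ∑ i ∈ Finset.range w, sgnT ρ ε ^ i

/-- The signed sum of the coefficients of an orbit. -/
def orbitSum (c : I) : (X →₀ ℤ) →ₗ[ℤ] ℤ :=
  ∑ i ∈ Finset.range (m c), ε ^ i • Finsupp.lapply (ρ^[i] (rep c))

/-- The partial norm of a basis element over its orbit. -/
def orbitNorm (c : I) : X →₀ ℤ :=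
  ∑ i ∈ Finset.range (m c), (sgnT ρ ε ^ i) (Finsupp.single (rep c) 1)

theorem sgnT_single (x : X) (a : ℤ) :
    sgnT ρ ε (Finsupp.single x a) = Finsupp.single (ρ x) (ε * a) := by
  simp [sgnT]

theorem sgnT_pow_single (i : ℕ) (x : X) (a : ℤ) :
    (sgnT ρ ε ^ i) (Finsupp.single x a) = Finsupp.single (ρ^[i] x) (ε ^ i * a) := by
  induction i with
  | zero => simp
  | succ i ih =>
    rw [pow_succ', Module.End.mul_apply, ih, sgnT_single, Function.iterate_succ_apply', pow_succ',
      mul_assoc]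

/-- `rep` is a system of representatives of the orbits of `ρ`, of lengths `m`, and the signs are
compatible with an action of the cyclic group of order `w`. -/
structure OrbitSystem : Prop where
  inj : Function.Injective ρ
  sign : ε * ε = 1
  pos : ∀ c, 0 < m c
  dvd : ∀ c, m c ∣ w
  per : ∀ c, ρ^[m c] (rep c) = rep c
  bij : Function.Bijective fun p : (c : I) × Fin (m c) => ρ^[(p.2 : ℕ)] (rep p.1)
  sign_w : ε ^ w = 1
  wpos : 0 < w

namespace OrbitSystem

variable {ρ ε w rep m}

theorem sign_pow_mul (H : OrbitSystem ρ ε w rep m) (i : ℕ) : ε ^ i * ε ^ i = 1 := by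
  rw [← mul_pow, H.sign, one_pow]

theorem sign_cases (H : OrbitSystem ρ ε w rep m) (c : I) : ε ^ m c = 1 ∨ ε ^ m c = -1 := by
  have := H.sign_pow_mul (m c)
  exact mul_self_eq_one_iff.mp this

theorem ext (H : OrbitSystem ρ ε w rep m) {N : Type*} [AddCommGroup N] {f g : (X →₀ ℤ) →ₗ[ℤ] N}
    (h : ∀ c, ∀ i < m c, f ((sgnT ρ ε ^ i) (Finsupp.single (rep c) 1)) =
      g ((sgnT ρ ε ^ i) (Finsupp.single (rep c) 1))) : f = g := by
  refine Finsupp.lhom_ext' fun x => LinearMap.ext_ring ?_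
  obtain ⟨⟨c, i⟩, rfl⟩ := H.bij.2 x
  have h1 := congr_arg (fun y => ε ^ (i : ℕ) • y) (h c i i.2)
  simp only [← map_smul, sgnT_pow_single, Finsupp.smul_single, smul_eq_mul, mul_one,
    H.sign_pow_mul] at h1
  exact h1

theorem coeff_eq (H : OrbitSystem ρ ε w rep m) (c c' : I) {i i' : ℕ} (hi : i < m c)
    (hi' : i' < m c') :
    (ρ^[i] (rep c) = ρ^[i'] (rep c')) ↔ c = c' ∧ i = i' := by
  constructor
  · intro h
    have := @H.bij.1 ⟨c, ⟨i, hi⟩⟩ ⟨c', ⟨i', hi'⟩⟩ h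
    rw [Sigma.mk.injEq] at this
    obtain ⟨rfl, h2⟩ := this
    have := eq_of_heq h2
    exact ⟨rfl, by simpa using this⟩
  · rintro ⟨rfl, rfl⟩; rfl

/-- The signs in `orbitSum` undo those of the powers of the operator, so the sum does not change
along an orbit before it closes up. -/
theorem orbitSum_pow (H : OrbitSystem ρ ε w rep m) [DecidableEq I] (c c' : I) {i : ℕ}
    (hi : i < m c') :
    orbitSum ρ ε rep m c ((sgnT ρ ε ^ i) (Finsupp.single (rep c') 1)) =
      if c = c' then 1 else 0 := by
  classical
  rw [orbitSum, sgnT_pow_single, LinearMap.sum_apply]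
  simp only [LinearMap.smul_apply, Finsupp.lapply_apply, Finsupp.single_apply, smul_eq_mul, mul_one]
  split_ifs with h
  · subst h
    rw [Finset.sum_eq_single i]
    · simp [H.sign_pow_mul]
    · intro j hj hji
      rw [if_neg, mul_zero]
      rw [H.coeff_eq c c hi (by simpa using hj)]
      exact fun h => hji h.2.symm
    · intro h; simp [hi] at h
  · refine Finset.sum_eq_zero fun j hj => ?_
    rw [if_neg, mul_zero]
    rw [H.coeff_eq c' c hi (by simpa using hj)]
    exact fun h' => h h'.1.symm

theorem orbitSum_single (H : OrbitSystem ρ ε w rep m) [DecidableEq I] (c c' : I) :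
    orbitSum ρ ε rep m c (Finsupp.single (rep c') 1) = if c = c' then 1 else 0 :=
  H.orbitSum_pow c c' (H.pos c')

theorem pow_period (H : OrbitSystem ρ ε w rep m) (c : I) :
    (sgnT ρ ε ^ m c) (Finsupp.single (rep c) 1) = ε ^ m c • Finsupp.single (rep c) 1 := by
  rw [sgnT_pow_single, H.per]; simp

theorem pow_w (H : OrbitSystem ρ ε w rep m) (x : X →₀ ℤ) : (sgnT ρ ε ^ w) x = x := by
  have : sgnT ρ ε ^ w = LinearMap.id := H.ext fun c i _ => by
    obtain ⟨k, hk⟩ := H.dvd c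
    have hper : ∀ k, (sgnT ρ ε ^ (m c * k)) (Finsupp.single (rep c) 1) =
        ε ^ (m c * k) • Finsupp.single (rep c) 1 := by
      intro k
      induction k with
      | zero => simp
      | succ k ih =>
        rw [Nat.mul_succ, pow_add, Module.End.mul_apply, H.pow_period, map_smul, ih, smul_smul,
          pow_add, mul_comm]
    rw [← Module.End.mul_apply, ← pow_add, add_comm, pow_add, Module.End.mul_apply, hk, hper,
      ← hk, H.sign_w, one_smul]
    rfl
  rw [this]; rfl

theorem N_T (H : OrbitSystem ρ ε w rep m) (x : X →₀ ℤ) :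
    sgnN ρ ε w (sgnT ρ ε x) = sgnN ρ ε w x := by
  simp only [sgnN, LinearMap.sum_apply, ← Module.End.mul_apply, ← pow_succ]
  have h1 := Finset.sum_range_succ (fun i => (sgnT ρ ε ^ i) x) w
  rw [Finset.sum_range_succ', H.pow_w] at h1
  simpa using h1

theorem orbitNorm_apply (H : OrbitSystem ρ ε w rep m) [DecidableEq I] (c c' : I) {i : ℕ}
    (hi : i < m c') :
    orbitNorm ρ ε rep m c (ρ^[i] (rep c')) = if c = c' then ε ^ i else 0 := by
  classical
  rw [orbitNorm, Finsupp.finsetSum_apply]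
  simp only [sgnT_pow_single, Finsupp.single_apply, mul_one]
  split_ifs with h
  · subst h
    rw [Finset.sum_eq_single i]
    · simp
    · intro j hj hji
      rw [if_neg]
      rw [H.coeff_eq c c (by simpa using hj) hi]
      exact fun h => hji h.2
    · intro h; simp [hi] at h
  · refine Finset.sum_eq_zero fun j hj => ?_
    rw [if_neg]
    rw [H.coeff_eq c c' (by simpa using hj) hi]
    exact fun h' => h h'.1

theorem orbitNorm_rep (H : OrbitSystem ρ ε w rep m) [DecidableEq I] (c c' : I) :
    orbitNorm ρ ε rep m c (rep c') = if c = c' then 1 else 0 := by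
  simpa using H.orbitNorm_apply c c' (H.pos c')

theorem T_orbitNorm (H : OrbitSystem ρ ε w rep m) {c : I} (hc : ε ^ m c = 1) :
    sgnT ρ ε (orbitNorm ρ ε rep m c) = orbitNorm ρ ε rep m c := by
  rw [orbitNorm, map_sum]
  simp only [← Module.End.mul_apply, ← pow_succ']
  have h1 := Finset.sum_range_succ (fun i => (sgnT ρ ε ^ i) (Finsupp.single (rep c) (1 : ℤ))) (m c)
  rw [Finset.sum_range_succ', H.pow_period, hc] at h1
  simpa using h1

/-- The norm runs `w / m c` times around the orbit, and each turn multiplies by the sign `ε ^ m c`.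
-/
theorem N_single (H : OrbitSystem ρ ε w rep m) (c : I) : sgnN ρ ε w (Finsupp.single (rep c) 1) =
    (∑ q ∈ Finset.range (w / m c), (ε ^ m c) ^ q) • orbitNorm ρ ε rep m c := by
  obtain ⟨k, hk⟩ := H.dvd c
  have hdiv : w / m c = k := by rw [hk, Nat.mul_div_cancel_left _ (H.pos c)]
  rw [hdiv, sgnN, LinearMap.sum_apply, hk]
  clear hdiv hk
  induction k with
  | zero => simp
  | succ k ih =>
    rw [Nat.mul_succ, Finset.sum_range_add, ih, Finset.sum_range_succ, add_smul]
    congr 1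
    rw [orbitNorm, Finset.smul_sum]
    refine Finset.sum_congr rfl fun i _ => ?_
    rw [add_comm, pow_add, Module.End.mul_apply, ← map_smul]
    congr 1
    have hk : ρ^[m c * k] (rep c) = rep c := Function.IsPeriodicPt.mul_const (H.per c) k
    rw [sgnT_pow_single, hk]
    simp [pow_mul]

theorem N_single_of_one (H : OrbitSystem ρ ε w rep m) {c : I} (hc : ε ^ m c = 1) :
    sgnN ρ ε w (Finsupp.single (rep c) 1) =
    ((w / m c : ℕ) : ℤ) • orbitNorm ρ ε rep m c := by
  rw [H.N_single, hc]; simp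

/-- The factor S in `N_single` is the alternating geometric sum, and 2 S = 1 - ε^w = 0. -/
theorem N_single_of_neg_one (H : OrbitSystem ρ ε w rep m) {c : I} (hc : ε ^ m c = -1) :
    sgnN ρ ε w (Finsupp.single (rep c) 1) = 0 := by
  have h := geom_sum_mul_neg (ε ^ m c) (w / m c)
  rw [← pow_mul, Nat.mul_div_cancel' (H.dvd c), H.sign_w, sub_self, hc] at h
  rw [H.N_single, hc]
  have : ∑ i ∈ Finset.range (w / m c), (-1 : ℤ) ^ i = 0 := by
    rcases mul_eq_zero.mp h with h | h
    · exact h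
    · norm_num at h
  rw [this, zero_smul]

variable [Fintype I]

/-- Every element is congruent to a combination of orbit representatives. -/
theorem sub_mem_range (H : OrbitSystem ρ ε w rep m) (x : X →₀ ℤ) :
    x - ∑ c, orbitSum ρ ε rep m c x • Finsupp.single (rep c) (1 : ℤ) ∈
      LinearMap.range (LinearMap.id - sgnT ρ ε) := by
  classical
  set B := LinearMap.range (LinearMap.id - sgnT ρ ε)
  have hB : ∀ (i : ℕ) (y : X →₀ ℤ), B.mkQ ((sgnT ρ ε ^ i) y) = B.mkQ y := by
    intro i
    induction i with
    | zero => intro y; rfl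
    | succ i ih =>
      intro y
      rw [pow_succ, Module.End.mul_apply, ih, eq_comm, ← sub_eq_zero, ← map_sub,
        Submodule.mkQ_apply, Submodule.Quotient.mk_eq_zero]
      exact ⟨y, rfl⟩
  have : B.mkQ = ∑ c, (orbitSum ρ ε rep m c).smulRight (B.mkQ (Finsupp.single (rep c) 1)) :=
    H.ext fun c i hi => by
      rw [hB, LinearMap.sum_apply]
      simp [H.orbitSum_pow _ _ hi]
  rw [← Submodule.Quotient.mk_eq_zero, ← Submodule.mkQ_apply, map_sub, sub_eq_zero, this]
  simp only [LinearMap.sum_apply, LinearMap.smulRight_apply, map_sum, map_smul]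
  simp [H.orbitSum_single]

theorem N_eq (H : OrbitSystem ρ ε w rep m) (x : X →₀ ℤ) : sgnN ρ ε w x =
    ∑ c, orbitSum ρ ε rep m c x • sgnN ρ ε w (Finsupp.single (rep c) 1) := by
  obtain ⟨y, hy⟩ := H.sub_mem_range x
  have := congr_arg (sgnN ρ ε w) hy
  rw [LinearMap.sub_apply, LinearMap.id_apply, map_sub, H.N_T, sub_self, map_sub] at this
  rw [sub_eq_zero.mp this.symm, map_sum]
  simp only [map_smul]

theorem N_apply_rep (H : OrbitSystem ρ ε w rep m) {c : I} (hc : ε ^ m c = 1) (x : X →₀ ℤ) :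
    sgnN ρ ε w x (rep c) = orbitSum ρ ε rep m c x * (w / m c : ℕ) := by
  classical
  rw [H.N_eq, Finsupp.finsetSum_apply, Finset.sum_eq_single c]
  · rw [H.N_single_of_one hc, Finsupp.smul_apply, Finsupp.smul_apply, H.orbitNorm_rep, if_pos rfl]
    simp
  · intro c' _ h
    rw [H.N_single, Finsupp.smul_apply, Finsupp.smul_apply, H.orbitNorm_rep, if_neg h]
    simp
  · simp

/-- One turn around an orbit identifies a representative with `ε ^ m c` times itself, so the
coinvariants of the orbit are ℤ/(1 - ε^m), that is ℤ or ℤ/2, and the orbit sum is the coordinate. -/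
theorem mem_range_sub_iff (H : OrbitSystem ρ ε w rep m) (x : X →₀ ℤ) :
    (∃ y, y - sgnT ρ ε y = x) ↔ ∀ c, (ε ^ m c = 1 → orbitSum ρ ε rep m c x = 0) ∧
      (ε ^ m c = -1 → (2 : ℤ) ∣ orbitSum ρ ε rep m c x) := by
  classical
  constructor
  · rintro ⟨y, rfl⟩ c
    have key : ∀ y, orbitSum ρ ε rep m c (y - sgnT ρ ε y) ∈ Ideal.span {1 - ε ^ m c} := by
      intro y
      have : (Ideal.span {1 - ε ^ m c}).mkQ ∘ₗ orbitSum ρ ε rep m c ∘ₗ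
          (LinearMap.id - sgnT ρ ε) = 0 := H.ext fun c' i hi => by
        simp only [LinearMap.comp_apply, LinearMap.sub_apply, LinearMap.id_apply,
          LinearMap.zero_apply, Submodule.mkQ_apply, Submodule.Quotient.mk_eq_zero]
        rw [map_sub, H.orbitSum_pow c c' hi, ← Module.End.mul_apply, ← pow_succ']
        rcases Nat.lt_or_ge (i + 1) (m c') with h | h
        · rw [H.orbitSum_pow c c' h, sub_self]; exact Submodule.zero_mem _
        · rw [show i + 1 = m c' by omega, H.pow_period, map_smul, H.orbitSum_single]
          split_ifs with hc
          · subst hc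
            simp
          · simp
      have h := LinearMap.congr_fun this y
      rwa [LinearMap.comp_apply, LinearMap.zero_apply, Submodule.mkQ_apply,
        Submodule.Quotient.mk_eq_zero] at h
    have := Ideal.mem_span_singleton.mp (key y)
    refine ⟨fun h => ?_, fun h => ?_⟩
    · rw [h, sub_self] at this; exact zero_dvd_iff.mp this
    · rw [h] at this; exact this
  · intro h
    suffices x ∈ LinearMap.range (LinearMap.id - sgnT ρ ε) by
      obtain ⟨y, hy⟩ := this
      exact ⟨y, hy⟩
    have h1 := H.sub_mem_range x
    have h2 : ∑ c, orbitSum ρ ε rep m c x • Finsupp.single (rep c) (1 : ℤ) ∈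
        LinearMap.range (LinearMap.id - sgnT ρ ε) := by
      refine Submodule.sum_mem _ fun c _ => ?_
      rcases H.sign_cases c with hc | hc
      · rw [(h c).1 hc, zero_smul]; exact Submodule.zero_mem _
      · obtain ⟨k, hk⟩ := (h c).2 hc
        rw [hk, mul_comm, mul_smul]
        refine Submodule.smul_mem _ _ ?_
        -- With sign -1 a full turn gives 2e = e - T^m e, and this telescopes into the image of 1 -
        -- T.
        have h3 : (2 : ℤ) • Finsupp.single (rep c) (1 : ℤ) =
            Finsupp.single (rep c) 1 - (sgnT ρ ε ^ m c) (Finsupp.single (rep c) 1) := by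
          rw [H.pow_period, hc, neg_one_smul, sub_neg_eq_add, two_smul]
        rw [h3]
        have : ∀ n : ℕ, Finsupp.single (rep c) (1 : ℤ) -
            (sgnT ρ ε ^ n) (Finsupp.single (rep c) 1) ∈
            LinearMap.range (LinearMap.id - sgnT ρ ε) := by
          intro n
          induction n with
          | zero => simp
          | succ n ih =>
            have := Submodule.add_mem _ ih
              (⟨(sgnT ρ ε ^ n) (Finsupp.single (rep c) 1), rfl⟩ :
                _ ∈ LinearMap.range (LinearMap.id - sgnT ρ ε))
            simpa [pow_succ'] using this
        exact this _
    simpa using Submodule.add_mem _ h1 h2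

theorem exists_orbitSum_eq (H : OrbitSystem ρ ε w rep m) (y : I → ℤ) :
    ∃ x : X →₀ ℤ, (∀ c, orbitSum ρ ε rep m c x = y c) ∧
    ((∀ c, ε ^ m c = 1 → y c = 0) → sgnN ρ ε w x = 0) := by
  classical
  refine ⟨∑ c, y c • Finsupp.single (rep c) 1, fun c => ?_, fun h => ?_⟩
  · rw [map_sum]
    simp [-Finsupp.smul_single, H.orbitSum_single]
  · rw [map_sum]
    refine Finset.sum_eq_zero fun c _ => ?_
    rcases H.sign_cases c with hc | hc
    · rw [h c hc, zero_smul, map_zero]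
    · rw [map_smul, H.N_single_of_neg_one hc, smul_zero]

/-- By `N_apply_rep` the norm has coefficient `w / m c` times the orbit sum at the representative,
and ℤ has no torsion. -/
theorem orbitSum_eq_zero_of_N (H : OrbitSystem ρ ε w rep m) {x : X →₀ ℤ} (hx : sgnN ρ ε w x = 0)
    {c : I} (hc : ε ^ m c = 1) :
    orbitSum ρ ε rep m c x = 0 := by
  have h := H.N_apply_rep hc x
  rw [hx] at h
  have hw : ((w / m c : ℕ) : ℤ) ≠ 0 := by
    exact_mod_cast (Nat.div_pos (Nat.le_of_dvd H.wpos (H.dvd c)) (H.pos c)).ne'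
  exact (mul_eq_zero.mp h.symm).resolve_right hw

/-- Invariance carries the coefficient at the representative around the orbit with signs; on closing
up with sign -1 it forces a = -a. -/
theorem eq_sum_of_invariant (H : OrbitSystem ρ ε w rep m) {x : X →₀ ℤ} (hx : sgnT ρ ε x = x) :
    (∀ c, ε ^ m c = -1 → x (rep c) = 0) ∧ x = ∑ c, x (rep c) • orbitNorm ρ ε rep m c := by
  classical
  have h1 : ∀ y, x (ρ y) = ε * x y := fun y => by
    conv_lhs => rw [← hx]
    simp [sgnT, Finsupp.mapDomain_apply H.inj]
  have h2 : ∀ (i : ℕ) y, x (ρ^[i] y) = ε ^ i * x y := by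
    intro i y
    induction i with
    | zero => simp
    | succ i ih => rw [Function.iterate_succ_apply', h1, ih, pow_succ', mul_assoc]
  refine ⟨fun c hc => ?_, ?_⟩
  · have := h2 (m c) (rep c)
    rw [H.per, hc] at this
    omega
  · ext y
    obtain ⟨⟨c, i⟩, rfl⟩ := H.bij.2 y
    simp only [h2, Finsupp.finsetSum_apply, Finsupp.smul_apply, H.orbitNorm_apply _ _ i.2]
    simp [mul_comm]

/-- Invariants are combinations of orbit norms, while the norm of a representative is `w / m c`
times its orbit norm, or 0 when the sign is -1. -/
theorem mem_range_N_iff (H : OrbitSystem ρ ε w rep m) {x : X →₀ ℤ} (hx : sgnT ρ ε x = x) :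
    (∃ y, sgnN ρ ε w y = x) ↔ ∀ c, ε ^ m c = 1 → ((w / m c : ℕ) : ℤ) ∣ x (rep c) := by
  classical
  constructor
  · rintro ⟨y, rfl⟩ c hc
    rw [H.N_apply_rep hc]
    exact dvd_mul_left _ _
  · intro h
    obtain ⟨h1, h2⟩ := H.eq_sum_of_invariant hx
    choose! k hk using h
    refine ⟨∑ c, (if ε ^ m c = 1 then k c else 0) • Finsupp.single (rep c) 1, ?_⟩
    rw [h2, map_sum]
    refine Finset.sum_congr rfl fun c _ => ?_
    rw [map_smul]
    rcases H.sign_cases c with hc | hc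
    · rw [if_pos hc, H.N_single_of_one hc, hk c hc, smul_smul, mul_comm]
    · rw [if_neg (by rw [hc]; norm_num), h1 c hc, zero_smul, zero_smul]

theorem exists_invariant (H : OrbitSystem ρ ε w rep m) (y : I → ℤ)
    (hy : ∀ c, ε ^ m c = -1 → y c = 0) :
    ∃ x : X →₀ ℤ, sgnT ρ ε x = x ∧ ∀ c, x (rep c) = y c := by
  classical
  refine ⟨∑ c, y c • orbitNorm ρ ε rep m c, ?_, fun c => ?_⟩
  · rw [map_sum]
    refine Finset.sum_congr rfl fun c _ => ?_
    rcases H.sign_cases c with hc | hc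
    · rw [map_smul, H.T_orbitNorm hc]
    · rw [hy c hc, zero_smul, map_zero]
  · simp [Finsupp.finsetSum_apply, H.orbitNorm_rep]

end OrbitSystem

end SignedPerm

end CyclicHom

end

noncomputable section

namespace CyclicHom

/-! ### Orbits of words under rotation -/

section Necklaces

variable {d m w : ℕ}

/-- The periodic extension of a word to `ℕ`. -/
def wext (hm : 0 < m) (u : Fin m → Fin d) (n : ℕ) : Fin d := u ⟨n % m, Nat.mod_lt n hm⟩

theorem wext_wordRot (hm : 0 < m) (u : Fin m → Fin d) (n : ℕ) :
    wext hm (wordRot m d u) (n + 1) = wext hm u n := by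
  obtain ⟨k, rfl⟩ : ∃ k, m = k + 1 := ⟨m - 1, by omega⟩
  unfold wext wordRot
  congr 1
  rw [Equiv.symm_apply_eq, finRotate_apply]
  apply Fin.ext
  rw [Fin.val_add, Fin.val_one']
  exact Nat.add_mod n 1 (k + 1)

theorem wext_iterate (hm : 0 < m) (u : Fin m → Fin d) (k n : ℕ) :
    wext hm ((wordRot m d)^[k] u) (n + k) = wext hm u n := by
  induction k with
  | zero => rfl
  | succ k ih => rw [Function.iterate_succ_apply', ← add_assoc, wext_wordRot, ih]

theorem wext_injective (hm : 0 < m) {u v : Fin m → Fin d} (k : ℕ)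
    (h : ∀ n, wext hm u (n + k) = wext hm v (n + k)) : u = v := by
  funext i
  have hk : k ≤ m * k := Nat.le_mul_of_pos_left k hm
  -- The position is chosen so that adding `k` gives `i` plus a multiple of the period.
  have := h (i + m * k - k)
  rw [show i + m * k - k + k = i + m * k by omega] at this
  unfold wext at this
  have hi : (i + m * k) % m = i := by rw [Nat.add_mul_mod_self_left, Nat.mod_eq_of_lt i.2]
  simpa only [hi] using this

theorem wext_add_self (hm : 0 < m) (u : Fin m → Fin d) (n : ℕ) :
    wext hm u (n + m) = wext hm u n := by
  unfold wext
  simp only [Nat.add_mod_right]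

theorem iterate_wordRot_self (hm : 0 < m) (u : Fin m → Fin d) : (wordRot m d)^[m] u = u :=
  wext_injective hm m fun n => by rw [wext_iterate, wext_add_self]

theorem wordRot_injective : Function.Injective (wordRot m d) := fun u v h => by
  funext i
  have := congr_fun h (finRotate m i)
  unfold wordRot at this
  rwa [Equiv.symm_apply_apply] at this

theorem cycleLength_dvd (hm : 0 < m) (u : Fin m → Fin d) : cycleLength m d u ∣ m :=
  Function.IsPeriodicPt.minimalPeriod_dvd (iterate_wordRot_self hm u)

theorem mem_periodicPts (hm : 0 < m) (u : Fin m → Fin d) :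
    u ∈ Function.periodicPts (wordRot m d) :=
  Function.mk_mem_periodicPts hm (iterate_wordRot_self hm u)

/-! ### Words as repetitions of primitive words -/

/-- The word of length `w` obtained by repeating a word of length `m`. -/
def wrep (w : ℕ) (hm : 0 < m) (u : Fin m → Fin d) : Fin w → Fin d := fun i => wext hm u i

theorem wext_wrep (hm : 0 < m) (hw : 0 < w) (h : m ∣ w) (u : Fin m → Fin d) (n : ℕ) :
    wext hw (wrep w hm u) n = wext hm u n := by
  unfold wrep wext
  simp only [Nat.mod_mod_of_dvd n h]

theorem wrep_injective (hm : 0 < m) (hw : 0 < w) (h : m ∣ w) :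
    Function.Injective (wrep (d := d) w hm) := fun u v huv =>
  wext_injective hm 0 fun n => by rw [← wext_wrep hm hw h, huv, wext_wrep hm hw h]

theorem wrep_iterate (hm : 0 < m) (hw : 0 < w) (h : m ∣ w) (u : Fin m → Fin d) (k : ℕ) :
    (wordRot w d)^[k] (wrep w hm u) = wrep w hm ((wordRot m d)^[k] u) :=
  wext_injective hw k fun n => by
    rw [wext_iterate, wext_wrep hm hw h, wext_wrep hm hw h, wext_iterate]

theorem cycleLength_wrep (hm : 0 < m) (hw : 0 < w) (h : m ∣ w) (u : Fin m → Fin d) :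
    cycleLength w d (wrep w hm u) = cycleLength m d u := by
  refine Function.minimalPeriod_eq_minimalPeriod_iff.mpr fun n => ?_
  rw [Function.IsPeriodicPt, Function.IsFixedPt, wrep_iterate hm hw h,
    (wrep_injective hm hw h).eq_iff]
  rfl

/-- A word fixed by `m` rotations has an `m`-periodic extension, so its first `m` letters determine
it. -/
theorem exists_wrep_eq (hw : 0 < w) (x : Fin w → Fin d) (hm : 0 < m) (h : m ∣ w)
    (hx : cycleLength w d x = m) : ∃ u : Fin m → Fin d, wrep w hm u = x := by
  have h1 : ∀ n, wext hw x (n + m) = wext hw x n := fun n => by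
    have := wext_iterate hw x m n
    rwa [← hx, cycleLength, Function.iterate_minimalPeriod, ← cycleLength, hx] at this
  have h2 : ∀ n k, wext hw x (n + m * k) = wext hw x n := by
    intro n k
    induction k with
    | zero => rfl
    | succ k ih => rw [Nat.mul_succ, ← add_assoc, h1, ih]
  refine ⟨fun i => wext hw x i, wext_injective hw 0 fun n => ?_⟩
  rw [wext_wrep hm hw h]
  conv_rhs => rw [add_zero, ← Nat.mod_add_div n m, h2]
  rfl

/-- A word representing a cycle family. -/
def famRep (F : omega m d) : Fin m → Fin d := F.2.choose

theorem cycleLength_famRep (F : omega m d) : cycleLength m d (famRep F) = m :=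
  F.2.choose_spec.1

theorem cycleFamily_famRep (F : omega m d) : cycleFamily m d (famRep F) = F.1 :=
  F.2.choose_spec.2.symm

theorem cycleFamily_iterate (hm : 0 < m) (u : Fin m → Fin d) (k : ℕ) :
    cycleFamily m d ((wordRot m d)^[k] u) = cycleFamily m d u := by
  ext v
  constructor
  · rintro ⟨n, rfl⟩
    exact ⟨n + k, by rw [Function.iterate_add_apply]⟩
  · rintro ⟨n, rfl⟩
    -- Rotating by `m * k - k` completes the `k` rotations already made to a multiple of the period.
    refine ⟨n + (m * k - k), ?_⟩
    have hk : k ≤ m * k := Nat.le_mul_of_pos_left k hm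
    have hper : (wordRot m d)^[m * k] u = u :=
      Function.IsPeriodicPt.mul_const (iterate_wordRot_self hm u) k
    rw [← Function.iterate_add_apply, add_assoc, Nat.sub_add_cancel hk, Function.iterate_add_apply,
      hper]

/-- The orbits of words of length `w`: pairs of a divisor `m` and a cycle family in `ω_{m,d}`. -/
abbrev OrbitIdx (w d : ℕ) : Type := (m : {m : ℕ // m ∣ w}) × omega m.1 d

/-- The length of an orbit. -/
def orbLen (c : OrbitIdx w d) : ℕ := c.1.1

theorem orbLen_pos (hw : 0 < w) (c : OrbitIdx w d) : 0 < orbLen c := Nat.pos_of_dvd_of_pos c.1.2 hw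

/-- A representative of an orbit. -/
def orbRep (hw : 0 < w) (c : OrbitIdx w d) : Fin w → Fin d :=
  wrep (m := c.1.1) w (Nat.pos_of_dvd_of_pos c.1.2 hw) (famRep c.2)

theorem cycleLength_iterate_orbRep (hw : 0 < w) (c : OrbitIdx w d) (i : ℕ) :
    cycleLength w d ((wordRot w d)^[i] (orbRep hw c)) = orbLen c := by
  rw [cycleLength, Function.minimalPeriod_apply_iterate (mem_periodicPts hw _), ← cycleLength,
    orbRep, cycleLength_wrep _ hw c.1.2, cycleLength_famRep]
  rfl

/-- The least period recovers `m`, the injectivity of repetition reduces to primitive words of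
length `m`, and there the rotations below the least period are distinct. -/
theorem orbRep_injective (hw : 0 < w) : Function.Injective
    fun p : (c : OrbitIdx w d) × Fin (orbLen c) => (wordRot w d)^[(p.2 : ℕ)] (orbRep hw p.1) := by
  rintro ⟨c, i⟩ ⟨c', i'⟩ h
  change (wordRot w d)^[(i : ℕ)] (orbRep hw c) = (wordRot w d)^[(i' : ℕ)] (orbRep hw c') at h
  have hlen : orbLen c = orbLen c' := by
    rw [← cycleLength_iterate_orbRep hw c i, h, cycleLength_iterate_orbRep]
  obtain ⟨⟨m, hm⟩, F⟩ := c
  obtain ⟨⟨m', hm'⟩, F'⟩ := c'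
  obtain rfl : m = m' := hlen
  have hm0 : 0 < m := Nat.pos_of_dvd_of_pos hm hw
  replace h : (wordRot w d)^[(i : ℕ)] (wrep w hm0 (famRep F)) =
    (wordRot w d)^[(i' : ℕ)] (wrep w hm0 (famRep F')) := h
  rw [wrep_iterate hm0 hw hm, wrep_iterate hm0 hw hm] at h
  replace h := wrep_injective hm0 hw hm h
  have hF : F = F' := by
    apply Subtype.ext
    rw [← cycleFamily_famRep F, ← cycleFamily_famRep F', ← cycleFamily_iterate hm0 _ i, h,
      cycleFamily_iterate hm0]
  subst hF
  have hi : (i : ℕ) = i' := by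
    refine Function.iterate_injOn_Iio_minimalPeriod (f := wordRot m d) (x := famRep F) ?_ ?_ h
    · exact lt_of_lt_of_eq i.2 (cycleLength_famRep F).symm
    · exact lt_of_lt_of_eq i'.2 (cycleLength_famRep F).symm
  rw [Fin.ext hi]

theorem orbRep_surjective (hw : 0 < w) : Function.Surjective
    fun p : (c : OrbitIdx w d) × Fin (orbLen c) => (wordRot w d)^[(p.2 : ℕ)] (orbRep hw p.1) := by
  intro x
  have hm : cycleLength w d x ∣ w := cycleLength_dvd hw x
  have hm0 : 0 < cycleLength w d x := Nat.pos_of_dvd_of_pos hm hw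
  obtain ⟨u, hu⟩ := exists_wrep_eq hw x hm0 hm rfl
  have hul : cycleLength _ d u = cycleLength w d x := by rw [← cycleLength_wrep hm0 hw hm, hu]
  let F : omega (cycleLength w d x) d := ⟨cycleFamily _ d u, u, hul, rfl⟩
  have hmem : u ∈ cycleFamily _ d (famRep F) := by
    rw [cycleFamily_famRep]; exact ⟨0, rfl⟩
  obtain ⟨n, hn⟩ := hmem
  refine ⟨⟨⟨⟨_, hm⟩, F⟩, ⟨n % cycleLength w d x, Nat.mod_lt _ hm0⟩⟩, ?_⟩
  change (wordRot w d)^[n % cycleLength w d x] (wrep w hm0 (famRep F)) = x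
  rw [wrep_iterate hm0 hw hm]
  have := Function.iterate_mod_minimalPeriod_eq (f := wordRot _ d) (x := famRep F) (n := n)
  rw [← cycleLength, cycleLength_famRep] at this
  rw [this, ← hn, hu]

theorem orbitSystem (hw : 0 < w) (d : ℕ) : OrbitSystem (wordRot w d) ((-1 : ℤ) ^ (w + 1)) w
    (orbRep (d := d) hw) orbLen where
  inj := wordRot_injective
  sign := by rw [← mul_pow]; simp
  pos := orbLen_pos hw
  dvd c := c.1.2
  per c := by
    conv_lhs => rw [← cycleLength_iterate_orbRep hw c 0]
    exact Function.iterate_minimalPeriod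
  bij := ⟨orbRep_injective hw, orbRep_surjective hw⟩
  sign_w := by
    rw [← pow_mul, mul_comm]
    exact (Nat.even_mul_succ_self w).neg_one_pow
  wpos := hw

theorem finite_divisors (hw : 0 < w) : Finite {m : ℕ // m ∣ w} :=
  Set.Finite.to_subtype ((Set.finite_Iic w).subset fun _ h => Nat.le_of_dvd hw h)

theorem finite_orbitIdx (hw : 0 < w) : Finite (OrbitIdx w d) :=
  have := finite_divisors hw
  inferInstance

theorem sign_of_modEq {m : ℕ} (hm : m ≡ w [MOD 2]) : ((-1 : ℤ) ^ (w + 1)) ^ m = 1 := by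
  rw [← pow_mul]
  refine Even.neg_one_pow ?_
  rw [Nat.ModEq] at hm
  rw [Nat.even_mul, Nat.even_iff, Nat.even_iff]
  omega

/-- A divisor of an odd number is odd, so the failing congruence means that `w` is even and `m` odd.
-/
theorem sign_of_not_modEq {m : ℕ} (h : m ∣ w) (hm : ¬ m ≡ w [MOD 2]) :
    ((-1 : ℤ) ^ (w + 1)) ^ m = -1 := by
  rw [← pow_mul]
  refine Odd.neg_one_pow ?_
  rw [Nat.odd_mul, Nat.odd_iff, Nat.odd_iff]
  rw [Nat.ModEq] at hm
  have : w % 2 = 1 → m % 2 = 1 := fun hw => by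
    rw [← Nat.odd_iff] at *
    exact Odd.of_dvd_nat hw h
  omega

/-! ### The number of primitive necklaces -/

/-- Counting words by orbits. -/
theorem sum_divisors_card (hw : 0 < w) (d : ℕ) :
    ∑ m ∈ w.divisors, m * Nat.card (omega m d) = d ^ w := by
  have := finite_divisors hw
  have := Fintype.ofFinite {m : ℕ // m ∣ w}
  have := fun m : {m : ℕ // m ∣ w} => Fintype.ofFinite (omega m.1 d)
  have h := Nat.card_congr (Equiv.ofBijective _ (orbitSystem hw d).bij)
  rw [Nat.card_sigma, Fintype.sum_sigma, Nat.card_eq_fintype_card] at h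
  rw [Fintype.card_fun, Fintype.card_fin, Fintype.card_fin] at h
  rw [← h, Finset.sum_subtype (p := fun m => m ∣ w) w.divisors (fun m => by simp [hw.ne'])]
  refine Finset.sum_congr rfl fun m _ => ?_
  simp [orbLen, mul_comm]

theorem card_omega {m : ℕ} (hm : 0 < m) (d : ℕ) : (Nat.card (omega m d) : ℚ) =
    1 / (m : ℚ) * ∑ i ∈ m.divisors, (ArithmeticFunction.moebius (m / i) : ℚ) * (d : ℚ) ^ i := by
  have h := (ArithmeticFunction.sum_eq_iff_sum_mul_moebius_eq
    (f := fun n => (n : ℚ) * Nat.card (omega n d)) (g := fun n => (d : ℚ) ^ n)).mp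
    (fun n hn => by exact_mod_cast sum_divisors_card hn d) m hm
  rw [Nat.sum_divisorsAntidiagonal'
    (f := fun a b => (ArithmeticFunction.moebius a : ℚ) * (d : ℚ) ^ b)] at h
  rw [h]
  field_simp

end Necklaces

end CyclicHom

end

noncomputable section

namespace CyclicHom

/-! ### The bottom row as a signed permutation module -/

section Final

variable {d w : ℕ}

/-- A word in the variables as a list. -/
def wordList (u : Fin w → Fin d) : List (Option (Fin d)) := List.ofFn fun i => some (u i)

theorem wordList_injective : Function.Injective (wordList (w := w) (d := d)) := fun u v h => by
  have := List.ofFn_injective h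
  funext i
  exact Option.some_injective _ (congr_fun this i)

theorem wordList_mem (u : Fin w → Fin d) :
    wordList u ∈ {l : List (Option (Fin d)) | l.length = w ∧ wt l = w} := by
  refine ⟨by simp [wordList], ?_⟩
  rw [wordList, wt_ofFn]
  simp

theorem exists_wordList_eq {l : List (Option (Fin d))} (hl : l.length = w) (hw : wt l = w) :
    ∃ u : Fin w → Fin d, wordList u = l := by
  have h : ∀ i : Fin w, ∃ a, l.get (i.cast hl.symm) = some a := fun i => by
    rw [← Option.isSome_iff_exists]
    exact List.countP_eq_length.mp (hw.trans hl.symm) _ (List.get_mem _ _)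
  choose u hu using h
  refine ⟨u, List.ext_getElem (by simp [wordList, hl]) fun i h1 h2 => ?_⟩
  have h : (wordList u)[i] = some (u ⟨i, hl ▸ h2⟩) := by simp [wordList]
  rw [h, ← hu]
  simp

theorem rotR_wordList (u : Fin w → Fin d) : rotR (wordList u) = wordList (wordRot w d u) := by
  rcases w with _ | k
  · simp [wordList]
  · rw [wordList, List.ofFn_succ', List.concat_eq_append, rotR_append, wordList, List.ofFn_succ]
    congr 1
    congr 1
    funext i
    rw [wordRot]
    congr 2
    rw [eq_comm, Equiv.symm_apply_eq, finRotate_apply]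
    simp

/-- The embedding of the signed permutation module into the span of words. -/
def rowEmb (w d : ℕ) : ((Fin w → Fin d) →₀ ℤ) →ₗ[ℤ] Wd (Fin d) :=
  Finsupp.lmapDomain ℤ ℤ wordList

/-- The projection of the span of words onto the signed permutation module. -/
def rowProj (w d : ℕ) : Wd (Fin d) →ₗ[ℤ] ((Fin w → Fin d) →₀ ℤ) :=
  Finsupp.lcomapDomain wordList wordList_injective

theorem rowProj_rowEmb (v : (Fin w → Fin d) →₀ ℤ) : rowProj w d (rowEmb w d v) = v :=
  Finsupp.comapDomain_mapDomain _ wordList_injective v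

theorem rowEmb_single (u : Fin w → Fin d) :
    rowEmb w d (Finsupp.single u 1) = ww (wordList u) := by
  simp [rowEmb, ww]

theorem rowEmb_mem (v : (Fin w → Fin d) →₀ ℤ) : rowEmb w d v ∈ homPart (Fin d) w w := by
  induction v using Finsupp.induction_linear with
  | zero => simp
  | add f g hf hg => rw [map_add]; exact Submodule.add_mem _ hf hg
  | single u a =>
    rw [← mul_one a, ← smul_eq_mul, ← Finsupp.smul_single, map_smul, rowEmb_single]
    exact Submodule.smul_mem _ _ (ww_mem_homPart (wordList_mem u).1 (wordList_mem u).2)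

theorem rowEmb_rowProj {x : Wd (Fin d)} (hx : x ∈ homPart (Fin d) w w) :
    rowEmb w d (rowProj w d x) = x := by
  refine supported_ext (f := rowEmb w d ∘ₗ rowProj w d) (g := LinearMap.id) (fun l hl => ?_) hx
  obtain ⟨u, rfl⟩ := exists_wordList_eq hl.1 hl.2
  rw [LinearMap.comp_apply, ← rowEmb_single, rowProj_rowEmb, LinearMap.id_apply]

theorem rowEmb_injective : Function.Injective (rowEmb w d) := fun u v h => by
  rw [← rowProj_rowEmb u, h, rowProj_rowEmb]

theorem tcyc_rowEmb (v : (Fin w → Fin d) →₀ ℤ) :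
    tcyc (Fin d) (rowEmb w d v) = rowEmb w d (sgnT (wordRot w d) ((-1) ^ (w + 1)) v) := by
  have : tcyc (Fin d) ∘ₗ rowEmb w d = rowEmb w d ∘ₗ sgnT (wordRot w d) ((-1) ^ (w + 1)) :=
    Finsupp.lhom_ext' fun u => LinearMap.ext_ring <| by
      change tcyc (Fin d) (rowEmb w d (Finsupp.single u 1)) =
        rowEmb w d (sgnT _ _ (Finsupp.single u 1))
      rw [rowEmb_single, tcyc_ww, sgnT_single, ← smul_eq_mul, ← Finsupp.smul_single, map_smul,
        rowEmb_single, rotR_wordList, (wordList_mem u).1]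
  exact LinearMap.congr_fun this v

theorem nrm_rowEmb (v : (Fin w → Fin d) →₀ ℤ) :
    nrm (Fin d) (rowEmb w d v) = rowEmb w d (sgnN (wordRot w d) ((-1) ^ (w + 1)) w v) := by
  have hpow : ∀ (i : ℕ) (v : (Fin w → Fin d) →₀ ℤ), (tcyc (Fin d) ^ i) (rowEmb w d v) =
      rowEmb w d ((sgnT (wordRot w d) ((-1) ^ (w + 1)) ^ i) v) := by
    intro i
    induction i with
    | zero => intro v; rfl
    | succ i ih =>
      intro v
      rw [pow_succ (tcyc _), pow_succ (sgnT _ _), Module.End.mul_apply, Module.End.mul_apply,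
        tcyc_rowEmb, ih]
  rw [nrm_of_mem (homPart_le_lenPart _ _ (rowEmb_mem v)), sgnN, LinearMap.sum_apply, map_sum]
  simp only [hpow]

/-- The differentials of the bottom row. -/
def rowD (w d j : ℕ) : ((Fin w → Fin d) →₀ ℤ) →ₗ[ℤ] ((Fin w → Fin d) →₀ ℤ) :=
  if Even j then LinearMap.id - sgnT (wordRot w d) ((-1) ^ (w + 1))
  else sgnN (wordRot w d) ((-1) ^ (w + 1)) w

theorem horizL_rowEmb (j : ℕ) (v : (Fin w → Fin d) →₀ ℤ) :
    horizL (Fin d) j (rowEmb w d v) = rowEmb w d (rowD w d j v) := by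
  unfold horizL rowD
  split_ifs
  · simp [tcyc_rowEmb]
  · exact nrm_rowEmb v

theorem rowD_even {j : ℕ} (hj : Even j) (v : (Fin w → Fin d) →₀ ℤ) :
    rowD w d j v = v - sgnT (wordRot w d) ((-1) ^ (w + 1)) v := by simp [rowD, hj]

theorem rowD_odd {j : ℕ} (hj : ¬ Even j) (v : (Fin w → Fin d) →₀ ℤ) :
    rowD w d j v = sgnN (wordRot w d) ((-1) ^ (w + 1)) w v := by simp [rowD, hj]

/-- `HC` in positive weight is the homology of the bottom row. -/
theorem nonempty_HC_equiv_of_row {n j : ℕ} (hj : j + w = n + 1) (hw : 0 < w) {G : Type*}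
    [AddCommGroup G] (θ : ((Fin w → Fin d) →₀ ℤ) →ₗ[ℤ] G)
    (hsurj : ∀ y, ∃ v, (∀ i, j = i + 1 → rowD w d i v = 0) ∧ θ v = y)
    (hker : ∀ v, (∀ i, j = i + 1 → rowD w d i v = 0) → (θ v = 0 ↔ ∃ u, rowD w d j u = v)) :
    Nonempty (HC ℤ d n w ≃+ G) := by
  refine nonempty_HC_equiv (θ ∘ₗ rowProj w d ∘ₗ phi (Fin d) j) (fun y => ?_) (fun f hf hD => ?_)
  · obtain ⟨v, hv, hy⟩ := hsurj y
    refine ⟨Pi.single j (rowEmb w d v), bottom_mem hj hw (rowEmb_mem v), ?_, ?_⟩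
    -- Nothing leaves column 0, which is why the cycle condition only speaks of j = i + 1.
    · rcases j with _ | j
      · exact famD_bottom_zero (rowEmb_mem v)
      · rw [famD_bottom_succ (rowEmb_mem v), horizL_rowEmb, hv j rfl, map_zero, Pi.single_zero]
    · rw [LinearMap.comp_apply, LinearMap.comp_apply, phi_single, rowProj_rowEmb, hy]
  · have hmem := phi_mem hj hw hf
    rw [exists_famD_iff hj hw hf hD, LinearMap.comp_apply, LinearMap.comp_apply, hker]
    · constructor
      · rintro ⟨u, hu⟩
        exact ⟨rowEmb w d u, rowEmb_mem u, by rw [horizL_rowEmb, hu, rowEmb_rowProj hmem]⟩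
      · rintro ⟨m, hm, hmf⟩
        refine ⟨rowProj w d m, rowEmb_injective ?_⟩
        rw [← horizL_rowEmb, rowEmb_rowProj hm, rowEmb_rowProj hmem, hmf]
    · rintro i rfl
      apply rowEmb_injective
      rw [← horizL_rowEmb, rowEmb_rowProj hmem, map_zero]
      exact horizL_phi hj hw hf hD

/-! ### The groups -/

theorem nonempty_HC_zero_even (d : ℕ) {n : ℕ} (hn : Even n) : Nonempty (HC ℤ d n 0 ≃+ ℤ) := by
  have hone : ∀ m ∈ homPart (Fin d) 1 0, m = m [none] • ww [none] := fun m hm => by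
    refine supported_ext (f := LinearMap.id)
      (g := (Finsupp.lapply [none]).smulRight (ww [none])) (fun l hl => ?_) hm
    obtain ⟨a, rfl⟩ := List.length_eq_one_iff.mp hl.1
    have h := hl.2
    rcases a with _ | a
    · simp [ww]
    · simp at h
  have hmem : ∀ f ∈ famPart (Fin d) n 0, f n ∈ homPart (Fin d) 1 0 := fun f hf => by
    simpa using (mem_famPart.mp hf).1 n le_rfl
  refine nonempty_HC_equiv (Finsupp.lapply [none] ∘ₗ
    LinearMap.proj (φ := fun _ : ℕ => Wd (Fin d)) n) (fun y => ?_) (fun f hf hD => ?_)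
  · obtain ⟨f, hf, hD, hfn⟩ := exists_cycle_weight_zero (α := Fin d) hn (m := y • ww [none])
      (Submodule.smul_mem _ _ (ww_mem_homPart rfl rfl))
    refine ⟨f, hf, hD, ?_⟩
    simp [hfn, ww]
  · constructor
    · intro h
      have h0 : f n = 0 := by
        rw [hone _ (hmem f hf)]
        have : f n [none] = 0 := h
        rw [this, zero_smul]
      obtain ⟨g, hg, hgf, -⟩ := exists_famD_eq_of_weight_zero (i := n + 1) hf hD (fun _ => h0)
        (fun p hp => (mem_famPart.mp hf).2 p (by omega))
      exact ⟨g, hg, hgf⟩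
    · rintro ⟨g, hg, rfl⟩
      have := famD_apply_top_of_weight_zero hn hg
      simp [this]

theorem subsingleton_HC_zero_odd (d : ℕ) {n : ℕ} (hn : ¬ Even n) : Subsingleton (HC ℤ d n 0) := by
  obtain ⟨e⟩ := nonempty_HC_equiv (d := d) (n := n) (w := 0) (G := PUnit.{1}) 0
    (fun y => ⟨0, Submodule.zero_mem _, map_zero _, rfl⟩) (fun f hf hD => by
      obtain ⟨g, hg, hgf, -⟩ := exists_famD_eq_of_weight_zero (i := n + 1) hf hD
        (fun h => absurd h hn) (fun p hp => (mem_famPart.mp hf).2 p (by omega))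
      exact ⟨fun _ => ⟨g, hg, hgf⟩, fun _ => rfl⟩)
  exact e.toEquiv.subsingleton

/-- Words in degree `n` have at most n + 1 letters, too few for weight `w`. -/
theorem subsingleton_HC_of_lt (d : ℕ) {n w : ℕ} (h : n + 2 ≤ w) : Subsingleton (HC ℤ d n w) := by
  obtain ⟨e⟩ := nonempty_HC_equiv (d := d) (n := n) (w := w) (G := PUnit.{1}) 0
    (fun y => ⟨0, Submodule.zero_mem _, map_zero _, rfl⟩) (fun f hf hD => by
      have hf' := mem_famPart.mp hf
      have : f = 0 := by
        funext p
        by_cases hp : p ≤ n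
        · exact homPart_eq_zero (by omega) (hf'.1 p hp)
        · exact hf'.2 p (by omega)
      subst this
      exact ⟨fun _ => ⟨0, Submodule.zero_mem _, map_zero _⟩, fun _ => rfl⟩)
  exact e.toEquiv.subsingleton

/-- A direct sum over divisors and cycle families is a product. -/
theorem nonempty_directSum_equiv (hw : 0 < w) (P : ℕ → Prop)
    (G : {m : ℕ // m ∣ w ∧ P m} → Type) [∀ m, AddCommGroup (G m)] :
    Nonempty ((∀ m : {m : ℕ // m ∣ w ∧ P m}, omega m.1 d → G m) ≃+
      ⨁ m : {m : ℕ // m ∣ w ∧ P m}, ⨁ _ : omega m.1 d, G m) := by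
  have : Finite {m : ℕ // m ∣ w ∧ P m} :=
    Set.Finite.to_subtype ((Set.finite_Iic w).subset fun _ h => Nat.le_of_dvd hw h.1)
  have := Fintype.ofFinite {m : ℕ // m ∣ w ∧ P m}
  have := fun m : {m : ℕ // m ∣ w ∧ P m} => Fintype.ofFinite (omega m.1 d)
  exact ⟨((DirectSum.addEquivProd _).trans
    (AddEquiv.piCongrRight fun m => DirectSum.addEquivProd fun _ => G m)).symm⟩

/-- The indices of the orbits on which the cyclic group acts without sign. -/
abbrev evenIdx (w : ℕ) : Type := {m : ℕ // m ∣ w ∧ m ≡ w [MOD 2]}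

/-- The indices of the orbits on which the cyclic group acts with a sign. -/
abbrev oddIdx (w : ℕ) : Type := {m : ℕ // m ∣ w ∧ ¬ m ≡ w [MOD 2]}

/-- The signed orbit sum attached to a cycle family. -/
def famSum (hw : 0 < w) {m : ℕ} (hm : m ∣ w) (F : omega m d) :
    ((Fin w → Fin d) →₀ ℤ) →ₗ[ℤ] ℤ :=
  orbitSum (wordRot w d) ((-1) ^ (w + 1)) (orbRep hw) orbLen ⟨⟨m, hm⟩, F⟩

theorem sub_range_iff (hw : 0 < w) (x : (Fin w → Fin d) →₀ ℤ) :
    (∃ y, y - sgnT (wordRot w d) ((-1) ^ (w + 1)) y = x) ↔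
      (∀ (m : evenIdx w) (F : omega m.1 d), famSum hw m.2.1 F x = 0) ∧
      ∀ (m : oddIdx w) (F : omega m.1 d), ((famSum hw m.2.1 F x : ℤ) : ZMod 2) = 0 := by
  have := finite_orbitIdx (d := d) hw
  have := Fintype.ofFinite (OrbitIdx w d)
  rw [(orbitSystem hw d).mem_range_sub_iff]
  constructor
  · intro h
    refine ⟨fun m F => (h ⟨⟨m.1, m.2.1⟩, F⟩).1 (sign_of_modEq m.2.2), fun m F => ?_⟩
    rw [ZMod.intCast_zmod_eq_zero_iff_dvd]
    exact (h ⟨⟨m.1, m.2.1⟩, F⟩).2 (sign_of_not_modEq m.2.1 m.2.2)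
  · rintro ⟨h1, h2⟩ ⟨⟨m, hm⟩, F⟩
    by_cases hmw : m ≡ w [MOD 2]
    · have hs : ((-1 : ℤ) ^ (w + 1)) ^ m = 1 := sign_of_modEq hmw
      refine ⟨fun _ => h1 ⟨m, hm, hmw⟩ F, fun h => ?_⟩
      change ((-1 : ℤ) ^ (w + 1)) ^ m = -1 at h
      rw [hs] at h
      norm_num at h
    · have hs : ((-1 : ℤ) ^ (w + 1)) ^ m = -1 := sign_of_not_modEq hm hmw
      refine ⟨fun h => ?_, fun _ => ?_⟩
      · change ((-1 : ℤ) ^ (w + 1)) ^ m = 1 at h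
        rw [hs] at h
        norm_num at h
      · have := h2 ⟨m, hm, hmw⟩ F
        rw [ZMod.intCast_zmod_eq_zero_iff_dvd] at this
        exact this

theorem exists_famSum (hw : 0 < w) (y : ∀ m : evenIdx w, omega m.1 d → ℤ)
    (z : ∀ m : oddIdx w, omega m.1 d → ZMod 2) :
    ∃ x : (Fin w → Fin d) →₀ ℤ, (∀ m F, famSum hw m.2.1 F x = y m F) ∧
      (∀ m F, ((famSum hw m.2.1 F x : ℤ) : ZMod 2) = z m F) ∧
      (y = 0 → sgnN (wordRot w d) ((-1) ^ (w + 1)) w x = 0) := by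
  classical
  have := finite_orbitIdx (d := d) hw
  have := Fintype.ofFinite (OrbitIdx w d)
  -- On orbits with sign -1 only the orbit sum modulo 2 is prescribed, so any integer lift serves.
  choose lift hlift using fun a : ZMod 2 => ZMod.intCast_surjective a
  obtain ⟨x, hx, hN⟩ := (orbitSystem hw d).exists_orbitSum_eq fun c =>
    if h : c.1.1 ≡ w [MOD 2] then y ⟨c.1.1, c.1.2, h⟩ c.2 else lift (z ⟨c.1.1, c.1.2, h⟩ c.2)
  refine ⟨x, fun m F => ?_, fun m F => ?_, fun hy => hN fun c hc => ?_⟩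
  · rw [famSum, hx]; exact dif_pos m.2.2
  · rw [famSum, hx]
    refine Eq.trans ?_ (hlift (z m F))
    congr 1
    exact dif_neg m.2.2
  · by_cases h : c.1.1 ≡ w [MOD 2]
    · simp [h, hy]
    · have hs : ((-1 : ℤ) ^ (w + 1)) ^ orbLen c = -1 := sign_of_not_modEq c.1.2 h
      rw [hs] at hc
      norm_num at hc

/-- Reduction modulo `n`, as a `ℤ`-linear map. -/
def castLin (n : ℕ) : ℤ →ₗ[ℤ] ZMod n := (Int.castAddHom (ZMod n)).toIntLinearMap

/-- This is column 0 of the row, where the homology is the coinvariants of the rotation. -/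
theorem nonempty_HC_bottom (d : ℕ) {w : ℕ} (hw : 0 < w) :
    Nonempty (HC ℤ d (w - 1) w ≃+
      (⨁ m : {m : ℕ // m ∣ w ∧ m ≡ w [MOD 2]}, ⨁ _ : omega m.1 d, ℤ) ×
      (⨁ m : {m : ℕ // m ∣ w ∧ ¬ m ≡ w [MOD 2]}, ⨁ _ : omega m.1 d, ZMod 2)) := by
  obtain ⟨e1⟩ := nonempty_directSum_equiv (d := d) hw (fun m => m ≡ w [MOD 2]) fun _ => ℤ
  obtain ⟨e2⟩ := nonempty_directSum_equiv (d := d) hw (fun m => ¬ m ≡ w [MOD 2]) fun _ => ZMod 2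
  obtain ⟨e⟩ := nonempty_HC_equiv_of_row (d := d) (n := w - 1) (j := 0) (w := w) (by omega) hw
    (G := (∀ m : evenIdx w, omega m.1 d → ℤ) × (∀ m : oddIdx w, omega m.1 d → ZMod 2))
    ((LinearMap.pi fun m => LinearMap.pi fun F => famSum hw m.2.1 F).prod
      (LinearMap.pi fun m => LinearMap.pi fun F => castLin 2 ∘ₗ famSum hw m.2.1 F))
    (fun y => by
      obtain ⟨x, h1, h2, -⟩ := exists_famSum hw y.1 y.2
      exact ⟨x, fun i hi => by omega, Prod.ext (funext fun m => funext fun F => h1 m F)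
        (funext fun m => funext fun F => h2 m F)⟩)
    (fun v _ => by
      simp only [rowD_even Even.zero, sub_range_iff hw]
      rw [Prod.ext_iff]
      simp only [funext_iff]
      rfl)
  exact ⟨e.trans (AddEquiv.prodCongr e1 e2)⟩

/-- In an odd column the homology is invariants modulo norms, read off from the coefficients at the
orbit representatives. -/
theorem nonempty_HC_even (d : ℕ) {w : ℕ} (hw : 0 < w) (i : ℕ) :
    Nonempty (HC ℤ d (w + 2 * i) w ≃+
      ⨁ m : {m : ℕ // m ∣ w ∧ m ≡ w [MOD 2]}, ⨁ _ : omega m.1 d, ZMod (w / m.1)) := by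
  classical
  have := finite_orbitIdx (d := d) hw
  have := Fintype.ofFinite (OrbitIdx w d)
  have H := orbitSystem hw d
  obtain ⟨e1⟩ := nonempty_directSum_equiv (d := d) hw (fun m => m ≡ w [MOD 2])
    fun m => ZMod (w / m.1)
  obtain ⟨e⟩ := nonempty_HC_equiv_of_row (d := d) (n := w + 2 * i) (j := 2 * i + 1) (w := w)
    (by omega) hw (G := ∀ m : evenIdx w, omega m.1 d → ZMod (w / m.1))
    (LinearMap.pi fun m => LinearMap.pi fun F =>
      castLin (w / m.1) ∘ₗ Finsupp.lapply (orbRep hw ⟨⟨m.1, m.2.1⟩, F⟩))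
    (fun y => by
      choose lift hlift using fun (n : ℕ) (a : ZMod n) => ZMod.intCast_surjective a
      obtain ⟨x, hx, hxy⟩ := H.exists_invariant
        -- An invariant element vanishes on orbits with sign -1, hence the value 0 there.
        (fun c => if h : c.1.1 ≡ w [MOD 2] then lift _ (y ⟨c.1.1, c.1.2, h⟩ c.2) else 0)
        (fun c hc => by
          refine dif_neg fun h => ?_
          have hs : ((-1 : ℤ) ^ (w + 1)) ^ orbLen c = 1 := sign_of_modEq h
          rw [hs] at hc
          norm_num at hc)
      refine ⟨x, fun k hk => ?_, funext fun m => funext fun F => ?_⟩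
      · obtain rfl : k = 2 * i := by omega
        rw [rowD_even (even_two_mul i), hx, sub_self]
      · change ((x (orbRep hw ⟨⟨m.1, m.2.1⟩, F⟩) : ℤ) : ZMod (w / m.1)) = y m F
        rw [hxy]
        refine Eq.trans ?_ (hlift _ (y m F))
        congr 1
        exact dif_pos m.2.2)
    (fun v hv => by
      have hv' := hv (2 * i) rfl
      rw [rowD_even (even_two_mul i), sub_eq_zero] at hv'
      have hodd : ¬ Even (2 * i + 1) := by simp
      simp only [rowD_odd hodd]
      rw [H.mem_range_N_iff hv'.symm, funext_iff]
      simp only [funext_iff]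
      constructor
      · rintro h ⟨⟨m, hm⟩, F⟩ hc
        rw [← ZMod.intCast_zmod_eq_zero_iff_dvd]
        by_cases hmw : m ≡ w [MOD 2]
        · exact h ⟨m, hm, hmw⟩ F
        · have hs : ((-1 : ℤ) ^ (w + 1)) ^ m = -1 := sign_of_not_modEq hm hmw
          change ((-1 : ℤ) ^ (w + 1)) ^ m = 1 at hc
          rw [hs] at hc
          norm_num at hc
      · intro h m F
        have := h ⟨⟨m.1, m.2.1⟩, F⟩ (sign_of_modEq m.2.2)
        rw [← ZMod.intCast_zmod_eq_zero_iff_dvd] at this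
        exact this)
  exact ⟨e.trans e1⟩

/-- In an even column beyond the first the homology is the kernel of `N` modulo the image of 1 - t.
The kernel condition kills the orbit sums of sign 1, leaving only those of sign -1 modulo 2. -/
theorem nonempty_HC_odd (d : ℕ) {w : ℕ} (hw : 0 < w) (i : ℕ) :
    Nonempty (HC ℤ d (w + 1 + 2 * i) w ≃+
      ⨁ m : {m : ℕ // m ∣ w ∧ ¬ m ≡ w [MOD 2]}, ⨁ _ : omega m.1 d, ZMod 2) := by
  have := finite_orbitIdx (d := d) hw
  have := Fintype.ofFinite (OrbitIdx w d)
  have H := orbitSystem hw d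
  have hodd : ¬ Even (2 * i + 1) := by simp
  have heven : Even (2 * i + 2) := ⟨i + 1, by omega⟩
  obtain ⟨e2⟩ := nonempty_directSum_equiv (d := d) hw (fun m => ¬ m ≡ w [MOD 2]) fun _ => ZMod 2
  obtain ⟨e⟩ := nonempty_HC_equiv_of_row (d := d) (n := w + 1 + 2 * i) (j := 2 * i + 2) (w := w)
    (by omega) hw (G := ∀ m : oddIdx w, omega m.1 d → ZMod 2)
    (LinearMap.pi fun m => LinearMap.pi fun F => castLin 2 ∘ₗ famSum hw m.2.1 F)
    (fun y => by
      obtain ⟨x, -, h2, h3⟩ := exists_famSum hw 0 y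
      refine ⟨x, fun k hk => ?_, funext fun m => funext fun F => h2 m F⟩
      obtain rfl : k = 2 * i + 1 := by omega
      rw [rowD_odd hodd, h3 rfl])
    (fun v hv => by
      have hv' := hv (2 * i + 1) rfl
      rw [rowD_odd hodd] at hv'
      simp only [rowD_even heven, sub_range_iff hw]
      have h1 : ∀ (m : evenIdx w) (F : omega m.1 d), famSum hw m.2.1 F v = 0 := fun m F =>
        H.orbitSum_eq_zero_of_N hv' (sign_of_modEq m.2.2)
      rw [and_iff_right h1, funext_iff]
      simp only [funext_iff]
      rfl)
  exact ⟨e.trans e2⟩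

end Final

end CyclicHom

end

theorem mainTheorem2 (d : ℕ) :
    (∀ n : ℕ, Even n → Nonempty (CyclicHom.HC ℤ d n 0 ≃+ ℤ)) ∧
    (∀ n : ℕ, ¬ Even n → Subsingleton (CyclicHom.HC ℤ d n 0)) ∧
    (∀ w : ℕ, 0 < w →
      (∀ n : ℕ, n + 2 ≤ w → Subsingleton (CyclicHom.HC ℤ d n w)) ∧
      Nonempty (CyclicHom.HC ℤ d (w - 1) w ≃+
        (⨁ m : {m : ℕ // m ∣ w ∧ m ≡ w [MOD 2]}, ⨁ _ : CyclicHom.omega m.1 d, ℤ) ×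
        (⨁ m : {m : ℕ // m ∣ w ∧ ¬ m ≡ w [MOD 2]}, ⨁ _ : CyclicHom.omega m.1 d, ZMod 2)) ∧
      (∀ i : ℕ, Nonempty (CyclicHom.HC ℤ d (w + 2 * i) w ≃+
        ⨁ m : {m : ℕ // m ∣ w ∧ m ≡ w [MOD 2]}, ⨁ _ : CyclicHom.omega m.1 d, ZMod (w / m.1))) ∧
      (∀ i : ℕ, Nonempty (CyclicHom.HC ℤ d (w + 1 + 2 * i) w ≃+
        ⨁ m : {m : ℕ // m ∣ w ∧ ¬ m ≡ w [MOD 2]}, ⨁ _ : CyclicHom.omega m.1 d, ZMod 2))) ∧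
    (∀ m : ℕ, 0 < m →
      (Nat.card (CyclicHom.omega m d) : ℚ) =
        1 / (m : ℚ) * ∑ i ∈ m.divisors, (ArithmeticFunction.moebius (m / i) : ℚ) * (d : ℚ) ^ i) := by
  refine ⟨fun n hn => CyclicHom.nonempty_HC_zero_even d hn,
    fun n hn => CyclicHom.subsingleton_HC_zero_odd d hn, fun w hw => ⟨fun n hn => ?_, ?_, ?_, ?_⟩,
    fun m hm => CyclicHom.card_omega hm d⟩
  · exact CyclicHom.subsingleton_HC_of_lt d hn
  · exact CyclicHom.nonempty_HC_bottom d hw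
  · exact CyclicHom.nonempty_HC_even d hw
  · exact CyclicHom.nonempty_HC_odd d hw
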